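/- **Machine model.** A Turing machine here is a nondeterministic multi-tape machine with a finite state set, finite tape alphabet, and $t+u\ge 1$ one-sided infinite tapes; the first $t$ tapes are called external, the other $u$ internal, and the input is written on the first tape. Machines are normalized: in each step at most one head moves. For a run $\rho$ and a tape $i$, $\mathrm{rev}(\rho,i)$ is the number of times the head on tape $i$ changes its direction, and $\mathrm{space}(\rho,i)$ is the number of cells of tape $i$ that are used. For $r,s:\mathbb N\to\mathbb N$, a machine is $(r,s,t)$-bounded if it has $t$ external tapes and every run $\rho$ on every input of length $N$ is finite and satisfies $1+\sum_{i=1}^{t}\mathrm{rev}(\rho,i)\le r(N)$ and $\sum_{i=t+1}^{t+u}\mathrm{space}(\rho,i)\le s(N)$ (the number $u$ is arbitrary). $\mathrm{NST}(r,s,t)$ is the class of decision problems decided by a nondeterministic $(r,s,t)$-bounded machine. In a randomized machine, each step chooses uniformly among the possible successor configurations; the probability of a run is the product of the probabilities of its steps, and $\Pr(T\text{ accepts }w)$ is the sum of the probabilities of the accepting runs of $T$ on $w$. $\mathrm{RST}(r,s,t)$ is the class of decision problems $L$ for which there is an $(r,s,t)$-bounded machine $T$ with $\Pr(T\text{ accepts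 }w)\ge\frac12$ for all inputs $w\in L$ and $\Pr(T\text{ accepts }w)=0$ for all inputs $w\notin L$. We write $O(\log N)$ in place of $s$ for the union of the classes over all $s\in O(\log N)$; an integer in place of $r$ denotes a constant function. $\mathrm{co}\text{-}C$ is the class of decision problems whose complements belong to $C$. **Problems.** Instances of the following problems are the words $v_1\#\cdots v_m\#v_1'\#\cdots v_m'\#$ over $\{0,1,\#\}$ with $m\ge 0$ and $v_i,v_i'\in\{0,1\}^*$. Multiset-Equality: decide whether the multisets $\{v_1,\dots,v_m\}$ and $\{v_1',\dots,v_m'\}$ are equal. Set-Equality: decide whether the sets $\{v_1,\dots,v_m\}$ and $\{v_1',\dots,v_m'\}$ are equal. CheckSort: decide whether $v_1',\dots,v_m'$ is the lexicographically sorted (in ascending order) version of $v_1,\dots,v_m$. Each problem is identified with the set of its yes-instances, as a language over $\{0,1,\#\}$. **Theorem 8.** (a) Multiset-Equality belongs to $\mathrm{co}\text{-}\mathrm{RST}(2,O(\log N),1)$, and $\mathrm{co}\text{-}\mathrm{RST}(2,O(\log N),1)\subseteq\mathrm{co}\text{-}\mathrm{NST}(2,O(\log N),1)$. (b) Each of the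 problems Multiset-Equality, CheckSort and Set-Equality belongs to $\mathrm{NST}(3,O(\log N),2)$. -/

import Mathlib

open scoped ENNReal

/-! ## Multi-tape nondeterministic Turing machines -/

/-- Head movements. -/
inductive Move : Type
  | left
  | stay
  | right

/-- `m.Moves p p'`: a head at cell `p` is at cell `p'` after the movement `m`.  Tapes are one-sided
infinite, with cells `0, 1, 2, …`; a head at cell `0` cannot move to the left. -/
def Move.Moves : Move → ℕ → ℕ → Prop
  | .left, p, p' => p = p' + 1
  | .stay, p, p' => p' = p
  | .right, p, p' => p' = p + 1

/-- Normalized nondeterministic Turing machines with input alphabet `α`, `t` external memory tapes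
(the tapes `i` with `i < t`) and `u` internal memory tapes (the tapes `i` with `t ≤ i < t + u`). -/
structure NTM (α : Type) (t u : ℕ) where
  /-- the state space -/
  Q : Type
  /-- the tape alphabet -/
  Γ : Type
  [finite_Q : Finite Q]
  [finite_Γ : Finite Γ]
  /-- there is an input tape -/
  tapes_pos : 0 < t + u
  /-- the blank symbol -/
  blank : Γ
  /-- the input alphabet as a part of the tape alphabet -/
  inp : α ↪ Γ
  inp_ne_blank : ∀ a, inp a ≠ blank
  /-- the start state -/
  start : Q
  /-- the final states -/
  final : Set Q
  /-- the accepting states -/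
  accepting : Set Q
  accepting_subset : accepting ⊆ final
  /-- The transition relation: `Δ q a q' b d` says that in state `q`, reading the symbols `a`, the
  machine may go to state `q'`, write the symbols `b` and move its heads according to `d`. -/
  Δ : Q → (Fin (t + u) → Γ) → Q → (Fin (t + u) → Γ) → (Fin (t + u) → Move) → Prop
  not_final_of_Δ : ∀ {q a q' b d}, Δ q a q' b d → q ∉ final
  /-- the machine is normalized: in each step at most one head moves -/
  normalized : ∀ {q a q' b d}, Δ q a q' b d → ∀ i j, d i ≠ .stay → d j ≠ .stay → i = j

namespace NTM

variable {α : Type} {t u : ℕ}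

/-- Configurations: state, head positions, tape inscriptions. -/
@[ext] structure Cfg (T : NTM α t u) where
  state : T.Q
  head : Fin (t + u) → ℕ
  tape : Fin (t + u) → ℕ → T.Γ

/-- The initial configuration on input `w`: the input is on the first tape, all other cells are
blank, all heads are on the first cell of their tape. -/
def init (T : NTM α t u) (w : List α) : T.Cfg where
  state := T.start
  head := fun _ => 0
  tape := fun i p => if i.val = 0 then (w[p]?).elim T.blank T.inp else T.blank

/-- `c'` can be reached from `c` in a single computation step. -/
def Step (T : NTM α t u) (c c' : T.Cfg) : Prop :=
  ∃ b d, T.Δ c.state (fun i => c.tape i (c.head i)) c'.state b d ∧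
    (∀ i, (d i).Moves (c.head i) (c'.head i)) ∧
    ∀ i, c'.tape i = Function.update (c.tape i) (c.head i) (b i)

/-- The set of all configurations that can be reached from `c` in a single step. -/
def Next (T : NTM α t u) (c : T.Cfg) : Set T.Cfg := {c' | T.Step c c'}

/-- Finite computations on input `w`: finite sequences of configurations that start with the
initial configuration and in which each configuration is followed by one of its successors.
They need not be complete, i.e. need not end in a final configuration. -/
def IsComputation (T : NTM α t u) (w : List α) (ρ : List T.Cfg) : Prop :=
  ρ.head? = some (T.init w) ∧ ρ.IsChain T.Step

/-- Accepting runs on input `w`: finite computations that end in an accepting configuration. -/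
def IsAcceptingRun (T : NTM α t u) (w : List α) (ρ : List T.Cfg) : Prop :=
  T.IsComputation w ρ ∧ ∃ c, ρ.getLast? = some c ∧ c.state ∈ T.accepting

/-- The sequence of the moves (nonzero differences of consecutive positions) of a head that is at
the given positions one after the other. -/
def headMoves (ps : List ℕ) : List ℤ :=
  (List.zipWith (fun p p' : ℕ => (p' : ℤ) - p) ps ps.tail).filter (fun d => d ≠ 0)

/-- The number of times `rev(ρ, i)` the head on tape `i` changes its direction in `ρ`, i.e. the
number of its moves whose direction is not that of its preceding move. -/
def rev {T : NTM α t u} (ρ : List T.Cfg) (i : Fin (t + u)) : ℕ :=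
  let ms := headMoves (ρ.map fun c => c.head i)
  (ms.zip ms.tail).countP fun x => x.1 ≠ x.2

/-- The number `space(ρ, i)` of cells of tape `i` that are used (visited by the head) in `ρ`. -/
def space {T : NTM α t u} (ρ : List T.Cfg) (i : Fin (t + u)) : ℕ :=
  (ρ.map fun c => c.head i).toFinset.card

/-- `(r, s, t)`-bounded machines.  As direction changes and space only grow when a computation is
prolonged, it does not matter that the bounds are stated for incomplete computations, too. -/
def IsBounded (T : NTM α t u) (r s : ℕ → ℕ) : Prop :=
  ∀ w : List α,
    (¬ ∃ f : ℕ → T.Cfg, f 0 = T.init w ∧ ∀ n, T.Step (f n) (f (n + 1))) ∧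
    ∀ ρ, T.IsComputation w ρ →
      1 + ∑ i with i.val < t, rev ρ i ≤ r w.length ∧
      ∑ i with t ≤ i.val, space ρ i ≤ s w.length

/-- The nondeterministic machine `T` decides `L`. -/
def Decides (T : NTM α t u) (L : Set (List α)) : Prop :=
  ∀ w, w ∈ L ↔ ∃ ρ, T.IsAcceptingRun w ρ

/-- The probability of a computation: every successor of a configuration is chosen with uniform
probability, independently in each step. -/
noncomputable def prob (T : NTM α t u) : List T.Cfg → ℝ≥0∞
  | [] => 1
  | [_] => 1
  | c :: c' :: ρ => ((T.Next c).ncard : ℝ≥0∞)⁻¹ * T.prob (c' :: ρ)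

/-- The probability that `T` accepts `w`: the sum of the probabilities of the accepting runs. -/
noncomputable def probAccepts (T : NTM α t u) (w : List α) : ℝ≥0∞ :=
  ∑' ρ : {ρ : List T.Cfg // T.IsAcceptingRun w ρ}, T.prob ρ.1

/-- `T`, as a randomized machine, solves `L` with false negatives of probability at most `1/2` and
without false positives. -/
def SolvesHalfZero (T : NTM α t u) (L : Set (List α)) : Prop :=
  ∀ w, (w ∈ L → 1 / 2 ≤ T.probAccepts w) ∧ (w ∉ L → T.probAccepts w = 0)

end NTM

/-! ## Complexity classes (sets of decision problems over the input alphabet `α`) -/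

/-- `NST(R, S, t)`, the union of the classes `NST(r, s, t)` over all `r ∈ R`, `s ∈ S`. -/
def NST (α : Type) (R S : Set (ℕ → ℕ)) (t : ℕ) : Set (Set (List α)) :=
  {L | ∃ r ∈ R, ∃ s ∈ S, ∃ u, ∃ T : NTM α t u, T.IsBounded r s ∧ T.Decides L}

/-- `RST(R, S, t)`, the union of the classes `RST(r, s, t)` over all `r ∈ R`, `s ∈ S`. -/
def RST (α : Type) (R S : Set (ℕ → ℕ)) (t : ℕ) : Set (Set (List α)) :=
  {L | ∃ r ∈ R, ∃ s ∈ S, ∃ u, ∃ T : NTM α t u, T.IsBounded r s ∧ T.SolvesHalfZero L}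

/-- `co-C`: the decision problems whose complements belong to `C`. -/
def co {α : Type} (C : Set (Set (List α))) : Set (Set (List α)) := {L | Lᶜ ∈ C}

/-- The class of the functions in `O(log N)`. -/
def OLog : Set (ℕ → ℕ) :=
  {s | (fun N => (s N : ℝ)) =O[Filter.atTop] fun N : ℕ => Real.log N}

/-! ## The decision problems -/

/-- The alphabet `{0, 1, #}`. -/
inductive Letter : Type
  | bit (b : Bool)
  | hash

/-- The string `v₁#v₂#⋯vₘ#`. -/
def encodeList (vs : List (List Bool)) : List Letter :=
  vs.flatMap fun v => v.map Letter.bit ++ [Letter.hash]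

/-- The problem to decide for an instance `v₁#⋯vₘ#v'₁#⋯v'ₘ#` if `P [v₁, …, vₘ] [v'₁, …, v'ₘ]`,
as the set of its yes-instances. -/
def listProblem (P : List (List Bool) → List (List Bool) → Prop) : Set (List Letter) :=
  {w | ∃ vs vs' : List (List Bool), vs.length = vs'.length ∧
    w = encodeList vs ++ encodeList vs' ∧ P vs vs'}

def MultisetEquality : Set (List Letter) :=
  listProblem fun vs vs' => (vs : Multiset (List Bool)) = (vs' : Multiset (List Bool))

def SetEquality : Set (List Letter) :=
  listProblem fun vs vs' => {v | v ∈ vs} = {v | v ∈ vs'}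

/-- `≤` on `List Bool` is the lexicographic order. -/
def CheckSort : Set (List Letter) :=
  listProblem fun vs vs' => vs.Perm vs' ∧ vs'.Pairwise (fun x y => x ≤ y)

/-! Fingerprints. A word `v` becomes the monic polynomial `wordPoly F v` whose coefficients after
the leading 1 are its letters, and a list of words becomes the product of the factors `X + C
(wordPoly F v)` in `F[X][X]`, where `F` is a prime field. As `F[X]` is a domain, the roots of the
product with their multiplicities recover the multiset of words (`perm_of_listPoly_eq`). For inputs
of length `n`, two different multisets give polynomials whose difference is nonzero of degree at
most `n` in each variable, so their values agree at no more than `2 * n * q` points of a `q` by `q`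
grid (`card_zeros_le`, `card_listEval_eq_le`). The value at a point is computed letter by letter
with a few numbers modulo `p`.

Randomized algorithm. The forward scan counts letters and words, finds a power `q` of 2 that is at
least `2 * n * n + 1` and a prime `p` with `q < p ≤ 2 * q` (Bertrand), and tosses coins for a point
of the grid. The backward scan evaluates the fingerprints of both halves, with all words reversed.
Equal multisets always have equal values; different ones have equal values with probability at most
1/2. Accepting when the values differ therefore decides the complement with the required one-sided
error. The inclusion of the randomized in the nondeterministic classes holds because every run has
positive probability.

Nondeterministic algorithms. The coins are replaced by all `p * p` points, and each point needs its
own reading of the input `w`. The machine guesses a word `z`, writes it behind `w` on the first tape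
and also on the second tape, and treats the consecutive blocks of `z` of length `n` as readings of
`w`. On the way back it compares `z` with the first letters of `w ++ z`; by periodicity `z` is a
prefix of `w ++ z` exactly if all blocks equal `w` (`prefix_append_iff`), so one comparison
certifies all readings. Multiset equality asks for equal values at all points. Set equality asks
that both fingerprints vanish at the same points (`mem_of_listEval_eq_zero`). CheckSort adds a
letter by letter comparison of neighbouring words of the second half, with one block for each pair
of letters.

Machines. Algorithms are structured programs; the states of a machine are the programs that can
remain to be executed. A program `ite p q r` whose condition never moves an external head to the
left and whose branches never move one to the right reverses each external head at most once, which
gives the bound `1 + t` (`Prog.isBounded_machine`). Internal tapes hold binary numbers bounded by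
the polynomial `regBound`, hence logarithmic space. Correctness is proved for runs with given coin
tosses; `Run.tree` assembles these runs into a tree from which termination, space, acceptance and
probability are read off. -/

/-! ## A structured programming language for Turing machines -/

/-- The tape alphabet of the machines that are constructed below. -/
inductive TSym : Type
  | blank
  | mark
  | bit (b : Bool)
  | hash
  deriving DecidableEq, Fintype

/-- The input alphabet as a part of the tape alphabet. -/
def Letter.sym : Letter → TSym
  | .bit b => .bit b
  | .hash => .hash

theorem Letter.sym_injective : Function.Injective Letter.sym := by
  intro a b h
  cases a <;> cases b <;> simp_all [Letter.sym]

theorem Letter.sym_ne_blank (a : Letter) : a.sym ≠ TSym.blank := by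
  cases a <;> simp [Letter.sym]

/-- Structured programs for a machine with `n` tapes.  Every program returns a truth value:
`op f g i d` reads the symbols `v` under the heads, writes `f v`, moves head `i` according to `d`
and returns `g v`; `flip` returns a random bit; `ite p q r` runs `p` and then `q` or `r` according
to the value returned by `p`; `loop p q` runs `q` as long as `p` returns `true`. -/
inductive Prog (n : ℕ) : Type
  | ret (b : Bool)
  | op (f : (Fin n → TSym) → Fin n → TSym) (g : (Fin n → TSym) → Bool) (i : Fin n) (d : Move)
  | flip
  | ite (p q r : Prog n)
  | loop (p q : Prog n)

/-- What a program does in its next step. -/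
inductive Todo (n : ℕ) : Type
  | halt (b : Bool)
  | det (p : Prog n) (v : Fin n → TSym) (d : Fin n → Move)
  | coin (p q : Prog n)

namespace Prog

variable {n : ℕ}

/-- The next step of a program if `v` are the symbols under the heads. -/
def next : Prog n → (Fin n → TSym) → Todo n
  | ret b, _ => .halt b
  | op f g i d, v => .det (ret (g v)) (f v) (Function.update (fun _ => .stay) i d)
  | flip, _ => .coin (ret true) (ret false)
  | ite p q r, v =>
    match next p v with
    -- Choosing the branch costs a step that writes back what was read, so only `ret` is without a
    -- successor.
    | .halt b => .det (bif b then q else r) v (fun _ => .stay)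
    | .det p' v' d => .det (ite p' q r) v' d
    | .coin p₀ p₁ => .coin (ite p₀ q r) (ite p₁ q r)
  | loop p q, v => .det (ite p (ite q (loop p q) (loop p q)) (ret true)) v (fun _ => .stay)

theorem next_halt {p : Prog n} {v b} (h : p.next v = .halt b) : p = ret b := by
  cases p with
  | ret b' => simpa [next] using h
  | ite p q r =>
    simp only [next] at h
    split at h <;> simp at h
  | _ => simp [next] at h

theorem next_det_normalized {p : Prog n} {v p' v' d} (h : p.next v = .det p' v' d) :
    ∀ i j, d i ≠ .stay → d j ≠ .stay → i = j := by
  induction p generalizing p' with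
  | ret b => simp [next] at h
  | op f g i₀ d₀ =>
    simp only [next, Todo.det.injEq] at h
    obtain ⟨-, -, rfl⟩ := h
    intro i j hi hj
    have key : ∀ k, Function.update (fun _ => Move.stay) i₀ d₀ k ≠ .stay → k = i₀ := by
      intro k hk
      by_contra hne
      exact hk (Function.update_of_ne hne _ _)
    rw [key i hi, key j hj]
  | flip => simp [next] at h
  | ite p q r ihp =>
    simp only [next] at h
    split at h
    · simp only [Todo.det.injEq] at h
      obtain ⟨-, -, rfl⟩ := h
      simp
    · rename_i p₁ v₁ d₁ heq
      simp only [Todo.det.injEq] at h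
      obtain ⟨-, rfl, rfl⟩ := h
      exact ihp heq
    · simp at h
  | loop p q =>
    simp only [next, Todo.det.injEq] at h
    obtain ⟨-, -, rfl⟩ := h
    simp

/-- Probabilities are defined by counting successor configurations. A toss is fair only if its two
successors differ, and they can differ only in the state. -/
theorem next_coin_ne {p : Prog n} {v p₀ p₁} (h : p.next v = .coin p₀ p₁) : p₀ ≠ p₁ := by
  induction p generalizing p₀ p₁ with
  | flip =>
    simp only [next, Todo.coin.injEq] at h
    obtain ⟨rfl, rfl⟩ := h
    simp
  | ite p q r ihp =>
    simp only [next] at h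
    split at h
    · simp at h
    · simp at h
    · rename_i heq
      simp only [Todo.coin.injEq] at h
      obtain ⟨rfl, rfl⟩ := h
      simpa using ihp heq
  | _ => simp [next] at h

/-- `p'` is a possible successor of the program `p`. -/
def IsSucc (p : Prog n) (v : Fin n → TSym) (p' : Prog n) : Prop :=
  match p.next v with
  | .halt _ => False
  | .det q _ _ => p' = q
  | .coin q₀ q₁ => p' = q₀ ∨ p' = q₁

/-- The programs that can remain to be done while `p` is executed. -/
def residuals : Prog n → Set (Prog n)
  | ret b => {ret b}
  | op f g i d => {op f g i d, ret true, ret false}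
  | flip => {flip, ret true, ret false}
  | ite p q r => (fun p' => ite p' q r) '' residuals p ∪ (residuals q ∪ residuals r)
  | loop p q => {loop p q, ret true} ∪
      ((fun p' => ite p' (ite q (loop p q) (loop p q)) (ret true)) '' residuals p ∪
        (fun q' => ite q' (loop p q) (loop p q)) '' residuals q)

/-- This makes the set of states finite: unfolding a loop leads back to the loop itself, so
recursion over the program adds only finitely many residuals. -/
theorem finite_residuals (p : Prog n) : p.residuals.Finite := by
  induction p with
  | ret b => simp [residuals]
  | op f g i d => simp [residuals]
  | flip => simp [residuals]
  | ite p q r ihp ihq ihr => exact (ihp.image _).union (ihq.union ihr)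
  | loop p q ihp ihq => exact (by simp : Set.Finite _).union ((ihp.image _).union (ihq.image _))

theorem self_mem_residuals (p : Prog n) : p ∈ p.residuals := by
  induction p with
  | ite p q r ihp => exact Or.inl ⟨p, ihp, rfl⟩
  | _ => simp [residuals]

theorem isSucc_ite {p q r : Prog n} {v s} (h : (ite p q r).IsSucc v s) :
    (∃ b, p = ret b ∧ s = bif b then q else r) ∨ ∃ p', p.IsSucc v p' ∧ s = ite p' q r := by
  unfold IsSucc at h
  simp only [next] at h
  cases hp : p.next v with
  | halt b => rw [hp] at h; exact Or.inl ⟨b, next_halt hp, h⟩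
  | det p' v' d => rw [hp] at h; exact Or.inr ⟨p', by simp [IsSucc, hp], h⟩
  | coin p₀ p₁ =>
    rw [hp] at h
    rcases h with h | h
    · exact Or.inr ⟨p₀, by simp [IsSucc, hp], h⟩
    · exact Or.inr ⟨p₁, by simp [IsSucc, hp], h⟩

/-- The residuals serve as states, so no step may leave them. -/
theorem residuals_closed (P : Prog n) :
    ∀ {p v s}, p ∈ P.residuals → p.IsSucc v s → s ∈ P.residuals := by
  induction P with
  | ret b =>
    rintro p v s rfl h
    simp [IsSucc, next] at h
  | op f g i d =>
    rintro p v s (rfl | rfl | rfl) h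
    · simp only [IsSucc, next] at h
      subst h
      cases g v <;> simp [residuals]
    all_goals simp [IsSucc, next] at h
  | flip =>
    rintro p v s (rfl | rfl | rfl) h
    · simp only [IsSucc, next] at h
      rcases h with rfl | rfl <;> simp [residuals]
    all_goals simp [IsSucc, next] at h
  | ite p q r ihp ihq ihr =>
    rintro _ v s (⟨p₁, hp₁, rfl⟩ | h | h) hs
    · rcases isSucc_ite hs with ⟨b, rfl, rfl⟩ | ⟨p', hp', rfl⟩
      · cases b
        · exact Or.inr (Or.inr r.self_mem_residuals)
        · exact Or.inr (Or.inl q.self_mem_residuals)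
      · exact Or.inl ⟨p', ihp hp₁ hp', rfl⟩
    · exact Or.inr (Or.inl (ihq h hs))
    · exact Or.inr (Or.inr (ihr h hs))
  | loop p q ihp ihq =>
    rintro _ v s ((rfl | rfl) | ⟨p₁, hp₁, rfl⟩ | ⟨q₁, hq₁, rfl⟩) hs
    · simp only [IsSucc, next] at hs
      subst hs
      exact Or.inr (Or.inl ⟨p, p.self_mem_residuals, rfl⟩)
    · simp [IsSucc, next] at hs
    · rcases isSucc_ite hs with ⟨b, rfl, rfl⟩ | ⟨p', hp', rfl⟩
      · cases b
        · simp [residuals]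
        · exact Or.inr (Or.inr ⟨q, q.self_mem_residuals, rfl⟩)
      · exact Or.inr (Or.inl ⟨p', ihp hp₁ hp', rfl⟩)
    · rcases isSucc_ite hs with ⟨b, rfl, rfl⟩ | ⟨q', hq', rfl⟩
      · cases b <;> simp [residuals]
      · exact Or.inr (Or.inr ⟨q', ihq hq₁ hq', rfl⟩)

end Prog

/-! ### Executions -/

/-- The memory of a machine with `n` tapes: head positions and tape inscriptions. -/
@[ext] structure Mem (n : ℕ) where
  head : Fin n → ℕ
  tape : Fin n → ℕ → TSym

namespace Mem

variable {n : ℕ}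

/-- The symbols under the heads. -/
def read (m : Mem n) : Fin n → TSym := fun i => m.tape i (m.head i)

/-- `m'` results from `m` by writing `v` and moving the heads according to `d`. -/
def Act (m : Mem n) (v : Fin n → TSym) (d : Fin n → Move) (m' : Mem n) : Prop :=
  (∀ i, (d i).Moves (m.head i) (m'.head i)) ∧
    ∀ i, m'.tape i = Function.update (m.tape i) (m.head i) (v i)

theorem Act.unique {m m₁ m₂ : Mem n} {v d} (h₁ : m.Act v d m₁) (h₂ : m.Act v d m₂) : m₁ = m₂ := by
  refine Mem.ext ?_ ?_
  · funext i
    have a := h₁.1 i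
    have b := h₂.1 i
    cases hd : d i <;> rw [hd] at a b <;> simp only [Move.Moves] at a b <;> omega
  · funext i
    rw [h₁.2 i, h₂.2 i]

theorem act_stay (m : Mem n) : m.Act m.read (fun _ => .stay) m :=
  ⟨fun _ => rfl, fun i => by simp [read]⟩

theorem act_stay_iff (m m' : Mem n) : m.Act m.read (fun _ => .stay) m' ↔ m' = m :=
  ⟨fun h => h.unique m.act_stay, fun h => h ▸ m.act_stay⟩

end Mem

/-- `Run ok p m cs b m'`: with the coin tosses `cs`, the program `p` started in `m` terminates in
`m'` and returns `b`; all memories on the way satisfy `ok`. -/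
inductive Run {n : ℕ} (ok : Mem n → Prop) : Prog n → Mem n → List Bool → Bool → Mem n → Prop
  | halt {b m} : ok m → Run ok (.ret b) m [] b m
  | det {p m p' v d m₁ cs b m'} : ok m → p.next m.read = .det p' v d → m.Act v d m₁ →
      Run ok p' m₁ cs b m' → Run ok p m cs b m'
  | coin {p m p₀ p₁ c cs b m'} : ok m → p.next m.read = .coin p₀ p₁ →
      Run ok (bif c then p₀ else p₁) m cs b m' → Run ok p m (c :: cs) b m'

/-- `RunTree ok K p m f`: the program `p` started in `m` makes `K` coin tosses and returns `f cs` if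
`cs` are their results. -/
inductive RunTree {n : ℕ} (ok : Mem n → Prop) :
    ℕ → Prog n → Mem n → (List Bool → Bool) → Prop
  | halt {b m f} : ok m → f [] = b → RunTree ok 0 (.ret b) m f
  | det {K p m p' v d m₁ f} : ok m → p.next m.read = .det p' v d → m.Act v d m₁ →
      RunTree ok K p' m₁ f → RunTree ok K p m f
  | coin {K p m p₀ p₁ f} : ok m → p.next m.read = .coin p₀ p₁ →
      RunTree ok K p₀ m (fun cs => f (true :: cs)) → RunTree ok K p₁ m (fun cs => f (false :: cs)) →
      RunTree ok (K + 1) p m f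

namespace Run

variable {n : ℕ} {ok : Mem n → Prop} {p q r : Prog n} {m m' m'' : Mem n} {b b' : Bool}
  {cs cs' : List Bool}

theorem ok_start (h : Run ok p m cs b m') : ok m := by cases h <;> assumption

theorem ok_end (h : Run ok p m cs b m') : ok m' := by
  induction h <;> assumption

theorem ite (h : Run ok p m cs b m') (h' : Run ok (bif b then q else r) m' cs' b' m'') :
    Run ok (.ite p q r) m (cs ++ cs') b' m'' := by
  induction h with
  | halt h => exact .det h (by simp [Prog.next]) (Mem.act_stay _) h'
  | det ho hn ha _ ih => exact .det ho (by simp [Prog.next, hn]) ha (ih h')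
  | @coin _ _ _ _ c _ _ _ ho hn _ ih =>
    refine .coin ho (by simp only [Prog.next, hn]; rfl) ?_
    cases c <;> exact ih h'

theorem flip (h : ok m) (c : Bool) : Run ok .flip m [c] c m := by
  refine .coin h rfl ?_
  cases c <;> exact .halt h

theorem op {f g i d} (h : ok m) (ha : m.Act (f m.read) (Function.update (fun _ => .stay) i d) m')
    (h' : ok m') : Run ok (.op f g i d) m [] (g m.read) m' :=
  .det h rfl ha (.halt h')

theorem loop_false (h : Run ok p m cs false m') : Run ok (.loop p q) m cs true m' := by
  have := h.ite (q := .ite q (.loop p q) (.loop p q)) (r := .ret true) (.halt h.ok_end)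
  rw [List.append_nil] at this
  exact .det h.ok_start rfl (Mem.act_stay _) this

theorem loop_true {cs₁ m₁} (h : Run ok p m cs true m') (h₁ : Run ok q m' cs₁ b m₁)
    (h₂ : Run ok (.loop p q) m₁ cs' b' m'') :
    Run ok (.loop p q) m (cs ++ (cs₁ ++ cs')) b' m'' := by
  refine .det h.ok_start rfl (Mem.act_stay _) (h.ite (h₁.ite ?_))
  cases b <;> exact h₂

/-- Steps before a toss are deterministic, so runs with different coin sequences agree until their
first toss. Runs for all sequences of length `K` therefore share one tree; the outer induction is
over the tosses, the inner one follows a single run to its next toss. -/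
theorem tree {K : ℕ} {f : List Bool → Bool} (h : ∀ cs, cs.length = K → ∃ m', Run ok p m cs (f cs) m') :
    RunTree ok K p m f := by
  induction K generalizing p m f with
  | zero =>
    obtain ⟨m', h'⟩ := h [] rfl
    clear h
    generalize hb : f [] = b at h'
    generalize hcs : ([] : List Bool) = cs at h'
    induction h' with
    | halt ho => exact .halt ho hb
    | det ho hn ha _ ih => exact .det ho hn ha (ih hb hcs)
    | coin => simp at hcs
  | succ K ihK =>
    -- Any sequence of this length would do: its run only leads to the first toss, where both
    -- continuations are taken from `h`.
    obtain ⟨m', h'⟩ := h (List.replicate (K + 1) true) (by simp)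
    generalize hcs : List.replicate (K + 1) true = cs at h'
    generalize hb : f cs = b at h'
    clear hb
    induction h' with
    | halt ho => simp at hcs
    | det ho hn ha _ ih =>
      refine .det ho hn ha (ih (fun cs hl => ?_) hcs)
      obtain ⟨m₂, h₂⟩ := h cs hl
      cases h₂ with
      | halt => simp [Prog.next] at hn
      | det _ hn' ha' h₃ =>
        rw [hn] at hn'
        cases hn'
        cases ha.unique ha'
        exact ⟨m₂, h₃⟩
      | coin _ hn' => rw [hn] at hn'; cases hn'
    | coin ho hn _ _ =>
      refine .coin ho hn (ihK fun cs hl => ?_) (ihK fun cs hl => ?_)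
      · obtain ⟨m₂, h₂⟩ := h (true :: cs) (by simp [hl])
        generalize f (true :: cs) = b at h₂ ⊢
        generalize hc : true :: cs = cs₁ at h₂
        cases h₂ with
        | halt => cases hc
        | det _ hn' => rw [hn] at hn'; cases hn'
        | coin _ hn' h₃ => rw [hn] at hn'; cases hn'; cases hc; exact ⟨m₂, h₃⟩
      · obtain ⟨m₂, h₂⟩ := h (false :: cs) (by simp [hl])
        generalize f (false :: cs) = b at h₂ ⊢
        generalize hc : false :: cs = cs₁ at h₂
        cases h₂ with
        | halt => cases hc
        | det _ hn' => rw [hn] at hn'; cases hn'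
        | coin _ hn' h₃ => rw [hn] at hn'; cases hn'; cases hc; exact ⟨m₂, h₃⟩

end Run

/-! ### The machine of a program -/

namespace Prog

variable {t u : ℕ}

/-- The Turing machine that executes the program `P`. -/
@[reducible] def machine (P : Prog (t + u)) (h : 0 < t + u) : NTM Letter t u where
  Q := P.residuals
  Γ := TSym
  finite_Q := P.finite_residuals.to_subtype
  tapes_pos := h
  blank := .blank
  inp := ⟨Letter.sym, Letter.sym_injective⟩
  inp_ne_blank := Letter.sym_ne_blank
  start := ⟨P, P.self_mem_residuals⟩
  final := {q | ∃ b, q.1 = ret b}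
  accepting := {q | q.1 = ret true}
  accepting_subset := fun _ hq => ⟨true, hq⟩
  Δ q a q' b d := match q.1.next a with
    | .halt _ => False
    | .det p v e => q'.1 = p ∧ b = v ∧ d = e
    | .coin p₀ p₁ => (q'.1 = p₀ ∨ q'.1 = p₁) ∧ b = a ∧ d = fun _ => .stay
  not_final_of_Δ := by
    rintro ⟨q, hq⟩ a q' b d h ⟨b', rfl⟩
    simp [next] at h
  normalized := by
    rintro ⟨q, hq⟩ a q' b d h
    simp only at h
    split at h
    · exact h.elim
    · rename_i heq
      obtain ⟨-, -, rfl⟩ := h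
      exact next_det_normalized heq
    · obtain ⟨-, -, rfl⟩ := h
      simp

variable {P : Prog (t + u)} {h : 0 < t + u}

/-- The memory of a configuration. -/
def mem (c : (P.machine h).Cfg) : Mem (t + u) := ⟨c.head, c.tape⟩

theorem cfg_ext {c c' : (P.machine h).Cfg} (h₁ : c.state.1 = c'.state.1) (h₂ : mem c = mem c') :
    c = c' := by
  obtain ⟨s, hd, tp⟩ := c
  obtain ⟨s', hd', tp'⟩ := c'
  have e : s = s' := Subtype.ext h₁
  simp only [mem, Mem.mk.injEq] at h₂
  obtain ⟨rfl, rfl⟩ := h₂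
  rw [e]

theorem step_iff {c c' : (P.machine h).Cfg} :
    (P.machine h).Step c c' ↔ match c.state.1.next (mem c).read with
      | .halt _ => False
      | .det p v d => c'.state.1 = p ∧ (mem c).Act v d (mem c')
      | .coin p₀ p₁ => (c'.state.1 = p₀ ∨ c'.state.1 = p₁) ∧ mem c' = mem c := by
  have key : (P.machine h).Step c c' ↔ ∃ b d, (match c.state.1.next (mem c).read with
    | .halt _ => False
    | .det p v e => c'.state.1 = p ∧ b = v ∧ d = e
    | .coin p₀ p₁ => (c'.state.1 = p₀ ∨ c'.state.1 = p₁) ∧ b = (mem c).read ∧ d = fun _ => .stay)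
      ∧ (mem c).Act b d (mem c') := Iff.rfl
  rw [key]
  cases c.state.1.next (mem c).read with
  | halt b => simp
  | det p v d =>
    constructor
    · rintro ⟨b, e, ⟨h₁, rfl, rfl⟩, h₂⟩
      exact ⟨h₁, h₂⟩
    · rintro ⟨h₁, h₂⟩
      exact ⟨v, d, ⟨h₁, rfl, rfl⟩, h₂⟩
  | coin p₀ p₁ =>
    constructor
    · rintro ⟨b, e, ⟨h₁, rfl, rfl⟩, h₂⟩
      exact ⟨h₁, (Mem.act_stay_iff _ _).1 h₂⟩
    · rintro ⟨h₁, h₂⟩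
      exact ⟨_, _, ⟨h₁, rfl, rfl⟩, (Mem.act_stay_iff _ _).2 h₂⟩

theorem next_halt_eq {c : (P.machine h).Cfg} {b} (hb : c.state.1 = ret b) :
    (P.machine h).Next c = ∅ := by
  ext c'
  simp only [NTM.Next, Set.mem_ofPred_eq, step_iff, hb, next]
  simp

theorem next_det_eq {c : (P.machine h).Cfg} {p v d m}
    (hn : c.state.1.next (mem c).read = .det p v d) (ha : (mem c).Act v d m) :
    ∃ c', c'.state.1 = p ∧ mem c' = m ∧ (P.machine h).Next c = {c'} := by
  have hp : p ∈ P.residuals := P.residuals_closed c.state.2 (v := (mem c).read) (by simp [IsSucc, hn])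
  refine ⟨⟨⟨p, hp⟩, m.head, m.tape⟩, rfl, rfl, ?_⟩
  ext c'
  simp only [NTM.Next, Set.mem_ofPred_eq, step_iff, hn, Set.mem_singleton_iff]
  constructor
  · rintro ⟨h₁, h₂⟩
    exact cfg_ext h₁ (h₂.unique ha)
  · rintro rfl
    exact ⟨rfl, ha⟩

theorem next_coin_eq {c : (P.machine h).Cfg} {p₀ p₁}
    (hn : c.state.1.next (mem c).read = .coin p₀ p₁) :
    ∃ c₀ c₁, c₀.state.1 = p₀ ∧ mem c₀ = mem c ∧ c₁.state.1 = p₁ ∧ mem c₁ = mem c ∧ c₀ ≠ c₁ ∧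
      (P.machine h).Next c = {c₀, c₁} := by
  have hp₀ : p₀ ∈ P.residuals :=
    P.residuals_closed c.state.2 (v := (mem c).read) (by simp [IsSucc, hn])
  have hp₁ : p₁ ∈ P.residuals :=
    P.residuals_closed c.state.2 (v := (mem c).read) (by simp [IsSucc, hn])
  refine ⟨⟨⟨p₀, hp₀⟩, c.head, c.tape⟩, ⟨⟨p₁, hp₁⟩, c.head, c.tape⟩, rfl, rfl, rfl, rfl, ?_, ?_⟩
  · intro he
    exact next_coin_ne hn (congrArg (fun c => c.state.1) he)
  ext c'
  simp only [NTM.Next, Set.mem_ofPred_eq, step_iff, hn, Set.mem_insert_iff, Set.mem_singleton_iff]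
  constructor
  · rintro ⟨h₁ | h₁, h₂⟩
    · exact Or.inl (cfg_ext h₁ h₂)
    · exact Or.inr (cfg_ext h₁ h₂)
  · rintro (rfl | rfl)
    · exact ⟨Or.inl rfl, rfl⟩
    · exact ⟨Or.inr rfl, rfl⟩

end Prog

/-! ### Acceptance probabilities by recursion over successor configurations. -/

namespace NTM

variable {α : Type} {t u : ℕ} (T : NTM α t u)

/-- The accepting runs that start with the configuration `c`. -/
def acceptingFrom (c : T.Cfg) : Set (List T.Cfg) :=
  {ρ | (ρ.head? = some c ∧ ρ.IsChain T.Step) ∧ ∃ c', ρ.getLast? = some c' ∧ c'.state ∈ T.accepting}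

variable {T}

theorem mem_acceptingFrom_singleton {c : T.Cfg} :
    [c] ∈ T.acceptingFrom c ↔ c.state ∈ T.accepting := by
  simp [acceptingFrom]

theorem cons_cons_mem_acceptingFrom {c c' d : T.Cfg} {ρ : List T.Cfg} :
    d :: c' :: ρ ∈ T.acceptingFrom c ↔ d = c ∧ T.Step d c' ∧ c' :: ρ ∈ T.acceptingFrom c' := by
  simp only [acceptingFrom, Set.mem_ofPred_eq, List.head?_cons, Option.some.injEq,
    List.isChain_cons_cons, List.getLast?_cons_cons, true_and]
  tauto

theorem exists_of_mem_acceptingFrom {c : T.Cfg} {ρ} (h : ρ ∈ T.acceptingFrom c) :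
    ∃ ρ', ρ = c :: ρ' := by
  cases ρ with
  | nil => simp [acceptingFrom] at h
  | cons d ρ =>
    have := h.1.1
    simp only [List.head?_cons, Option.some.injEq] at this
    exact ⟨ρ, by rw [this]⟩

theorem acceptingFrom_eq_of_final {c : T.Cfg} (h : T.Next c = ∅) :
    T.acceptingFrom c = {ρ | ρ = [c] ∧ c.state ∈ T.accepting} := by
  ext ρ
  constructor
  · intro hρ
    obtain ⟨ρ', rfl⟩ := exists_of_mem_acceptingFrom hρ
    cases ρ' with
    | nil => exact ⟨rfl, mem_acceptingFrom_singleton.1 hρ⟩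
    | cons d ρ' =>
      have : d ∈ T.Next c := (cons_cons_mem_acceptingFrom.1 hρ).2.1
      simp [h] at this
  · rintro ⟨rfl, h⟩
    exact mem_acceptingFrom_singleton.2 h

/-- The one-element run `[c]` is not accepting, so every accepting run has a first step; this is the
recursion behind the probabilities. -/
theorem acceptingFrom_eq {c : T.Cfg} (h : c.state ∉ T.accepting) :
    T.acceptingFrom c = ⋃ c' ∈ T.Next c, List.cons c '' T.acceptingFrom c' := by
  ext ρ
  simp only [Set.mem_iUnion, Set.mem_image, exists_prop]
  constructor
  · intro hρ
    obtain ⟨ρ', rfl⟩ := exists_of_mem_acceptingFrom hρ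
    cases ρ' with
    | nil => exact (h (mem_acceptingFrom_singleton.1 hρ)).elim
    | cons d ρ' =>
      have := cons_cons_mem_acceptingFrom.1 hρ
      exact ⟨d, this.2.1, _, this.2.2, rfl⟩
  · rintro ⟨c', hc', ρ', hρ', rfl⟩
    obtain ⟨ρ'', rfl⟩ := exists_of_mem_acceptingFrom hρ'
    exact cons_cons_mem_acceptingFrom.2 ⟨rfl, hc', hρ'⟩

variable (T) in
/-- The probability that `T` accepts if it is started in `c`. -/
noncomputable def probFrom (c : T.Cfg) : ℝ≥0∞ := ∑' ρ : T.acceptingFrom c, T.prob ρ.1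

theorem probAccepts_eq (w : List α) : T.probAccepts w = T.probFrom (T.init w) := rfl

theorem probFrom_of_final {c : T.Cfg} (h : T.Next c = ∅) (b : Bool)
    (hb : c.state ∈ T.accepting ↔ b = true) : T.probFrom c = if b then 1 else 0 := by
  unfold probFrom
  rw [acceptingFrom_eq_of_final h]
  cases b with
  | true =>
    have : {ρ : List T.Cfg | ρ = [c] ∧ c.state ∈ T.accepting} = {[c]} := by
      ext; simp [hb]
    rw [this, tsum_singleton [c] T.prob]
    simp [prob]
  | false =>
    have : {ρ : List T.Cfg | ρ = [c] ∧ c.state ∈ T.accepting} = ∅ := by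
      ext; simp [hb]
    rw [this]
    simp

theorem tsum_cons_image {c c' : T.Cfg} :
    ∑' ρ : List.cons c '' T.acceptingFrom c', T.prob ρ.1
      = ((T.Next c).ncard : ℝ≥0∞)⁻¹ * T.probFrom c' := by
  rw [tsum_image T.prob (List.cons_injective.injOn), probFrom, ← ENNReal.tsum_mul_left]
  congr 1
  funext ρ
  obtain ⟨ρ', h⟩ := exists_of_mem_acceptingFrom ρ.2
  rw [h]
  rfl

theorem probFrom_of_next_singleton {c c' : T.Cfg} (h : T.Next c = {c'})
    (ha : c.state ∉ T.accepting) : T.probFrom c = T.probFrom c' := by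
  have : T.acceptingFrom c = List.cons c '' T.acceptingFrom c' := by
    rw [acceptingFrom_eq ha, h]; simp
  rw [probFrom, this, tsum_cons_image, h]
  simp

/-- The runs through the two successors form disjoint sets, and each run gets the weight 1/2 because
`T.Next c` has exactly two elements. -/
theorem probFrom_of_next_pair {c c₀ c₁ : T.Cfg} (h : T.Next c = {c₀, c₁}) (hne : c₀ ≠ c₁)
    (ha : c.state ∉ T.accepting) :
    T.probFrom c = (T.probFrom c₀ + T.probFrom c₁) / 2 := by
  have : T.acceptingFrom c =
      List.cons c '' T.acceptingFrom c₀ ∪ List.cons c '' T.acceptingFrom c₁ := by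
    rw [acceptingFrom_eq ha, h]; simp
  have hd : Disjoint (List.cons c '' T.acceptingFrom c₀) (List.cons c '' T.acceptingFrom c₁) := by
    rw [Set.disjoint_left]
    rintro _ ⟨ρ₀, h₀, rfl⟩ ⟨ρ₁, h₁, he⟩
    obtain ⟨ρ₀', rfl⟩ := exists_of_mem_acceptingFrom h₀
    obtain ⟨ρ₁', rfl⟩ := exists_of_mem_acceptingFrom h₁
    simp only [List.cons.injEq, true_and] at he
    exact hne he.1.symm
  rw [probFrom, this, ENNReal.summable.tsum_union_disjoint hd ENNReal.summable, tsum_cons_image,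
    tsum_cons_image, h, Set.ncard_pair hne, ← mul_add, mul_comm, div_eq_mul_inv]
  rfl

end NTM

/-! ### What a tree of coin tosses says about the machine. -/

/-- The average of the truth values of `f` over all lists of length `K`. -/
noncomputable def coinAverage : ℕ → (List Bool → Bool) → ℝ≥0∞
  | 0, f => if f [] then 1 else 0
  | K + 1, f =>
    (coinAverage K (fun cs => f (true :: cs)) + coinAverage K (fun cs => f (false :: cs))) / 2

namespace RunTree

open Prog

variable {t u : ℕ} {P : Prog (t + u)} {h : 0 < t + u} {ok : Mem (t + u) → Prop} {K : ℕ}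
  {p : Prog (t + u)} {m : Mem (t + u)} {f : List Bool → Bool}

theorem not_accepting {c : (P.machine h).Cfg} {a} (hn : c.state.1.next (mem c).read = a)
    (ha : ∀ b, a ≠ .halt b) : c.state ∉ (P.machine h).accepting := by
  intro hc
  have hc : c.state.1 = ret true := hc
  rw [hc] at hn
  exact ha true hn.symm

/-- The tree contains every computation from `c`; a deterministic node has one successor and a toss
has two of equal weight, so the recursions for both sides coincide. -/
theorem probFrom_eq (H : RunTree ok K p m f) {c : (P.machine h).Cfg} (hs : c.state.1 = p)
    (hm : mem c = m) : (P.machine h).probFrom c = coinAverage K f := by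
  induction H generalizing c with
  | @halt b m f ho hf =>
    rw [NTM.probFrom_of_final (next_halt_eq hs) b, coinAverage, hf]
    change c.state.1 = ret true ↔ _
    rw [hs]
    simp
  | det ho hn ha _ ih =>
    subst hs hm
    obtain ⟨c', h₁, h₂, h₃⟩ := next_det_eq hn ha
    rw [NTM.probFrom_of_next_singleton h₃ (not_accepting hn (by simp)), ih h₁ h₂]
  | coin ho hn _ _ ih₀ ih₁ =>
    subst hs hm
    obtain ⟨c₀, c₁, h₁, h₂, h₃, h₄, h₅, h₆⟩ := next_coin_eq hn
    rw [NTM.probFrom_of_next_pair h₆ h₅ (not_accepting hn (by simp)), ih₀ h₁ h₂, ih₁ h₃ h₄,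
      coinAverage]

theorem accepts_iff (H : RunTree ok K p m f) {c : (P.machine h).Cfg} (hs : c.state.1 = p)
    (hm : mem c = m) :
    ((P.machine h).acceptingFrom c).Nonempty ↔ ∃ cs, cs.length = K ∧ f cs = true := by
  induction H generalizing c with
  | @halt b m f ho hf =>
    have hc : c.state ∈ (P.machine h).accepting ↔ b = true := by
      change c.state.1 = ret true ↔ _
      rw [hs]
      simp
    rw [NTM.acceptingFrom_eq_of_final (next_halt_eq hs), hc, ← hf]
    constructor
    · rintro ⟨ρ, -, h⟩
      exact ⟨[], rfl, h⟩
    · rintro ⟨cs, hcs, h⟩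
      rw [List.eq_nil_of_length_eq_zero hcs] at h
      exact ⟨[c], rfl, h⟩
  | det ho hn ha _ ih =>
    subst hs hm
    obtain ⟨c', h₁, h₂, h₃⟩ := next_det_eq hn ha
    rw [NTM.acceptingFrom_eq (not_accepting hn (by simp)), h₃, ← ih h₁ h₂]
    simp
  | coin ho hn _ _ ih₀ ih₁ =>
    subst hs hm
    obtain ⟨c₀, c₁, h₁, h₂, h₃, h₄, h₅, h₆⟩ := next_coin_eq hn
    rw [NTM.acceptingFrom_eq (not_accepting hn (by simp)), h₆, Set.biUnion_insert,
      Set.biUnion_singleton, Set.union_nonempty, Set.image_nonempty, Set.image_nonempty,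
      ih₀ h₁ h₂, ih₁ h₃ h₄]
    constructor
    · rintro (⟨cs, rfl, h⟩ | ⟨cs, rfl, h⟩)
      · exact ⟨_, rfl, h⟩
      · exact ⟨_, rfl, h⟩
    · rintro ⟨cs, hcs, h⟩
      cases cs with
      | nil => simp at hcs
      | cons b cs =>
        simp only [List.length_cons, Nat.add_right_cancel_iff] at hcs
        cases b
        · exact Or.inr ⟨cs, hcs, h⟩
        · exact Or.inl ⟨cs, hcs, h⟩

/-- An infinite computation would be an infinite path in a well-founded tree. -/
theorem no_infinite (H : RunTree ok K p m f) {c : (P.machine h).Cfg} (hs : c.state.1 = p)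
    (hm : mem c = m) :
    ¬ ∃ g : ℕ → (P.machine h).Cfg, g 0 = c ∧ ∀ n, (P.machine h).Step (g n) (g (n + 1)) := by
  induction H generalizing c with
  | halt ho hf =>
    rintro ⟨g, h₀, hg⟩
    have : g 1 ∈ (P.machine h).Next c := h₀ ▸ hg 0
    simp [next_halt_eq hs] at this
  | det ho hn ha _ ih =>
    subst hs hm
    obtain ⟨c', h₁, h₂, h₃⟩ := next_det_eq hn ha
    rintro ⟨g, h₀, hg⟩
    have : g 1 ∈ (P.machine h).Next c := h₀ ▸ hg 0
    rw [h₃] at this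
    exact ih h₁ h₂ ⟨fun n => g (n + 1), this, fun n => hg (n + 1)⟩
  | coin ho hn _ _ ih₀ ih₁ =>
    subst hs hm
    obtain ⟨c₀, c₁, h₁, h₂, h₃, h₄, h₅, h₆⟩ := next_coin_eq hn
    rintro ⟨g, h₀, hg⟩
    have : g 1 ∈ (P.machine h).Next c := h₀ ▸ hg 0
    rw [h₆] at this
    rcases this with h | h
    · exact ih₀ h₁ h₂ ⟨fun n => g (n + 1), h, fun n => hg (n + 1)⟩
    · exact ih₁ h₃ h₄ ⟨fun n => g (n + 1), h, fun n => hg (n + 1)⟩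

/-- Incomplete computations are covered too, as the definition of boundedness demands; `ok` will be
the space condition. -/
theorem ok_of_chain (H : RunTree ok K p m f) {c : (P.machine h).Cfg} (hs : c.state.1 = p)
    (hm : mem c = m) {ρ} (hρ : (c :: ρ).IsChain (P.machine h).Step) :
    ∀ c' ∈ c :: ρ, ok (mem c') := by
  induction H generalizing c ρ with
  | halt ho hf =>
    subst hm
    cases ρ with
    | nil => simpa using ho
    | cons d ρ =>
      have : d ∈ (P.machine h).Next c := (List.isChain_cons_cons.1 hρ).1
      simp [next_halt_eq hs] at this
  | det ho hn ha _ ih =>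
    subst hs hm
    cases ρ with
    | nil => simpa using ho
    | cons d ρ =>
      obtain ⟨c', h₁, h₂, h₃⟩ := next_det_eq hn ha
      obtain ⟨hd, hρ⟩ := List.isChain_cons_cons.1 hρ
      have : d ∈ (P.machine h).Next c := hd
      rw [h₃] at this
      obtain rfl : d = c' := this
      intro e he
      rcases List.mem_cons.1 he with rfl | he
      · exact ho
      · exact ih h₁ h₂ hρ e he
  | coin ho hn _ _ ih₀ ih₁ =>
    subst hs hm
    cases ρ with
    | nil => simpa using ho
    | cons d ρ =>
      obtain ⟨c₀, c₁, h₁, h₂, h₃, h₄, h₅, h₆⟩ := next_coin_eq hn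
      obtain ⟨hd, hρ⟩ := List.isChain_cons_cons.1 hρ
      have : d ∈ (P.machine h).Next c := hd
      rw [h₆] at this
      intro e he
      rcases List.mem_cons.1 he with rfl | he
      · exact ho
      · rcases this with rfl | this
        · exact ih₀ h₁ h₂ hρ e he
        · obtain rfl : d = c₁ := this
          exact ih₁ h₃ h₄ hρ e he

end RunTree

/-! ### Head reversals and space -/

def Move.isLeft : Move → Bool
  | .left => true
  | _ => false

def Move.isRight : Move → Bool
  | .right => true
  | _ => false

namespace Prog

/-- The program never moves one of the first `t` heads by a movement `d` with `bad d`. -/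
def avoids {n : ℕ} (t : ℕ) (bad : Move → Bool) : Prog n → Bool
  | op _ _ i d => decide (t ≤ i.val) || !bad d
  | ite p q r => p.avoids t bad && q.avoids t bad && r.avoids t bad
  | loop p q => p.avoids t bad && q.avoids t bad
  | _ => true

theorem avoids_next_det {n t : ℕ} {bad : Move → Bool} (hb : bad .stay = false) {p : Prog n}
    {v p' v' d} (hp : p.avoids t bad = true) (h : p.next v = .det p' v' d) :
    p'.avoids t bad = true ∧ ∀ i : Fin n, i.val < t → bad (d i) = false := by
  induction p generalizing p' with
  | ret b => simp [next] at h
  | op f g i₀ d₀ =>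
    simp only [next, Todo.det.injEq] at h
    obtain ⟨rfl, -, rfl⟩ := h
    refine ⟨rfl, fun i hi => ?_⟩
    by_cases hii : i = i₀
    · subst hii
      simp only [avoids, Bool.or_eq_true, decide_eq_true_eq, Bool.not_eq_true'] at hp
      rw [Function.update_self]
      exact hp.resolve_left (by omega)
    · rw [Function.update_of_ne hii]
      exact hb
  | flip => simp [next] at h
  | ite p q r ihp =>
    simp only [avoids, Bool.and_eq_true] at hp
    simp only [next] at h
    split at h
    · rename_i b _
      simp only [Todo.det.injEq] at h
      obtain ⟨rfl, -, rfl⟩ := h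
      exact ⟨by cases b <;> simp [hp], fun _ _ => hb⟩
    · rename_i p₁ v₁ d₁ heq
      simp only [Todo.det.injEq] at h
      obtain ⟨rfl, rfl, rfl⟩ := h
      have := ihp hp.1.1 heq
      exact ⟨by simp [avoids, this.1, hp], this.2⟩
    · simp at h
  | loop p q =>
    simp only [next, Todo.det.injEq] at h
    obtain ⟨rfl, -, rfl⟩ := h
    simp only [avoids, Bool.and_eq_true] at hp
    exact ⟨by simp [avoids, hp], fun _ _ => hb⟩

theorem avoids_next_coin {n t : ℕ} {bad : Move → Bool} {p : Prog n}
    {v p₀ p₁} (hp : p.avoids t bad = true) (h : p.next v = .coin p₀ p₁) :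
    p₀.avoids t bad = true ∧ p₁.avoids t bad = true := by
  induction p generalizing p₀ p₁ with
  | flip =>
    simp only [next, Todo.coin.injEq] at h
    obtain ⟨rfl, rfl⟩ := h
    exact ⟨rfl, rfl⟩
  | ite p q r ihp =>
    simp only [avoids, Bool.and_eq_true] at hp
    simp only [next] at h
    split at h
    · simp at h
    · simp at h
    · rename_i heq
      simp only [Todo.coin.injEq] at h
      obtain ⟨rfl, rfl⟩ := h
      have := ihp hp.1.1 heq
      simp [avoids, this, hp]
  | _ => simp [next] at h

variable {t u : ℕ} {P : Prog (t + u)} {h : 0 < t + u}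

theorem avoids_step {bad : Move → Bool} (hb : bad .stay = false) {c c' : (P.machine h).Cfg}
    (hc : c.state.1.avoids t bad = true) (hs : (P.machine h).Step c c') :
    c'.state.1.avoids t bad = true ∧
      ∀ i : Fin (t + u), i.val < t → ∃ d, bad d = false ∧ d.Moves (c.head i) (c'.head i) := by
  rw [step_iff] at hs
  split at hs
  · exact hs.elim
  · rename_i heq
    have := avoids_next_det hb hc heq
    exact ⟨hs.1 ▸ this.1, fun i hi => ⟨_, this.2 i hi, hs.2.1 i⟩⟩
  · rename_i heq
    have := avoids_next_coin hc heq
    have hm : c'.head = c.head := congrArg Mem.head hs.2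
    refine ⟨?_, fun i _ => ⟨.stay, hb, by simp [Move.Moves, hm]⟩⟩
    rcases hs.1 with h | h
    · rw [h]; exact this.1
    · rw [h]; exact this.2

end Prog

namespace NTM

theorem headMoves_cons_cons (a b : ℕ) (l : List ℕ) :
    headMoves (a :: b :: l) = if b = a then headMoves (b :: l)
      else ((b : ℤ) - a) :: headMoves (b :: l) := by
  unfold headMoves
  simp only [List.tail_cons, List.zipWith_cons_cons]
  split_ifs with h
  · subst h
    rw [List.filter_cons_of_neg (by simp)]
  · rw [List.filter_cons_of_pos (by simpa [sub_eq_zero] using h)]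

/-- The number of changes in a list. -/
theorem countP_changes_const {a : ℤ} {l : List ℤ} (h : ∀ x ∈ l, x = a) :
    (l.zip l.tail).countP (fun x => decide (x.1 ≠ x.2)) = 0 := by
  rw [List.countP_eq_zero]
  rintro ⟨x, y⟩ hx
  have h₁ := h x (List.of_mem_zip hx).1
  have h₂ := h y (List.mem_of_mem_tail (List.of_mem_zip hx).2)
  simp [h₁, h₂]

/-- A change can occur only at the seam of the two constant blocks. -/
theorem countP_changes_append {a b : ℤ} {l l' : List ℤ} (h : ∀ x ∈ l, x = a) (h' : ∀ x ∈ l', x = b) :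
    ((l ++ l').zip (l ++ l').tail).countP (fun x => decide (x.1 ≠ x.2)) ≤ 1 := by
  induction l with
  | nil => simp only [List.nil_append]; rw [countP_changes_const h']; simp
  | cons x l ih =>
    cases l with
    | nil =>
      cases l' with
      | nil => simp
      | cons y l' =>
        simp only [List.cons_append, List.nil_append, List.tail_cons, List.zip_cons_cons,
          List.countP_cons]
        have := countP_changes_const h'
        simp only [List.tail_cons] at this
        rw [this]
        split_ifs <;> simp
    | cons y l =>
      have := ih fun z hz => h z (List.mem_cons_of_mem _ hz)
      simp only [List.cons_append, List.tail_cons, List.zip_cons_cons,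
          List.countP_cons] at this ⊢
      have hxy : x = y := by rw [h x (by simp), h y (by simp)]
      simpa [hxy] using this

end NTM

namespace Prog

variable {t u : ℕ} {P : Prog (t + u)} {h : 0 < t + u}

theorem headMoves_backward {c : (P.machine h).Cfg} {ρ}
    (hc : c.state.1.avoids t Move.isRight = true) (hρ : (c :: ρ).IsChain (P.machine h).Step)
    {i : Fin (t + u)} (hi : i.val < t) :
    ∀ x ∈ NTM.headMoves ((c :: ρ).map fun c => c.head i), x = -1 := by
  induction ρ generalizing c with
  | nil => simp [NTM.headMoves]
  | cons d ρ ih =>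
    obtain ⟨hd, hρ⟩ := List.isChain_cons_cons.1 hρ
    obtain ⟨h₁, h₂⟩ := avoids_step rfl hc hd
    obtain ⟨e, he, hm⟩ := h₂ i hi
    have := ih h₁ hρ
    simp only [List.map_cons, NTM.headMoves_cons_cons] at this ⊢
    split_ifs with hcd
    · exact this
    · intro x hx
      rcases List.mem_cons.1 hx with rfl | hx
      · cases e <;> simp [Move.isRight, Move.Moves] at he hm <;> omega
      · exact this x hx

/-- While the condition is executed, the state keeps the form `ite p' q r` with `p'` avoiding left
moves; once the condition halts, only `q` or `r` remains. The moves of an external head are thus a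
block of `1` followed by a block of `-1`. The induction varies `p`, which shrinks from step to step.
-/
theorem headMoves_forward_backward {p q r : Prog (t + u)} (hq : q.avoids t Move.isRight = true)
    (hr : r.avoids t Move.isRight = true) {c : (P.machine h).Cfg} {ρ} (hs : c.state.1 = ite p q r)
    (hp : p.avoids t Move.isLeft = true) (hρ : (c :: ρ).IsChain (P.machine h).Step)
    {i : Fin (t + u)} (hi : i.val < t) :
    ∃ l l', NTM.headMoves ((c :: ρ).map fun c => c.head i) = l ++ l' ∧ (∀ x ∈ l, x = 1) ∧
      ∀ x ∈ l', x = -1 := by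
  induction ρ generalizing c p with
  | nil => exact ⟨[], [], by simp [NTM.headMoves]⟩
  | cons d ρ ih =>
    obtain ⟨hd, hρ⟩ := List.isChain_cons_cons.1 hρ
    have hd' := hd
    rw [step_iff, hs] at hd
    simp only [next] at hd
    cases hn : p.next (mem c).read with
    | halt b =>
      rw [hn] at hd
      have hstay : d.head = c.head := congrArg Mem.head ((Mem.act_stay_iff _ _).1 hd.2)
      refine ⟨[], _, (List.nil_append _).symm, by simp, ?_⟩
      have := headMoves_backward (c := d) (by rw [hd.1]; cases b <;> assumption) hρ hi
      simp only [List.map_cons, NTM.headMoves_cons_cons] at this ⊢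
      rw [if_pos (by rw [hstay])]
      exact this
    | det p' v' e =>
      rw [hn] at hd
      obtain ⟨h₁, h₂⟩ := avoids_next_det rfl hp hn
      obtain ⟨l, l', h₃, h₄, h₅⟩ := ih hd.1 h₁ hρ
      simp only [List.map_cons, NTM.headMoves_cons_cons] at h₃ ⊢
      split_ifs with hcd
      · exact ⟨l, l', h₃, h₄, h₅⟩
      · refine ⟨_ :: l, l', by rw [h₃]; rfl, ?_, h₅⟩
        intro x hx
        rcases List.mem_cons.1 hx with rfl | hx
        · have hm : (e i).Moves (c.head i) (d.head i) := hd.2.1 i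
          have he := h₂ i hi
          cases hei : e i <;> rw [hei] at hm he <;> simp [Move.isLeft, Move.Moves] at he hm <;> omega
        · exact h₄ x hx
    | coin p₀ p₁ =>
      rw [hn] at hd
      obtain ⟨h₁, h₂⟩ := avoids_next_coin hp hn
      have hstay : d.head = c.head := congrArg Mem.head hd.2
      have : ∃ p', d.state.1 = ite p' q r ∧ p'.avoids t Move.isLeft = true := by
        rcases hd.1 with h | h
        · exact ⟨_, h, h₁⟩
        · exact ⟨_, h, h₂⟩
      obtain ⟨p', h₃, h₄⟩ := this
      have := ih h₃ h₄ hρ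
      simp only [List.map_cons, NTM.headMoves_cons_cons] at this ⊢
      rw [if_pos (by rw [hstay])]
      exact this

/-- The internal heads do not leave the first `B + 1` cells. -/
def SpaceOk (t B : ℕ) {n : ℕ} (m : Mem n) : Prop := ∀ i : Fin n, t ≤ i.val → m.head i ≤ B

/-- The initial memory on input `w`. -/
def initMem (n : ℕ) (w : List Letter) : Mem n where
  head := fun _ => 0
  tape := fun i p => if i.val = 0 then (w[p]?).elim .blank Letter.sym else .blank

/-- One reversal on each of the `t` external tapes gives `1 + t`, and cells `0` to `B N` on each of
the `u` internal tapes give `u * (B N + 1)`. -/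
theorem isBounded_machine {p q r : Prog (t + u)} (hp : p.avoids t Move.isLeft = true)
    (hq : q.avoids t Move.isRight = true) (hr : r.avoids t Move.isRight = true) {B : ℕ → ℕ}
    (H : ∀ w : List Letter, ∃ K f, RunTree (SpaceOk t (B w.length)) K (ite p q r)
      (initMem (t + u) w) f) :
    ((ite p q r).machine h).IsBounded (fun _ => 1 + t) (fun N => u * (B N + 1)) := by
  intro w
  obtain ⟨K, f, hT⟩ := H w
  refine ⟨hT.no_infinite rfl rfl, ?_⟩
  rintro ρ ⟨hh, hρ⟩
  obtain ⟨ρ', rfl⟩ : ∃ ρ', ρ = ((ite p q r).machine h).init w :: ρ' := by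
    cases ρ with
    | nil => simp at hh
    | cons d ρ =>
      simp only [List.head?_cons, Option.some.injEq] at hh
      exact ⟨ρ, by rw [hh]⟩
  constructor
  · have h₁ : ∀ i ∈ (Finset.univ : Finset (Fin (t + u))).filter (fun i => i.val < t),
        NTM.rev (((ite p q r).machine h).init w :: ρ') i ≤ 1 := by
      intro i hi
      obtain ⟨l, l', h₁, h₂, h₃⟩ := headMoves_forward_backward hq hr
        (c := ((ite p q r).machine h).init w) rfl hp hρ (Finset.mem_filter.1 hi).2
      simp only [NTM.rev, h₁]
      exact NTM.countP_changes_append h₂ h₃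
    have h₂ := Finset.sum_le_card_nsmul _ _ 1 h₁
    have h₃ : ((Finset.univ : Finset (Fin (t + u))).filter (fun i => i.val < t)).card ≤ t := by
      have := Finset.card_le_card_of_injOn (s := (Finset.univ : Finset (Fin (t + u))).filter
        (fun i => i.val < t)) (t := Finset.range t) (fun i => i.val)
        (fun i hi => by simpa using hi) (fun i _ j _ hij => Fin.ext hij)
      simpa using this
    simp only [smul_eq_mul, mul_one] at h₂
    exact Nat.add_le_add_left (h₂.trans h₃) 1
  · have h₁ : ∀ i ∈ (Finset.univ : Finset (Fin (t + u))).filter (fun i => t ≤ i.val),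
        NTM.space (((ite p q r).machine h).init w :: ρ') i ≤ B w.length + 1 := by
      intro i hi
      have : ((((ite p q r).machine h).init w :: ρ').map fun c => c.head i).toFinset ⊆
          Finset.range (B w.length + 1) := by
        intro x hx
        simp only [List.mem_toFinset, List.mem_map] at hx
        obtain ⟨c, hc, rfl⟩ := hx
        have := hT.ok_of_chain rfl rfl hρ c hc i (Finset.mem_filter.1 hi).2
        have : c.head i ≤ _ := this
        simp only [Finset.mem_range]
        omega
      simpa [NTM.space] using Finset.card_le_card this
    have h₂ := Finset.sum_le_card_nsmul _ _ _ h₁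
    have h₃ : ((Finset.univ : Finset (Fin (t + u))).filter (fun i => t ≤ i.val)).card ≤ u := by
      have := Finset.card_le_card_of_injOn (s := (Finset.univ : Finset (Fin (t + u))).filter
        (fun i => t ≤ i.val)) (t := Finset.range u) (fun i => i.val - t)
        (fun i hi => by
          have := (Finset.mem_filter.1 hi).2
          have := i.isLt
          simp only [Finset.coe_range, Set.mem_Iio]; omega)
        (fun i hi j hj hij => by
          have h1 := (Finset.mem_filter.1 (Finset.mem_coe.1 hi)).2
          have h2 := (Finset.mem_filter.1 (Finset.mem_coe.1 hj)).2
          refine Fin.ext ?_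
          simp only at hij
          omega)
      simpa using this
    refine h₂.trans ?_
    simp only [smul_eq_mul]
    exact Nat.mul_le_mul_right _ h₃

end Prog

/-! ### From programs to complexity classes. -/

/-- `NST` and `RST` membership for programs. -/
theorem mem_NST_of_prog {t u : ℕ} (h : 0 < t + u) {p q r : Prog (t + u)}
    (hp : p.avoids t Move.isLeft = true) (hq : q.avoids t Move.isRight = true)
    (hr : r.avoids t Move.isRight = true) {B : ℕ → ℕ} (hB : (fun N => u * (B N + 1)) ∈ OLog)
    {L : Set (List Letter)}
    (H : ∀ w : List Letter, ∃ K f, RunTree (Prog.SpaceOk t (B w.length)) K (.ite p q r)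
      (Prog.initMem (t + u) w) f ∧ (w ∈ L ↔ ∃ cs, cs.length = K ∧ f cs = true)) :
    L ∈ NST Letter {fun _ => 1 + t} OLog t := by
  refine ⟨_, rfl, _, hB, u, (Prog.ite p q r).machine h, Prog.isBounded_machine hp hq hr
    fun w => ?_, fun w => ?_⟩
  · obtain ⟨K, f, hT, -⟩ := H w
    exact ⟨K, f, hT⟩
  · obtain ⟨K, f, hT, hL⟩ := H w
    rw [hL, ← hT.accepts_iff (P := Prog.ite p q r) (h := h)
      (c := ((Prog.ite p q r).machine h).init w) rfl rfl]
    rfl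

theorem mem_RST_of_prog {t u : ℕ} (h : 0 < t + u) {p q r : Prog (t + u)}
    (hp : p.avoids t Move.isLeft = true) (hq : q.avoids t Move.isRight = true)
    (hr : r.avoids t Move.isRight = true) {B : ℕ → ℕ} (hB : (fun N => u * (B N + 1)) ∈ OLog)
    {L : Set (List Letter)}
    (H : ∀ w : List Letter, ∃ K f, RunTree (Prog.SpaceOk t (B w.length)) K (.ite p q r)
      (Prog.initMem (t + u) w) f ∧ (w ∈ L → 1 / 2 ≤ coinAverage K f) ∧
        (w ∉ L → coinAverage K f = 0)) :
    L ∈ RST Letter {fun _ => 1 + t} OLog t := by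
  refine ⟨_, rfl, _, hB, u, (Prog.ite p q r).machine h, Prog.isBounded_machine hp hq hr
    fun w => ?_, fun w => ?_⟩
  · obtain ⟨K, f, hT, -⟩ := H w
    exact ⟨K, f, hT⟩
  · obtain ⟨K, f, hT, hL⟩ := H w
    rw [NTM.probAccepts_eq, hT.probFrom_eq rfl rfl]
    exact hL

/-- Each factor is the inverse of a natural number in `ℝ≥0∞`; such an inverse is never zero, not
even for `ncard = 0`, where it is `⊤`. -/
theorem NTM.prob_ne_zero {α : Type} {t u : ℕ} (T : NTM α t u) (ρ : List T.Cfg) : T.prob ρ ≠ 0 := by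
  induction ρ with
  | nil => simp [NTM.prob]
  | cons c ρ ih =>
    cases ρ with
    | nil => simp [NTM.prob]
    | cons c' ρ => exact mul_ne_zero (by simp) ih

/-- The same machine works: positive acceptance probability requires an accepting run, and a single
accepting run already has positive probability. -/
theorem RST_subset_NST (α : Type) (R S : Set (ℕ → ℕ)) (t : ℕ) : RST α R S t ⊆ NST α R S t := by
  rintro L ⟨r, hr, s, hs, u, T, hT, hL⟩
  refine ⟨r, hr, s, hs, u, T, hT, fun w => ⟨fun hw => ?_, fun ⟨ρ, hρ⟩ => ?_⟩⟩
  · by_contra hne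
    have : T.probAccepts w = 0 := by
      unfold NTM.probAccepts
      rw [ENNReal.tsum_eq_zero]
      rintro ⟨ρ, hρ⟩
      exact (hne ⟨ρ, hρ⟩).elim
    have h := (hL w).1 hw
    rw [this] at h
    simp at h
  · by_contra hw
    have h := (hL w).2 hw
    unfold NTM.probAccepts at h
    rw [ENNReal.tsum_eq_zero] at h
    exact T.prob_ne_zero ρ (h ⟨ρ, hρ⟩)

/-! ## Registers: natural numbers on internal tapes -/

/-- The successor of a binary number with least significant bit first. -/
def binSucc : List Bool → List Bool
  | [] => [true]
  | false :: l => true :: l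
  | true :: l => false :: binSucc l

def binVal : List Bool → ℕ
  | [] => 0
  | b :: l => b.toNat + 2 * binVal l

/-- The binary representation of a natural number. -/
def bin (n : ℕ) : List Bool := binSucc^[n] []

theorem binVal_binSucc (l : List Bool) : binVal (binSucc l) = binVal l + 1 := by
  induction l with
  | nil => rfl
  | cons b l ih =>
    cases b
    · simp [binSucc, binVal]; omega
    · simp [binSucc, binVal, ih]; omega

theorem bin_succ (n : ℕ) : bin (n + 1) = binSucc (bin n) := Function.iterate_succ_apply' _ _ _

theorem binVal_bin (n : ℕ) : binVal (bin n) = n := by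
  induction n with
  | zero => rfl
  | succ n ih => rw [bin_succ, binVal_binSucc, ih]

theorem bin_injective : Function.Injective bin := fun a b h => by
  rw [← binVal_bin a, h, binVal_bin]

/-- Numerals obtained by counting have no superfluous leading zeros; the inequality expresses this
in a form that is preserved by `binSucc`. -/
theorem two_pow_length_binSucc {l : List Bool} (h : l = [] ∨ 2 ^ l.length ≤ 2 * binVal l) :
    2 ^ (binSucc l).length ≤ 2 * binVal (binSucc l) := by
  induction l with
  | nil => simp [binSucc, binVal]
  | cons b l ih =>
    replace h := h.resolve_left (by simp)
    cases b
    · simp only [binSucc, binVal, List.length_cons, Bool.toNat_false, Bool.toNat_true] at h ⊢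
      omega
    · simp only [binSucc, binVal, List.length_cons, Bool.toNat_false, Bool.toNat_true] at h ⊢
      have := ih (by
        by_cases hl : l = []
        · exact Or.inl hl
        · refine Or.inr ?_
          have : 0 < l.length := List.length_pos_iff.2 hl
          -- For nonempty `l` the power `2 ^ l.length` is even, so the 1 contributed by the lowest
          -- bit can be dropped.
          obtain ⟨k, hk⟩ : ∃ k, l.length = k + 1 := ⟨l.length - 1, by omega⟩
          rw [hk, pow_succ, pow_succ] at h
          rw [hk, pow_succ]
          omega)
      rw [pow_succ]
      omega

/-- This turns bounds on register values into bounds on space. -/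
theorem length_bin_le {n M : ℕ} (h : n ≤ M) : (bin n).length ≤ Nat.log 2 M + 1 := by
  have key : bin n = [] ∨ 2 ^ (bin n).length ≤ 2 * binVal (bin n) := by
    induction n with
    | zero => exact Or.inl rfl
    | succ n ih => rw [bin_succ]; exact Or.inr (two_pow_length_binSucc (ih (by omega)))
  rcases key with h' | h'
  · simp [h']
  · rw [binVal_bin] at h'
    have h₀ : n ≠ 0 := by
      rintro rfl
      simp at h'
    have h₁ : (bin n).length ≤ Nat.log 2 (2 * M) :=
      Nat.le_log_of_pow_le (by norm_num) (h'.trans (by omega))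
    rwa [mul_comm, Nat.log_mul_base (by norm_num) (by omega)] at h₁

/-- The inscription of an internal tape that holds `l`. -/
def regTape (l : List Bool) : ℕ → TSym
  | 0 => .mark
  | p + 1 => (l[p]?).elim .blank .bit

theorem regTape_ne_mark (l : List Bool) {p : ℕ} (h : p ≠ 0) : regTape l p ≠ .mark := by
  cases p with
  | zero => exact (h rfl).elim
  | succ p => simp only [regTape]; cases l[p]? <;> simp

theorem regTape_eq_blank {l : List Bool} {p : ℕ} : regTape l p = .blank ↔ l.length < p := by
  cases p with
  | zero => simp [regTape]
  | succ p =>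
    simp only [regTape]
    by_cases h : p < l.length
    · rw [List.getElem?_eq_getElem h]; simp; omega
    · rw [List.getElem?_eq_none (by omega)]; simp; omega

theorem regTape_append (l : List Bool) (b : Bool) (l' : List Bool) :
    regTape (l ++ b :: l') (l.length + 1) = .bit b := by
  simp [regTape]

theorem update_regTape (l : List Bool) (b c : Bool) (l' : List Bool) :
    Function.update (regTape (l ++ b :: l')) (l.length + 1) (.bit c) = regTape (l ++ c :: l') := by
  funext p
  by_cases h : p = l.length + 1
  · subst h; rw [Function.update_self, regTape_append]
  · rw [Function.update_of_ne h]
    cases p with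
    | zero => rfl
    | succ p =>
      simp only [regTape]
      congr 1
      by_cases h' : p < l.length
      · rw [List.getElem?_append_left h', List.getElem?_append_left h']
      · rw [List.getElem?_append_right (by omega), List.getElem?_append_right (by omega)]
        obtain ⟨k, hk⟩ : ∃ k, p - l.length = k + 1 := ⟨p - l.length - 1, by omega⟩
        rw [hk]; rfl

theorem update_regTape_end (l : List Bool) (c : Bool) :
    Function.update (regTape l) (l.length + 1) (.bit c) = regTape (l ++ [c]) := by
  funext p
  by_cases h : p = l.length + 1
  · subst h; rw [Function.update_self, regTape_append]
  · rw [Function.update_of_ne h]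
    cases p with
    | zero => rfl
    | succ p =>
      simp only [regTape]
      congr 1
      by_cases h' : p < l.length
      · rw [List.getElem?_append_left h']
      · rw [List.getElem?_eq_none (by omega), List.getElem?_eq_none (by simp; omega)]

theorem update_regTape_blank (l : List Bool) (c : Bool) :
    Function.update (regTape (l ++ [c])) (l.length + 1) .blank = regTape l := by
  rw [← update_regTape_end, Function.update_idem, Function.update_eq_self_iff]
  exact (regTape_eq_blank.2 (by omega)).symm

namespace Mem

variable {n : ℕ}

/-- Replace head position and inscription of tape `i`. -/
def upd (m : Mem n) (i : Fin n) (p : ℕ) (T : ℕ → TSym) : Mem n :=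
  ⟨Function.update m.head i p, Function.update m.tape i T⟩

variable (m : Mem n) (i j : Fin n) (p q : ℕ) (T U : ℕ → TSym)

@[simp] theorem upd_head_self : (m.upd i p T).head i = p := Function.update_self ..
@[simp] theorem upd_tape_self : (m.upd i p T).tape i = T := Function.update_self ..
@[simp] theorem upd_upd : (m.upd i p T).upd i q U = m.upd i q U := by simp [upd]

variable {i j}

theorem upd_head_ne (h : j ≠ i) : (m.upd i p T).head j = m.head j := Function.update_of_ne h ..
theorem upd_tape_ne (h : j ≠ i) : (m.upd i p T).tape j = m.tape j := Function.update_of_ne h ..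
theorem upd_comm (h : i ≠ j) : (m.upd i p T).upd j q U = (m.upd j q U).upd i p T := by
  simp only [upd, Function.update_comm h]

variable {m p T}

theorem upd_eq_self (h : m.head i = p) (h' : m.tape i = T) : m.upd i p T = m := by
  subst h h'; simp [upd]

end Mem

namespace Prog

variable {n : ℕ}

def seq (p q : Prog n) : Prog n := ite p q q

infixr:65 " ⨟ " => Prog.seq

/-- Test whether `g` holds for the symbols under the heads. -/
def test (i : Fin n) (g : (Fin n → TSym) → Bool) : Prog n := op id g i .stay

/-- Write the symbol `a` on tape `i` and move the head. -/
def put (i : Fin n) (a : TSym) (d : Move) : Prog n :=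
  op (fun v => Function.update v i a) (fun _ => true) i d

def move (i : Fin n) (d : Move) : Prog n := op id (fun _ => true) i d

/-- Move the head on tape `i` to the marker at its left end. -/
def rewind (i : Fin n) : Prog n := loop (test i fun v => decide (v i ≠ .mark)) (move i .left)

/-- Increment register `i`. -/
def inc (i : Fin n) : Prog n :=
  move i .right ⨟ loop (test i fun v => decide (v i = .bit true)) (put i (.bit false) .right) ⨟
    put i (.bit true) .stay ⨟ rewind i

/-- Set register `i` to zero. -/
def zero (i : Fin n) : Prog n :=
  loop (test i fun v => decide (v i ≠ .blank)) (move i .right) ⨟ move i .left ⨟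
    loop (test i fun v => decide (v i ≠ .mark)) (put i .blank .left)

/-- Test whether the registers `i` and `j` have the same value. -/
def eq (i j : Fin n) : Prog n :=
  loop (test i fun v => decide (v i = v j ∧ v i ≠ .blank)) (move i .right ⨟ move j .right) ⨟
    ite (test i fun v => decide (v i = v j)) (rewind i ⨟ rewind j ⨟ ret true)
      (rewind i ⨟ rewind j ⨟ ret false)

theorem SpaceOk.upd {t B : ℕ} {m : Mem n} (h : SpaceOk t B m) {i : Fin n} {p : ℕ}
    (hp : i.val < t ∨ p ≤ B) (T : ℕ → TSym) : SpaceOk t B (m.upd i p T) := by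
  intro j hj
  by_cases hji : j = i
  · subst hji
    rw [Mem.upd_head_self]
    omega
  · rw [Mem.upd_head_ne _ _ _ hji]
    exact h j hj

end Prog

namespace Run

open Prog

variable {n : ℕ} {ok : Mem n → Prop} {p q : Prog n} {m m' m'' : Mem n} {b b' : Bool}
  {cs cs' : List Bool} {i j : Fin n} {t B : ℕ}

theorem seq (h : Run ok p m cs b m') (h' : Run ok q m' cs' b' m'') :
    Run ok (p ⨟ q) m (cs ++ cs') b' m'' := h.ite (by cases b <;> exact h')

/-- `seq` for programs without coin tosses. -/
theorem seq₀ (h : Run ok p m [] b m') (h' : Run ok q m' [] b' m'') :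
    Run ok (p ⨟ q) m [] b' m'' := h.seq h'

/-- `loop_true` for programs without coin tosses. -/
theorem loop_true₀ {m₁} (h : Run ok p m [] true m') (h₁ : Run ok q m' [] b m₁)
    (h₂ : Run ok (.loop p q) m₁ [] b' m'') : Run ok (.loop p q) m [] b' m'' := h.loop_true h₁ h₂

theorem test (h : ok m) {g} {b} (hb : g m.read = b) : Run ok (.test i g) m [] b m := by
  rw [← hb]
  refine Run.op h ?_ h
  rw [Function.update_eq_self_iff.2 rfl]
  exact m.act_stay

theorem put (h : ok m) {a : TSym} {d : Move} {p : ℕ} (hd : d.Moves (m.head i) p)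
    (h' : ok (m.upd i p (Function.update (m.tape i) (m.head i) a))) :
    Run ok (.put i a d) m [] true (m.upd i p (Function.update (m.tape i) (m.head i) a)) := by
  refine Run.op (g := fun _ => true) h ⟨fun j => ?_, fun j => ?_⟩ h'
  · by_cases hj : j = i
    · subst hj; simpa using hd
    · rw [Function.update_of_ne hj, Mem.upd_head_ne _ _ _ hj]; rfl
  · by_cases hj : j = i
    · subst hj; simp
    · rw [Function.update_of_ne hj, Mem.upd_tape_ne _ _ _ hj]; simp [Mem.read]

theorem move (h : ok m) {d : Move} {p : ℕ} (hd : d.Moves (m.head i) p)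
    (h' : ok (m.upd i p (m.tape i))) :
    Run ok (.move i d) m [] true (m.upd i p (m.tape i)) := by
  refine Run.op (g := fun _ => true) h ⟨fun j => ?_, fun j => ?_⟩ h'
  · by_cases hj : j = i
    · subst hj; simpa using hd
    · rw [Function.update_of_ne hj, Mem.upd_head_ne _ _ _ hj]; rfl
  · by_cases hj : j = i
    · subst hj; simp [Mem.read]
    · rw [Mem.upd_tape_ne _ _ _ hj]; simp [Mem.read]

theorem rewind (h : SpaceOk t B m) {p : ℕ} {T : ℕ → TSym} (hp : p ≤ B) (h₀ : T 0 = .mark)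
    (h₁ : ∀ k, 0 < k → k ≤ p → T k ≠ .mark) :
    Run (SpaceOk t B) (.rewind i) (m.upd i p T) [] true (m.upd i 0 T) := by
  induction p with
  | zero =>
    exact loop_false (Run.test (h.upd (Or.inr hp) T) (by simp [Mem.read, h₀]))
  | succ p ih =>
    have hr : Run (SpaceOk t B) (.test i fun v => decide (v i ≠ .mark)) (m.upd i (p + 1) T) [] true
        (m.upd i (p + 1) T) :=
      Run.test (h.upd (Or.inr hp) T) (by simp [Mem.read, h₁ (p + 1) (by omega) (by omega)])
    have hm : Run (SpaceOk t B) (.move i .left) (m.upd i (p + 1) T) [] true (m.upd i p T) := by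
      have := Run.move (i := i) (d := .left) (p := p) (h.upd (i := i) (Or.inr hp) T) (by simp [Move.Moves])
        (by simpa using h.upd (Or.inr (by omega)) T)
      simpa using this
    exact loop_true₀ hr hm (ih (by omega) fun k hk hk' => h₁ k hk (by omega))

/-- Here `l₀` stands for the bits already passed and `l` for those still to be inspected; the offset
1 is due to the marker in cell 0. The carry stops at cell `p`, where writing one more `true`
completes the successor. -/
theorem carry (h : SpaceOk t B m) (l₀ l : List Bool) (hl : l₀.length + l.length + 1 ≤ B) :
    ∃ p T, Run (SpaceOk t B)
      (.loop (.test i fun v => decide (v i = .bit true)) (.put i (.bit false) .right))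
      (m.upd i (l₀.length + 1) (regTape (l₀ ++ l))) [] true (m.upd i p T) ∧
      p ≤ l₀.length + l.length + 1 ∧ Function.update T p (.bit true) = regTape (l₀ ++ binSucc l) := by
  induction l generalizing l₀ with
  | nil =>
    refine ⟨l₀.length + 1, regTape l₀, ?_, by simp, update_regTape_end _ _⟩
    rw [List.append_nil]
    refine loop_false (Run.test (h.upd (Or.inr (by simpa using hl)) _) ?_)
    have : regTape l₀ (l₀.length + 1) = .blank := regTape_eq_blank.2 (by omega)
    simp [Mem.read, this]
  | cons b l ih =>
    simp only [List.length_cons] at hl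
    have h₀ := h.upd (i := i) (p := l₀.length + 1) (Or.inr (by omega)) (regTape (l₀ ++ b :: l))
    cases b with
    | false =>
      refine ⟨l₀.length + 1, _, loop_false (Run.test h₀ ?_), by omega, update_regTape _ _ _ _⟩
      simp [Mem.read, regTape_append]
    | true =>
      obtain ⟨p, T, h₁, h₂, h₃⟩ := ih (l₀ ++ [false]) (by simp; omega)
      refine ⟨p, T, ?_, by simp at h₂ ⊢; omega, by simpa [binSucc] using h₃⟩
      refine loop_true₀ (b := true) (Run.test h₀ (by simp [Mem.read, regTape_append])) ?_ h₁
      have := Run.put (i := i) (a := .bit false) (d := .right) (p := l₀.length + 1 + 1) h₀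
        (by simp [Move.Moves]) (by simpa using h.upd (Or.inr (by omega)) _)
      simpa [update_regTape] using this

theorem inc (h : SpaceOk t B m) {l : List Bool} (h₀ : m.head i = 0) (h₁ : m.tape i = regTape l)
    (hl : l.length + 1 ≤ B) :
    Run (SpaceOk t B) (.inc i) m [] true (m.upd i 0 (regTape (binSucc l))) := by
  obtain ⟨p, T, h₂, h₃, h₄⟩ := carry (i := i) h [] l (by simpa using hl)
  simp only [List.nil_append, List.length_nil, Nat.zero_add] at h₂ h₃ h₄
  have s₁ := Run.move (i := i) (d := .right) (p := 1) h (by simp [h₀, Move.Moves])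
    (h.upd (Or.inr (by omega)) _)
  rw [h₁] at s₁
  have s₃ := Run.put (i := i) (a := .bit true) (d := .stay) (p := p) h₂.ok_end
    (by simp [Move.Moves]) (by simpa using h.upd (Or.inr (by omega)) _)
  simp only [Mem.upd_upd, Mem.upd_tape_self, Mem.upd_head_self, h₄] at s₃
  exact s₁.seq₀ (h₂.seq₀ (s₃.seq₀ (rewind h (by omega) rfl fun k hk _ => regTape_ne_mark _ hk.ne')))

theorem goto_end (h : SpaceOk t B m) {l : List Bool} (hl : l.length + 1 ≤ B) (k : ℕ) {p : ℕ}
    (hk : p + k = l.length + 1) :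
    Run (SpaceOk t B) (.loop (.test i fun v => decide (v i ≠ .blank)) (.move i .right))
      (m.upd i p (regTape l)) [] true (m.upd i (l.length + 1) (regTape l)) := by
  have h₀ := h.upd (i := i) (p := p) (Or.inr (by omega)) (regTape l)
  induction k generalizing p with
  | zero =>
    obtain rfl : p = l.length + 1 := by omega
    refine loop_false (Run.test h₀ ?_)
    simp [Mem.read, regTape_eq_blank]
  | succ k ih =>
    have s := Run.move (i := i) (d := .right) (p := p + 1) h₀
      (by simp [Move.Moves]) (by simpa using h.upd (Or.inr (by omega)) _)
    simp only [Mem.upd_upd, Mem.upd_tape_self] at s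
    refine loop_true₀ (Run.test h₀ ?_) s (ih (by omega) s.ok_end)
    simp only [Mem.read, Mem.upd_tape_self, Mem.upd_head_self]
    simp [regTape_eq_blank]
    omega

theorem erase (h : SpaceOk t B m) (l : List Bool) (hl : l.length ≤ B) :
    Run (SpaceOk t B) (.loop (.test i fun v => decide (v i ≠ .mark)) (.put i .blank .left))
      (m.upd i l.length (regTape l)) [] true (m.upd i 0 (regTape [])) := by
  induction l using List.reverseRecOn with
  | nil =>
    exact loop_false (Run.test (h.upd (Or.inr hl) _) (by simp [Mem.read, regTape]))
  | append_singleton l b ih =>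
    simp only [List.length_append, List.length_cons, List.length_nil, Nat.zero_add] at hl ⊢
    have h₀ := h.upd (i := i) (Or.inr hl) (regTape (l ++ [b]))
    have s := Run.put (i := i) (a := .blank) (d := .left) (p := l.length) h₀
      (by simp [Move.Moves]) (by simpa using h.upd (Or.inr (by omega)) _)
    simp only [Mem.upd_upd, Mem.upd_tape_self, Mem.upd_head_self, update_regTape_blank] at s
    refine loop_true₀ (Run.test h₀ ?_) s (ih (by omega))
    simp [Mem.read, regTape_append]

theorem zero (h : SpaceOk t B m) {l : List Bool} (h₀ : m.head i = 0) (h₁ : m.tape i = regTape l)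
    (hl : l.length + 1 ≤ B) :
    Run (SpaceOk t B) (.zero i) m [] true (m.upd i 0 (regTape [])) := by
  have s₁ := goto_end (i := i) (p := 0) h hl (l.length + 1) (by omega)
  rw [Mem.upd_eq_self h₀ h₁] at s₁
  have s₂ := Run.move (i := i) (d := .left) (p := l.length) s₁.ok_end
      (by simp [Move.Moves]) (by simpa using h.upd (Or.inr (by omega)) _)
  simp only [Mem.upd_upd, Mem.upd_tape_self] at s₂
  exact s₁.seq₀ (s₂.seq₀ (erase h l (by omega)))

/-- Both heads advance together to the first cell `p` where the symbols differ or are both blank.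
The numerals are equal exactly if the symbols at `p` still agree, and then both are blank. -/
theorem eq (h : SpaceOk t B m) {l l' : List Bool} (hij : i ≠ j) (h₀ : m.head i = 0)
    (h₁ : m.tape i = regTape l) (h₀' : m.head j = 0)
    (h₁' : m.tape j = regTape l') (hl : l.length + 1 ≤ B) (hl' : l'.length + 1 ≤ B) :
    Run (SpaceOk t B) (.eq i j) m [] (decide (l = l')) m := by
  classical
  have hex : ∃ p, ¬ (regTape l p = regTape l' p ∧ regTape l p ≠ .blank) :=
    ⟨l.length + 1, fun h => h.2 (regTape_eq_blank.2 (by omega))⟩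
  obtain ⟨p, hp, hmin⟩ : ∃ p, (¬ (regTape l p = regTape l' p ∧ regTape l p ≠ .blank)) ∧
      ∀ k < p, regTape l k = regTape l' k ∧ regTape l k ≠ .blank :=
    ⟨Nat.find hex, Nat.find_spec hex, fun k hk => not_not.1 (Nat.find_min hex hk)⟩
  have hpl : p ≤ l.length + 1 := by
    by_contra hlt
    exact (hmin (l.length + 1) (by omega)).2 (regTape_eq_blank.2 (by omega))
  have hpl' : p ≤ l'.length + 1 := by
    by_contra hlt
    have := hmin (l'.length + 1) (by omega)
    exact this.2 (this.1 ▸ regTape_eq_blank.2 (by omega))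
  -- The memory with both heads at cell `k`; between `N k` and `N (k + 1)` the heads move one after
  -- the other.
  let N : ℕ → Mem n := fun k => (m.upd i k (regTape l)).upd j k (regTape l')
  have okN : ∀ k ≤ p, SpaceOk t B (N k) := fun k hk =>
    (h.upd (Or.inr (by omega)) _).upd (Or.inr (by omega)) _
  have ri : ∀ k, (N k).read i = regTape l k := fun k => by
    simp only [N, Mem.read, Mem.upd_tape_ne _ _ _ hij, Mem.upd_head_ne _ _ _ hij,
      Mem.upd_tape_self, Mem.upd_head_self]
  have rj : ∀ k, (N k).read j = regTape l' k := fun k => by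
    simp only [N, Mem.read, Mem.upd_tape_self, Mem.upd_head_self]
  have hloop : ∀ k p', p' + k = p → Run (SpaceOk t B)
      (.loop (.test i fun v => decide (v i = v j ∧ v i ≠ .blank)) (.move i .right ⨟ .move j .right))
      (N p') [] true (N p) := by
    intro k
    induction k with
    | zero =>
      rintro p' hk
      obtain rfl : p' = p := hk
      refine loop_false (Run.test (okN _ le_rfl) ?_)
      rw [ri, rj]
      simpa using hp
    | succ k ih =>
      intro p' hk
      have o₁ : SpaceOk t B ((m.upd i (p' + 1) (regTape l)).upd j p' (regTape l')) :=
        (h.upd (Or.inr (by omega)) _).upd (Or.inr (by omega)) _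
      have s₁ : Run (SpaceOk t B) (.move i .right) (N p') [] true
          ((m.upd i (p' + 1) (regTape l)).upd j p' (regTape l')) := by
        have := Run.move (i := i) (d := .right) (p := p' + 1) (okN p' (by omega))
          (by simp only [N, Mem.upd_head_ne _ _ _ hij]; simp [Move.Moves]) (by
            simp only [N, Mem.upd_tape_ne _ _ _ hij, Mem.upd_tape_self]
            rw [Mem.upd_comm _ _ _ _ _ hij.symm]
            simpa using o₁)
        simp only [N, Mem.upd_tape_ne _ _ _ hij, Mem.upd_tape_self] at this
        rw [Mem.upd_comm _ _ _ _ _ hij.symm] at this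
        simpa using this
      have s₂ : Run (SpaceOk t B) (.move j .right)
          ((m.upd i (p' + 1) (regTape l)).upd j p' (regTape l')) [] true (N (p' + 1)) := by
        have := Run.move (i := j) (d := .right) (p := p' + 1) o₁
          (by simp [Move.Moves]) (by simpa using okN (p' + 1) (by omega))
        simpa using this
      refine loop_true₀ (Run.test (okN _ (by omega)) ?_) (s₁.seq₀ s₂) (ih (p' + 1) (by omega))
      rw [ri, rj]
      simpa using hmin p' (by omega)
  have hN₀ : N 0 = m := by
    simp only [N, Mem.upd_eq_self h₀ h₁, Mem.upd_eq_self h₀' h₁']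
  have hr : ∀ b, Run (SpaceOk t B) (.rewind i ⨟ .rewind j ⨟ .ret b) (N p) [] b m := by
    intro b
    have s₁ : Run (SpaceOk t B) (.rewind i) (N p) [] true
        ((m.upd j p (regTape l')).upd i 0 (regTape l)) := by
      simp only [N]
      rw [Mem.upd_comm _ _ _ _ _ hij]
      exact rewind (h.upd (Or.inr (by omega)) _) (by omega) rfl
        fun k hk _ => regTape_ne_mark _ hk.ne'
    have s₂ : Run (SpaceOk t B) (.rewind j) ((m.upd j p (regTape l')).upd i 0 (regTape l)) [] true
        m := by
      have := rewind (i := j) (p := p) (T := regTape l') (h.upd (i := i) (Or.inr (Nat.zero_le B)) (regTape l))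
        (by omega) rfl fun k hk _ => regTape_ne_mark _ hk.ne'
      rw [Mem.upd_comm _ _ _ _ _ hij, Mem.upd_comm _ _ _ _ _ hij, Mem.upd_eq_self h₀' h₁',
        Mem.upd_eq_self h₀ h₁, Mem.upd_comm _ _ _ _ _ hij.symm, Mem.upd_eq_self h₀ h₁] at this
      rwa [Mem.upd_comm _ _ _ _ _ hij.symm, Mem.upd_eq_self h₀ h₁]
    exact s₁.seq₀ (s₂.seq₀ (.halt h))
  have hl := hloop p 0 (by omega)
  rw [hN₀] at hl
  have key : (regTape l p = regTape l' p) ↔ l = l' := by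
    constructor
    · intro he
      have hb : regTape l p = .blank := by
        by_contra hb
        exact hp ⟨he, hb⟩
      have e₁ := regTape_eq_blank.1 hb
      have e₂ := regTape_eq_blank.1 (he ▸ hb)
      refine List.ext_getElem? fun k => ?_
      by_cases hk : k + 1 < p
      · have := (hmin (k + 1) hk).1
        simp only [regTape] at this
        cases h₁ : l[k]? <;> cases h₂ : l'[k]? <;> simp_all
      · rw [List.getElem?_eq_none (by omega), List.getElem?_eq_none (by omega)]
    · rintro rfl; rfl
  refine hl.seq₀ ?_
  by_cases he : l = l'
  · refine Run.ite (cs := []) (b := true) (Run.test (okN _ le_rfl) ?_) (by simpa [he] using hr true)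
    rw [ri, rj]
    simpa using key.2 he
  · refine Run.ite (cs := []) (b := false) (Run.test (okN _ le_rfl) ?_) (by simpa [he] using hr false)
    rw [ri, rj]
    simpa using fun h' => he (key.1 h')

end Run

/-! ## Register programs -/

/-- The inscription of an external tape that holds the word `l`. -/
def wordTape (l : List Letter) : ℕ → TSym := fun p => (l[p]?).elim .blank Letter.sym

theorem wordTape_append (l : List Letter) (a : Letter) :
    Function.update (wordTape l) l.length a.sym = wordTape (l ++ [a]) := by
  funext p
  by_cases h : p = l.length
  · subst h; simp [wordTape]
  · rw [Function.update_of_ne h]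
    simp only [wordTape]
    congr 1
    by_cases h' : p < l.length
    · rw [List.getElem?_append_left h']
    · rw [List.getElem?_eq_none (by omega), List.getElem?_eq_none (by simp; omega)]

/-- A state: head positions and contents of the external tapes, values of the registers. -/
@[ext] structure St (n : ℕ) where
  pos : Fin n → ℕ
  con : Fin n → List Letter
  reg : Fin n → ℕ

namespace St

variable {n : ℕ}

/-- The memory that represents a state if the first `t` tapes are external. -/
def enc (t : ℕ) (s : St n) : Mem n where
  head := fun i => if i.val < t then s.pos i else 0
  tape := fun i => if i.val < t then wordTape (s.con i) else regTape (bin (s.reg i))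

/-- Assign a value to a register. -/
def set (s : St n) (i : Fin n) (v : ℕ) : St n := { s with reg := Function.update s.reg i v }

def setPos (s : St n) (i : Fin n) (v : ℕ) : St n := { s with pos := Function.update s.pos i v }

def setCon (s : St n) (i : Fin n) (l : List Letter) : St n :=
  { s with con := Function.update s.con i l }

variable (s : St n) {i j : Fin n} (v v' : ℕ) (l l' : List Letter)

@[simp] theorem reg_set_self : (s.set i v).reg i = v := Function.update_self ..
theorem reg_set_ne (h : j ≠ i) : (s.set i v).reg j = s.reg j := Function.update_of_ne h ..
theorem reg_set : (s.set i v).reg j = if j = i then v else s.reg j := Function.update_apply ..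
@[simp] theorem set_set : (s.set i v).set i v' = s.set i v' := by simp [set]
theorem set_comm (h : i ≠ j) : (s.set i v).set j v' = (s.set j v').set i v := by
  simp only [set, Function.update_comm h]

variable {s v l}

theorem set_eq_self (h : s.reg i = v) : s.set i v = s := by subst h; simp [set]

variable {t : ℕ}

theorem enc_set (h : t ≤ i.val) : (s.set i v).enc t = (s.enc t).upd i 0 (regTape (bin v)) := by
  refine Mem.ext ?_ ?_
  · funext j
    by_cases hj : j = i
    · subst hj; simp [enc, set, h]
    · rw [Mem.upd_head_ne _ _ _ hj]; rfl
  · funext j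
    by_cases hj : j = i
    · subst hj; simp [enc, set, h]
    · rw [Mem.upd_tape_ne _ _ _ hj]
      simp [enc, set, hj]

theorem enc_setPos (h : i.val < t) : (s.setPos i v).enc t = (s.enc t).upd i v (wordTape (s.con i)) := by
  refine Mem.ext ?_ ?_
  · funext j
    by_cases hj : j = i
    · subst hj; simp [enc, setPos, h]
    · rw [Mem.upd_head_ne _ _ _ hj]
      simp [enc, setPos, hj]
  · funext j
    by_cases hj : j = i
    · subst hj; simp [enc, setPos, h]
    · rw [Mem.upd_tape_ne _ _ _ hj]; rfl

theorem enc_setCon (h : i.val < t) :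
    ((s.setCon i l).setPos i v).enc t = (s.enc t).upd i v (wordTape l) := by
  refine Mem.ext ?_ ?_
  · funext j
    by_cases hj : j = i
    · subst hj; simp [enc, setPos, h]
    · rw [Mem.upd_head_ne _ _ _ hj]
      simp [enc, setPos, setCon, hj]
  · funext j
    by_cases hj : j = i
    · subst hj; simp [enc, setPos, setCon, h]
    · rw [Mem.upd_tape_ne _ _ _ hj]; simp [enc, setPos, setCon, hj]

theorem enc_reg (h : t ≤ i.val) :
    (s.enc t).head i = 0 ∧ (s.enc t).tape i = regTape (bin (s.reg i)) := by
  simp [enc, h]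

theorem enc_pos (h : i.val < t) :
    (s.enc t).head i = s.pos i ∧ (s.enc t).tape i = wordTape (s.con i) := by
  simp [enc, h]

/-- Encoded states have all internal heads on the marker, so space has to be watched only inside the
basic register operations. -/
theorem spaceOk_enc (B : ℕ) : Prog.SpaceOk t B (s.enc t) := fun i hi => by
  simp [enc, Nat.not_lt.2 hi]

end St

namespace Prog

variable {n : ℕ}

/-- Test whether the registers `i` and `j` have different values. -/
def ne (i j : Fin n) : Prog n := ite (eq i j) (ret false) (ret true)

/-- Execute `body` for all values of the register `c` less than the register `r`. -/
def forLoop (c r : Fin n) (body : Prog n) : Prog n := loop (ne c r) (body ⨟ inc c) ⨟ zero c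

/-- Increment register `a` modulo register `p`. -/
def incMod (a p : Fin n) : Prog n := inc a ⨟ ite (eq a p) (zero a) (ret true)

/-- Add register `r` to register `a`, modulo register `p`. -/
def addMod (c a r p : Fin n) : Prog n := forLoop c r (incMod a p)

/-- Copy register `a` to register `b`. -/
def copy (c a b : Fin n) : Prog n := zero b ⨟ forLoop c a (inc b)

/-- Multiply register `a` by register `b`, modulo register `p`. -/
def mulMod (c c' x a b p : Fin n) : Prog n :=
  forLoop c a (addMod c' x b p) ⨟ copy c x a ⨟ zero x

/-- Double register `a`. -/
def double (c x a : Fin n) : Prog n := forLoop c a (inc x ⨟ inc x) ⨟ copy c x a ⨟ zero x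

/-- Assign the value 1. -/
def one (i : Fin n) : Prog n := zero i ⨟ inc i

/-- Test whether the head on the external tape `i` reads `a`. -/
def look (i : Fin n) (a : TSym) : Prog n := test i fun v => decide (v i = a)

end Prog

/-- Executions of register programs. -/
def Runs {n : ℕ} (t M : ℕ) (p : Prog n) (s : St n) (cs : List Bool) (b : Bool) (s' : St n) : Prop :=
  Run (Prog.SpaceOk t (Nat.log 2 M + 2)) p (s.enc t) cs b (s'.enc t)

namespace Runs

open Prog

variable {n t M : ℕ} {p q r : Prog n} {s s' s'' : St n} {b b' : Bool} {cs cs' : List Bool}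
  {i j : Fin n}

theorem ret (b : Bool) : Runs t M (.ret b) s [] b s := .halt (St.spaceOk_enc _)

theorem flip (b : Bool) : Runs t M .flip s [b] b s := Run.flip (St.spaceOk_enc _) b

theorem ite (h : Runs t M p s cs b s') (h' : Runs t M (bif b then q else r) s' cs' b' s'') :
    Runs t M (.ite p q r) s (cs ++ cs') b' s'' := Run.ite h h'

theorem ite_true (h : Runs t M p s [] true s') (h' : Runs t M q s' cs' b' s'') :
    Runs t M (.ite p q r) s cs' b' s'' := Run.ite h h'

theorem ite_false (h : Runs t M p s [] false s') (h' : Runs t M r s' cs' b' s'') :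
    Runs t M (.ite p q r) s cs' b' s'' := Run.ite h h'

theorem seq (h : Runs t M p s cs b s') (h' : Runs t M q s' cs' b' s'') :
    Runs t M (p ⨟ q) s (cs ++ cs') b' s'' := Run.seq h h'

theorem seq₀ (h : Runs t M p s [] b s') (h' : Runs t M q s' cs' b' s'') :
    Runs t M (p ⨟ q) s cs' b' s'' := Run.seq h h'

theorem loop_false (h : Runs t M p s cs false s') : Runs t M (.loop p q) s cs true s' :=
  Run.loop_false h

theorem loop_true {cs₁ : List Bool} {s₁ : St n} (h : Runs t M p s cs true s')
    (h₁ : Runs t M q s' cs₁ b s₁) (h₂ : Runs t M (.loop p q) s₁ cs' b' s'') :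
    Runs t M (.loop p q) s (cs ++ (cs₁ ++ cs')) b' s'' := Run.loop_true h h₁ h₂

/-- The bound concerns the value before the increment. Its numeral has at most `Nat.log 2 M + 1`
bits, and the head goes no further than the cell behind it, whose index is at most `Nat.log 2 M +
2`. -/
theorem inc (hi : t ≤ i.val) (h : s.reg i ≤ M) :
    Runs t M (.inc i) s [] true (s.set i (s.reg i + 1)) := by
  unfold Runs
  rw [St.enc_set hi, bin_succ]
  have := length_bin_le h
  exact Run.inc (St.spaceOk_enc _) (St.enc_reg hi).1 (St.enc_reg hi).2 (by omega)

theorem zero (hi : t ≤ i.val) (h : s.reg i ≤ M) : Runs t M (.zero i) s [] true (s.set i 0) := by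
  unfold Runs
  rw [St.enc_set hi]
  have := length_bin_le h
  exact Run.zero (St.spaceOk_enc _) (St.enc_reg hi).1 (St.enc_reg hi).2 (by omega)

theorem eq (hi : t ≤ i.val) (hj : t ≤ j.val) (hij : i ≠ j) (h : s.reg i ≤ M) (h' : s.reg j ≤ M) :
    Runs t M (.eq i j) s [] (decide (s.reg i = s.reg j)) s := by
  have := length_bin_le h
  have := length_bin_le h'
  have h := Run.eq (St.spaceOk_enc (s := s) (t := t) (Nat.log 2 M + 2)) hij (St.enc_reg hi).1
    (St.enc_reg hi).2 (St.enc_reg hj).1 (St.enc_reg hj).2 (by omega) (by omega)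
  simp only [bin_injective.eq_iff] at h
  exact h

theorem ne (hi : t ≤ i.val) (hj : t ≤ j.val) (hij : i ≠ j) (h : s.reg i ≤ M) (h' : s.reg j ≤ M) :
    Runs t M (.ne i j) s [] (decide (s.reg i ≠ s.reg j)) s := by
  refine (Runs.eq hi hj hij h h').ite (cs' := []) ?_
  by_cases he : s.reg i = s.reg j
  · simpa [he] using ret false
  · simpa [he] using ret true

theorem eq_true (hi : t ≤ i.val) (hj : t ≤ j.val) (hij : i ≠ j) (h : s.reg i ≤ M)
    (h' : s.reg i = s.reg j) : Runs t M (.eq i j) s [] true s := by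
  simpa only [decide_eq_true h'] using Runs.eq hi hj hij h (h' ▸ h)

theorem eq_false (hi : t ≤ i.val) (hj : t ≤ j.val) (hij : i ≠ j) (h : s.reg i ≤ M)
    (h' : s.reg j ≤ M) (hne : s.reg i ≠ s.reg j) : Runs t M (.eq i j) s [] false s := by
  simpa only [decide_eq_false hne] using Runs.eq hi hj hij h h'

theorem ne_false (hi : t ≤ i.val) (hj : t ≤ j.val) (hij : i ≠ j) (h : s.reg i ≤ M)
    (h' : s.reg i = s.reg j) : Runs t M (.ne i j) s [] false s :=
  (eq_true hi hj hij h h').ite_true (ret false)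

theorem ne_true (hi : t ≤ i.val) (hj : t ≤ j.val) (hij : i ≠ j) (h : s.reg i ≤ M)
    (h' : s.reg j ≤ M) (hne : s.reg i ≠ s.reg j) : Runs t M (.ne i j) s [] true s :=
  (eq_false hi hj hij h h' hne).ite_false (ret true)

theorem look_true (hi : i.val < t) {a : TSym} (h : wordTape (s.con i) (s.pos i) = a) :
    Runs t M (.look i a) s [] true s :=
  Run.test (St.spaceOk_enc _) (by simpa [Mem.read, St.enc_pos hi] using h)

theorem look_false (hi : i.val < t) {a : TSym} (h : wordTape (s.con i) (s.pos i) ≠ a) :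
    Runs t M (.look i a) s [] false s :=
  Run.test (St.spaceOk_enc _) (by simpa [Mem.read, St.enc_pos hi] using h)

theorem moveRight (hi : i.val < t) :
    Runs t M (.move i .right) s [] true (s.setPos i (s.pos i + 1)) := by
  have hs := St.spaceOk_enc (s := s) (t := t) (Nat.log 2 M + 2)
  have := Run.move (i := i) (d := .right) (p := s.pos i + 1) hs
    (by simp [St.enc_pos hi, Move.Moves]) (hs.upd (Or.inl hi) _)
  rwa [(St.enc_pos hi).2, ← St.enc_setPos hi] at this

theorem moveLeft (hi : i.val < t) {k : ℕ} (hk : s.pos i = k + 1) :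
    Runs t M (.move i .left) s [] true (s.setPos i k) := by
  have hs := St.spaceOk_enc (s := s) (t := t) (Nat.log 2 M + 2)
  have := Run.move (i := i) (d := .left) (p := k) hs
    (by simp [St.enc_pos hi, Move.Moves, hk]) (hs.upd (Or.inl hi) _)
  rwa [(St.enc_pos hi).2, ← St.enc_setPos hi] at this

theorem append (hi : i.val < t) (h : s.pos i = (s.con i).length) (a : Letter) :
    Runs t M (.put i a.sym .right) s [] true
      ((s.setCon i (s.con i ++ [a])).setPos i (s.pos i + 1)) := by
  have hs := St.spaceOk_enc (s := s) (t := t) (Nat.log 2 M + 2)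
  have := Run.put (i := i) (a := a.sym) (d := .right) (p := s.pos i + 1) hs
    (by simp [St.enc_pos hi, Move.Moves]) (hs.upd (Or.inl hi) _)
  rwa [(St.enc_pos hi).2, (St.enc_pos hi).1, h, wordTape_append, ← h, ← St.enc_setCon hi] at this

/-- The rule for loops: `Inv k cs` holds before the iteration `k` if `cs` are the results of the
coin tosses up to then. -/
theorem forLoop {c x : Fin n} (hc : t ≤ c.val) (hx : t ≤ x.val) (hcx : c ≠ x) {N : ℕ} (hN : N ≤ M)
    (Inv : ℕ → List Bool → St n → Prop) (K : ℕ → ℕ)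
    (hInv : ∀ {k cs s}, Inv k cs s → s.reg c = 0 ∧ s.reg x = N)
    (hbody : ∀ k cs s, k < N → Inv k cs s → ∀ ds : List Bool, ds.length = K k →
      ∃ b s', Runs t M p (s.set c k) ds b (s'.set c k) ∧ Inv (k + 1) (cs ++ ds) s')
    {s : St n} (h₀ : Inv 0 [] s) {cs : List Bool}
    (hcs : cs.length = ∑ i ∈ Finset.range N, K i) :
    ∃ s', Runs t M (.forLoop c x p) s cs true s' ∧ Inv N cs s' := by
  -- Induction on the number `d` of iterations left; `cs` are the past and `ds` the future tosses,
  -- of which iteration `k` consumes the first `K k`. The invariant speaks of the state with counter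
  -- 0, whereas the actual state is `s.set c k`.
  have key : ∀ d k, k + d = N → ∀ cs s, Inv k cs s → ∀ ds : List Bool,
      ds.length + ∑ i ∈ Finset.range k, K i = ∑ i ∈ Finset.range N, K i →
      ∃ s', Runs t M (.loop (.ne c x) (p ⨟ .inc c)) (s.set c k) ds true (s'.set c N) ∧
        Inv N (cs ++ ds) s' := by
    intro d
    induction d with
    | zero =>
      rintro k hk cs s hs ds hds
      obtain rfl : k = N := by omega
      obtain rfl : ds = [] := List.eq_nil_of_length_eq_zero (by omega)
      refine ⟨s, loop_false ?_, by simpa using hs⟩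
      have := Runs.ne (s := s.set c k) (M := M) hc hx hcx (by simpa using hN)
        (by rw [St.reg_set_ne _ _ hcx.symm, (hInv hs).2]; exact hN)
      simpa [St.reg_set_ne _ _ hcx.symm, (hInv hs).2] using this
    | succ d ih =>
      rintro k hk cs s hs ds hds
      have hsum : ∑ i ∈ Finset.range (k + 1), K i ≤ ∑ i ∈ Finset.range N, K i :=
        Finset.sum_le_sum_of_subset (Finset.range_mono (by omega))
      rw [Finset.sum_range_succ] at hsum
      obtain ⟨b, s₁, h₁, h₂⟩ := hbody k cs s (by omega) hs (ds.take (K k)) (by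
        rw [List.length_take]; omega)
      obtain ⟨s', h₃, h₄⟩ := ih (k + 1) (by omega) _ s₁ h₂ (ds.drop (K k)) (by
        rw [List.length_drop, Finset.sum_range_succ]; omega)
      refine ⟨s', ?_, by simpa using h₄⟩
      have e₁ := Runs.ne (s := s.set c k) (M := M) hc hx hcx (by rw [St.reg_set_self]; omega)
        (by rw [St.reg_set_ne _ _ hcx.symm, (hInv hs).2]; exact hN)
      have e₂ := Runs.inc (s := s₁.set c k) (M := M) (i := c) hc (by rw [St.reg_set_self]; omega)
      rw [St.reg_set_self, St.set_set] at e₂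
      have e₃ : decide ((s.set c k).reg c ≠ (s.set c k).reg x) = true := by
        rw [St.reg_set_self, St.reg_set_ne _ _ hcx.symm, (hInv hs).2]
        simp; omega
      rw [e₃] at e₁
      have := loop_true e₁ (h₁.seq e₂) h₃
      simpa using this
  obtain ⟨s', h₁, h₂⟩ := key N 0 (by omega) [] s h₀ cs (by simpa using hcs)
  rw [St.set_eq_self (hInv h₀).1] at h₁
  refine ⟨s', ?_, h₂⟩
  have h₃ := Runs.zero (s := s'.set c N) (M := M) (i := c) hc (by simpa using hN)
  rw [St.set_set, St.set_eq_self (hInv h₂).1] at h₃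
  have h₄ := h₁.seq h₃
  rwa [List.append_nil] at h₄

/-- The rule for loops without coin tosses; `S k` is the state before the iteration `k`. -/
theorem forLoop₀ {c x : Fin n} (hc : t ≤ c.val) (hx : t ≤ x.val) (hcx : c ≠ x) {N : ℕ} (hN : N ≤ M)
    (S : ℕ → St n) (hcS : ∀ k ≤ N, (S k).reg c = 0) (hxS : ∀ k ≤ N, (S k).reg x = N)
    (hbody : ∀ k < N, ∃ b, Runs t M p ((S k).set c k) [] b ((S (k + 1)).set c k)) :
    Runs t M (.forLoop c x p) (S 0) [] true (S N) := by
  obtain ⟨s', h₁, h₂⟩ := forLoop (p := p) hc hx hcx hN (fun k _ s => k ≤ N ∧ s = S k)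
    (fun _ => 0) (by rintro k cs s ⟨hk, rfl⟩; exact ⟨hcS k hk, hxS k hk⟩) (by
      rintro k cs s hk ⟨-, rfl⟩ ds hds
      obtain ⟨b, hb⟩ := hbody k hk
      rw [List.eq_nil_of_length_eq_zero hds]
      exact ⟨b, _, hb, hk, rfl⟩) ⟨Nat.zero_le _, rfl⟩ (cs := []) (by simp)
  rwa [h₂.2] at h₁

theorem one (hi : t ≤ i.val) (h : s.reg i ≤ M) : Runs t M (.one i) s [] true (s.set i 1) := by
  have := (Runs.zero hi h).seq₀ (Runs.inc (s := s.set i 0) (M := M) hi (by simp))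
  rwa [St.reg_set_self, St.set_set] at this

/-- Modulus 0 is included: there the remainder is `k` itself and the successor never reaches `m`.
Trial division will use it. -/
theorem _root_.Nat.mod_succ_eq_ite (k m : ℕ) :
    (if k % m + 1 = m then 0 else k % m + 1) = (k + 1) % m := by
  rcases Nat.eq_zero_or_pos m with rfl | hm
  · simp
  · have h₁ := Nat.mod_lt k hm
    have h₂ : (k + 1) % m = (k % m + 1) % m := by simp
    split_ifs with h
    · rw [h₂, h, Nat.mod_self]
    · rw [h₂]; exact (Nat.mod_eq_of_lt (by omega)).symm

theorem incMod {a x : Fin n} (ha : t ≤ a.val) (hx : t ≤ x.val) (hax : a ≠ x) {k : ℕ}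
    (hk : s.reg a = k % s.reg x) (h : s.reg a + 1 ≤ M) (h' : s.reg x ≤ M) :
    ∃ b, Runs t M (.incMod a x) s [] b (s.set a ((k + 1) % s.reg x)) := by
  have h₁ := Runs.inc (s := s) (M := M) ha (by omega)
  rw [← Nat.mod_succ_eq_ite, ← hk]
  by_cases he : s.reg a + 1 = s.reg x
  · have h₂ := Runs.eq_true (s := s.set a (s.reg a + 1)) (M := M) ha hx hax (by simpa using h)
      (by simpa [St.reg_set_ne _ _ hax.symm] using he)
    have h₃ := Runs.zero (s := s.set a (s.reg a + 1)) (M := M) (i := a) ha (by simpa using h)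
    rw [St.set_set] at h₃
    rw [if_pos he]
    exact ⟨_, h₁.seq₀ (h₂.ite_true h₃)⟩
  · have h₂ := Runs.eq_false (s := s.set a (s.reg a + 1)) (M := M) ha hx hax (by simpa using h)
      (by rwa [St.reg_set_ne _ _ hax.symm]) (by simpa [St.reg_set_ne _ _ hax.symm] using he)
    rw [if_neg he]
    exact ⟨_, h₁.seq₀ (h₂.ite_false (Runs.ret true))⟩

/-- For a positive modulus the intermediate values stay below it; for modulus 0 nothing is reduced
and the bound must come from the sum, hence the alternative `hM`. -/
theorem addMod {c a y x : Fin n} (hc : t ≤ c.val) (ha : t ≤ a.val) (hy : t ≤ y.val) (hx : t ≤ x.val)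
    (hca : c ≠ a) (hcy : c ≠ y) (hcx : c ≠ x) (hay : a ≠ y) (hax : a ≠ x) {A : ℕ}
    (h₀ : s.reg c = 0) (hA : s.reg a = A % s.reg x) (hyM : s.reg y ≤ M) (hxM : s.reg x ≤ M)
    (hM : 0 < s.reg x ∨ A + s.reg y ≤ M) :
    Runs t M (.addMod c a y x) s [] true (s.set a ((A + s.reg y) % s.reg x)) := by
  have := forLoop₀ (p := .incMod a x) (t := t) hc hy hcy hyM
    (fun k => s.set a ((A + k) % s.reg x))
    (fun k _ => by rw [St.reg_set_ne _ _ hca, h₀]) (fun k _ => St.reg_set_ne _ _ hay.symm)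
    (fun k hk => by
      have := incMod (s := (s.set a ((A + k) % s.reg x)).set c k) (M := M) ha hx hax (k := A + k)
        (by rw [St.reg_set_ne _ _ hca.symm, St.reg_set_self, St.reg_set_ne _ _ hcx.symm,
          St.reg_set_ne _ _ hax.symm]) (by
          rw [St.reg_set_ne _ _ hca.symm, St.reg_set_self]
          rcases hM with hM | hM
          · have := Nat.mod_lt (A + k) hM; omega
          · have := Nat.mod_le (A + k) (s.reg x); omega)
        (by rwa [St.reg_set_ne _ _ hcx.symm, St.reg_set_ne _ _ hax.symm])
      rw [St.reg_set_ne _ _ hcx.symm, St.reg_set_ne _ _ hax.symm, St.set_comm _ _ _ hca, St.set_set] at this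
      exact this)
  rwa [Nat.add_zero, ← hA, St.set_eq_self rfl] at this

theorem copy {c a d : Fin n} (hc : t ≤ c.val) (ha : t ≤ a.val) (hd : t ≤ d.val) (hca : c ≠ a)
    (hcd : c ≠ d) (had : a ≠ d) (h₀ : s.reg c = 0) (haM : s.reg a ≤ M) (hdM : s.reg d ≤ M) :
    Runs t M (.copy c a d) s [] true (s.set d (s.reg a)) := by
  refine (Runs.zero hd hdM).seq₀ ?_
  exact forLoop₀ (p := .inc d) (t := t) hc ha hca haM (fun k => s.set d k)
    (fun k _ => by rw [St.reg_set_ne _ _ hcd, h₀]) (fun k _ => St.reg_set_ne _ _ had)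
    (fun k hk => by
      have := Runs.inc (s := (s.set d k).set c k) (M := M) hd (by
        rw [St.reg_set_ne _ _ hcd.symm, St.reg_set_self]; omega)
      rw [St.reg_set_ne _ _ hcd.symm, St.reg_set_self, St.set_comm _ _ _ hcd, St.set_set] at this
      exact ⟨_, this⟩)

/-- The product is collected in the scratch register `y`, since `a` bounds the loop. Clearing `y` at
the end restores the state for the next call. -/
theorem mulMod {c c' y a d x : Fin n} (hc : t ≤ c.val) (hc' : t ≤ c'.val) (hy : t ≤ y.val)
    (ha : t ≤ a.val) (hd : t ≤ d.val) (hx : t ≤ x.val) (hcc' : c ≠ c') (hcy : c ≠ y) (hca : c ≠ a)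
    (hcd : c ≠ d) (hcx : c ≠ x) (hcy' : c' ≠ y) (hcd' : c' ≠ d) (hcx' : c' ≠ x)
    (hya : y ≠ a) (hyd : y ≠ d) (hyx : y ≠ x)
    (h₀ : s.reg c = 0) (h₀' : s.reg c' = 0) (h₁ : s.reg y = 0)
    (haM : s.reg a ≤ M) (hdM : s.reg d ≤ M) (hxM : s.reg x ≤ M) (hx₀ : 0 < s.reg x) :
    Runs t M (.mulMod c c' y a d x) s [] true (s.set a ((s.reg a * s.reg d) % s.reg x)) := by
  have r₁ := forLoop₀ (p := .addMod c' y d x) (t := t) hc ha hca haM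
    (fun k => s.set y ((k * s.reg d) % s.reg x))
    (fun k _ => by rw [St.reg_set_ne _ _ hcy, h₀]) (fun k _ => St.reg_set_ne _ _ hya.symm)
    (fun k hk => by
      have e : ∀ z, z ≠ c → z ≠ y → ((s.set y ((k * s.reg d) % s.reg x)).set c k).reg z = s.reg z :=
        fun z h h' => by rw [St.reg_set_ne _ _ h, St.reg_set_ne _ _ h']
      have := addMod (s := (s.set y ((k * s.reg d) % s.reg x)).set c k) (M := M) hc' hy hd hx
        hcy' hcd' hcx' hyd hyx (A := k * s.reg d) (by rw [e _ hcc'.symm hcy', h₀'])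
        (by rw [e _ hcx.symm hyx.symm, St.reg_set_ne _ _ hcy.symm, St.reg_set_self])
        (by rwa [e _ hcd.symm hyd.symm]) (by rwa [e _ hcx.symm hyx.symm])
        (Or.inl (by rwa [e _ hcx.symm hyx.symm]))
      rw [e _ hcx.symm hyx.symm, e _ hcd.symm hyd.symm, St.set_comm _ _ _ hcy, St.set_set] at this
      refine ⟨true, ?_⟩
      rwa [add_mul, one_mul])
  simp only [Nat.zero_mul, Nat.zero_mod] at r₁
  rw [St.set_eq_self h₁] at r₁
  have hlt : s.reg a * s.reg d % s.reg x < s.reg x := Nat.mod_lt _ hx₀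
  have r₂ := copy (s := s.set y ((s.reg a * s.reg d) % s.reg x)) (M := M) (c := c) hc hy ha hcy hca
    hya (by rw [St.reg_set_ne _ _ hcy, h₀]) (by rw [St.reg_set_self]; omega)
    (by rwa [St.reg_set_ne _ _ hya.symm])
  rw [St.reg_set_self] at r₂
  have r₃ := Runs.zero (s := (s.set y ((s.reg a * s.reg d) % s.reg x)).set a
    ((s.reg a * s.reg d) % s.reg x)) (M := M) (i := y) hy (by
      rw [St.reg_set_ne _ _ hya, St.reg_set_self]; omega)
  rw [St.set_comm _ _ _ hya, St.set_set, St.set_eq_self (i := y) (v := 0)] at r₃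
  · rw [St.set_comm _ _ _ hya] at r₂
    exact r₁.seq₀ (r₂.seq₀ r₃)
  · rw [St.reg_set_ne _ _ hya, h₁]

theorem double {c y a : Fin n} (hc : t ≤ c.val) (hy : t ≤ y.val) (ha : t ≤ a.val)
    (hcy : c ≠ y) (hca : c ≠ a) (hya : y ≠ a) (h₀ : s.reg c = 0) (h₁ : s.reg y = 0)
    (haM : 2 * s.reg a ≤ M) : Runs t M (.double c y a) s [] true (s.set a (2 * s.reg a)) := by
  have r₁ := forLoop₀ (p := .inc y ⨟ .inc y) (t := t) (M := M) hc ha hca (N := s.reg a) (by omega)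
    (fun k => s.set y (2 * k))
    (fun k _ => by rw [St.reg_set_ne _ _ hcy, h₀]) (fun k _ => St.reg_set_ne _ _ hya.symm)
    (fun k hk => by
      have e₁ := Runs.inc (s := (s.set y (2 * k)).set c k) (t := t) (M := M) (i := y) hy (by
        rw [St.reg_set_ne _ _ hcy.symm, St.reg_set_self]; omega)
      rw [St.reg_set_ne _ _ hcy.symm, St.reg_set_self, St.set_comm _ _ _ hcy, St.set_set] at e₁
      have e₂ := Runs.inc (s := (s.set y (2 * k + 1)).set c k) (t := t) (M := M) (i := y) hy (by
        rw [St.reg_set_ne _ _ hcy.symm, St.reg_set_self]; omega)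
      rw [St.reg_set_ne _ _ hcy.symm, St.reg_set_self, St.set_comm _ _ _ hcy, St.set_set] at e₂
      exact ⟨_, e₁.seq₀ e₂⟩)
  rw [Nat.mul_zero, St.set_eq_self h₁] at r₁
  have r₂ := copy (s := s.set y (2 * s.reg a)) (M := M) (c := c) hc hy ha hcy hca
    hya (by rw [St.reg_set_ne _ _ hcy, h₀]) (by rw [St.reg_set_self]; omega)
    (by rw [St.reg_set_ne _ _ hya.symm]; omega)
  rw [St.reg_set_self] at r₂
  have r₃ := Runs.zero (s := (s.set y (2 * s.reg a)).set a (2 * s.reg a)) (M := M) (i := y) hy (by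
      rw [St.reg_set_ne _ _ hya, St.reg_set_self]; omega)
  rw [St.set_comm _ _ _ hya, St.set_set, St.set_eq_self (i := y) (v := 0)] at r₃
  · rw [St.set_comm _ _ _ hya] at r₂
    exact r₁.seq₀ (r₂.seq₀ r₃)
  · rw [St.reg_set_ne _ _ hya, h₁]

end Runs

/-! ## The variables of the programs -/

/-- The external tapes (contents and head positions) and the registers of the programs. -/
structure Vars where
  pos₀ : ℕ := 0
  pos₁ : ℕ := 0
  con₀ : List Letter := []
  con₁ : List Letter := []
  n : ℕ := 0
  m : ℕ := 0
  par : ℕ := 0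
  lb : ℕ := 0
  d : ℕ := 0
  q : ℕ := 0
  x : ℕ := 0
  y : ℕ := 0
  p : ℕ := 0
  h : ℕ := 0
  acc : ℕ := 0
  A : ℕ := 0
  j : ℕ := 0
  e : ℕ := 0
  comp : ℕ := 0
  bad : ℕ := 0
  tot : ℕ := 0
  ka : ℕ := 0
  kb : ℕ := 0
  tt : ℕ := 0
  k : ℕ := 0
  a : ℕ := 0
  b : ℕ := 0
  i : ℕ := 0
  res : ℕ := 0
  c₀ : ℕ := 0
  c₁ : ℕ := 0
  c₂ : ℕ := 0
  tmp : ℕ := 0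
  one : ℕ := 0

namespace Reg

abbrev n : Fin 33 := 2
abbrev m : Fin 33 := 3
abbrev par : Fin 33 := 4
abbrev lb : Fin 33 := 5
abbrev d : Fin 33 := 6
abbrev q : Fin 33 := 7
abbrev x : Fin 33 := 8
abbrev y : Fin 33 := 9
abbrev p : Fin 33 := 10
abbrev h : Fin 33 := 11
abbrev acc : Fin 33 := 12
abbrev A : Fin 33 := 13
abbrev j : Fin 33 := 14
abbrev e : Fin 33 := 15
abbrev comp : Fin 33 := 16
abbrev bad : Fin 33 := 17
abbrev tot : Fin 33 := 18
abbrev ka : Fin 33 := 19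
abbrev kb : Fin 33 := 20
abbrev tt : Fin 33 := 21
abbrev k : Fin 33 := 22
abbrev a : Fin 33 := 23
abbrev b : Fin 33 := 24
abbrev i : Fin 33 := 25
abbrev res : Fin 33 := 26
abbrev c₀ : Fin 33 := 27
abbrev c₁ : Fin 33 := 28
abbrev c₂ : Fin 33 := 29
abbrev tmp : Fin 33 := 30
abbrev one : Fin 33 := 31
/-- The value of this register is always zero. -/
abbrev zer : Fin 33 := 32

end Reg

namespace Vars

/-- The state given by the variables. -/
def st (v : Vars) : St 33 where
  pos := fun i => if i = 0 then v.pos₀ else if i = 1 then v.pos₁ else 0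
  con := fun i => if i = 0 then v.con₀ else if i = 1 then v.con₁ else []
  reg := ![0, 0, v.n, v.m, v.par, v.lb, v.d, v.q, v.x, v.y, v.p, v.h, v.acc, v.A, v.j, v.e,
    v.comp, v.bad, v.tot, v.ka, v.kb, v.tt, v.k, v.a, v.b, v.i, v.res, v.c₀, v.c₁,
    v.c₂, v.tmp, v.one, 0]

variable (v : Vars) (z : ℕ) (l : List Letter)

-- These rules turn register access into projections and updates of records, so that `simp` executes
-- programs symbolically.
@[simp] theorem reg_n : v.st.reg Reg.n = v.n := rfl
@[simp] theorem reg_m : v.st.reg Reg.m = v.m := rfl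
@[simp] theorem reg_par : v.st.reg Reg.par = v.par := rfl
@[simp] theorem reg_lb : v.st.reg Reg.lb = v.lb := rfl
@[simp] theorem reg_d : v.st.reg Reg.d = v.d := rfl
@[simp] theorem reg_q : v.st.reg Reg.q = v.q := rfl
@[simp] theorem reg_x : v.st.reg Reg.x = v.x := rfl
@[simp] theorem reg_y : v.st.reg Reg.y = v.y := rfl
@[simp] theorem reg_p : v.st.reg Reg.p = v.p := rfl
@[simp] theorem reg_h : v.st.reg Reg.h = v.h := rfl
@[simp] theorem reg_acc : v.st.reg Reg.acc = v.acc := rfl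
@[simp] theorem reg_A : v.st.reg Reg.A = v.A := rfl
@[simp] theorem reg_j : v.st.reg Reg.j = v.j := rfl
@[simp] theorem reg_e : v.st.reg Reg.e = v.e := rfl
@[simp] theorem reg_comp : v.st.reg Reg.comp = v.comp := rfl
@[simp] theorem reg_bad : v.st.reg Reg.bad = v.bad := rfl
@[simp] theorem reg_tot : v.st.reg Reg.tot = v.tot := rfl
@[simp] theorem reg_ka : v.st.reg Reg.ka = v.ka := rfl
@[simp] theorem reg_kb : v.st.reg Reg.kb = v.kb := rfl
@[simp] theorem reg_tt : v.st.reg Reg.tt = v.tt := rfl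
@[simp] theorem reg_k : v.st.reg Reg.k = v.k := rfl
@[simp] theorem reg_a : v.st.reg Reg.a = v.a := rfl
@[simp] theorem reg_b : v.st.reg Reg.b = v.b := rfl
@[simp] theorem reg_i : v.st.reg Reg.i = v.i := rfl
@[simp] theorem reg_res : v.st.reg Reg.res = v.res := rfl
@[simp] theorem reg_c₀ : v.st.reg Reg.c₀ = v.c₀ := rfl
@[simp] theorem reg_c₁ : v.st.reg Reg.c₁ = v.c₁ := rfl
@[simp] theorem reg_c₂ : v.st.reg Reg.c₂ = v.c₂ := rfl
@[simp] theorem reg_tmp : v.st.reg Reg.tmp = v.tmp := rfl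
@[simp] theorem reg_one : v.st.reg Reg.one = v.one := rfl
@[simp] theorem reg_zer : v.st.reg Reg.zer = 0 := rfl
@[simp] theorem st_pos₀ : v.st.pos 0 = v.pos₀ := rfl
@[simp] theorem st_pos₁ : v.st.pos 1 = v.pos₁ := rfl
@[simp] theorem st_con₀ : v.st.con 0 = v.con₀ := rfl
@[simp] theorem st_con₁ : v.st.con 1 = v.con₁ := rfl

@[simp] theorem set_n : v.st.set Reg.n z = { v with n := z }.st :=
  St.ext rfl rfl (by funext i; fin_cases i <;> rfl)
@[simp] theorem set_m : v.st.set Reg.m z = { v with m := z }.st :=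
  St.ext rfl rfl (by funext i; fin_cases i <;> rfl)
@[simp] theorem set_par : v.st.set Reg.par z = { v with par := z }.st :=
  St.ext rfl rfl (by funext i; fin_cases i <;> rfl)
@[simp] theorem set_lb : v.st.set Reg.lb z = { v with lb := z }.st :=
  St.ext rfl rfl (by funext i; fin_cases i <;> rfl)
@[simp] theorem set_d : v.st.set Reg.d z = { v with d := z }.st :=
  St.ext rfl rfl (by funext i; fin_cases i <;> rfl)
@[simp] theorem set_q : v.st.set Reg.q z = { v with q := z }.st :=
  St.ext rfl rfl (by funext i; fin_cases i <;> rfl)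
@[simp] theorem set_x : v.st.set Reg.x z = { v with x := z }.st :=
  St.ext rfl rfl (by funext i; fin_cases i <;> rfl)
@[simp] theorem set_y : v.st.set Reg.y z = { v with y := z }.st :=
  St.ext rfl rfl (by funext i; fin_cases i <;> rfl)
@[simp] theorem set_p : v.st.set Reg.p z = { v with p := z }.st :=
  St.ext rfl rfl (by funext i; fin_cases i <;> rfl)
@[simp] theorem set_h : v.st.set Reg.h z = { v with h := z }.st :=
  St.ext rfl rfl (by funext i; fin_cases i <;> rfl)
@[simp] theorem set_acc : v.st.set Reg.acc z = { v with acc := z }.st :=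
  St.ext rfl rfl (by funext i; fin_cases i <;> rfl)
@[simp] theorem set_A : v.st.set Reg.A z = { v with A := z }.st :=
  St.ext rfl rfl (by funext i; fin_cases i <;> rfl)
@[simp] theorem set_j : v.st.set Reg.j z = { v with j := z }.st :=
  St.ext rfl rfl (by funext i; fin_cases i <;> rfl)
@[simp] theorem set_e : v.st.set Reg.e z = { v with e := z }.st :=
  St.ext rfl rfl (by funext i; fin_cases i <;> rfl)
@[simp] theorem set_comp : v.st.set Reg.comp z = { v with comp := z }.st :=
  St.ext rfl rfl (by funext i; fin_cases i <;> rfl)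
@[simp] theorem set_bad : v.st.set Reg.bad z = { v with bad := z }.st :=
  St.ext rfl rfl (by funext i; fin_cases i <;> rfl)
@[simp] theorem set_tot : v.st.set Reg.tot z = { v with tot := z }.st :=
  St.ext rfl rfl (by funext i; fin_cases i <;> rfl)
@[simp] theorem set_ka : v.st.set Reg.ka z = { v with ka := z }.st :=
  St.ext rfl rfl (by funext i; fin_cases i <;> rfl)
@[simp] theorem set_kb : v.st.set Reg.kb z = { v with kb := z }.st :=
  St.ext rfl rfl (by funext i; fin_cases i <;> rfl)
@[simp] theorem set_tt : v.st.set Reg.tt z = { v with tt := z }.st :=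
  St.ext rfl rfl (by funext i; fin_cases i <;> rfl)
@[simp] theorem set_k : v.st.set Reg.k z = { v with k := z }.st :=
  St.ext rfl rfl (by funext i; fin_cases i <;> rfl)
@[simp] theorem set_a : v.st.set Reg.a z = { v with a := z }.st :=
  St.ext rfl rfl (by funext i; fin_cases i <;> rfl)
@[simp] theorem set_b : v.st.set Reg.b z = { v with b := z }.st :=
  St.ext rfl rfl (by funext i; fin_cases i <;> rfl)
@[simp] theorem set_i : v.st.set Reg.i z = { v with i := z }.st :=
  St.ext rfl rfl (by funext i; fin_cases i <;> rfl)
@[simp] theorem set_res : v.st.set Reg.res z = { v with res := z }.st :=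
  St.ext rfl rfl (by funext i; fin_cases i <;> rfl)
@[simp] theorem set_c₀ : v.st.set Reg.c₀ z = { v with c₀ := z }.st :=
  St.ext rfl rfl (by funext i; fin_cases i <;> rfl)
@[simp] theorem set_c₁ : v.st.set Reg.c₁ z = { v with c₁ := z }.st :=
  St.ext rfl rfl (by funext i; fin_cases i <;> rfl)
@[simp] theorem set_c₂ : v.st.set Reg.c₂ z = { v with c₂ := z }.st :=
  St.ext rfl rfl (by funext i; fin_cases i <;> rfl)
@[simp] theorem set_tmp : v.st.set Reg.tmp z = { v with tmp := z }.st :=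
  St.ext rfl rfl (by funext i; fin_cases i <;> rfl)
@[simp] theorem set_one : v.st.set Reg.one z = { v with one := z }.st :=
  St.ext rfl rfl (by funext i; fin_cases i <;> rfl)
@[simp] theorem set_pos₀ : v.st.setPos 0 z = { v with pos₀ := z }.st :=
  St.ext (by funext i; fin_cases i <;> rfl) rfl rfl
@[simp] theorem set_pos₁ : v.st.setPos 1 z = { v with pos₁ := z }.st :=
  St.ext (by funext i; fin_cases i <;> rfl) rfl rfl
@[simp] theorem set_con₀ : v.st.setCon 0 l = { v with con₀ := l }.st :=
  St.ext rfl (by funext i; fin_cases i <;> rfl) rfl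
@[simp] theorem set_con₁ : v.st.setCon 1 l = { v with con₁ := l }.st :=
  St.ext rfl (by funext i; fin_cases i <;> rfl) rfl

end Vars

/-! ## Number-theoretic procedures -/

namespace Prog

/-- Assign 1 to `comp` if `c₁` is a proper divisor of `p`. -/
def tryDivisor : Prog 33 :=
  addMod Reg.c₂ Reg.tmp Reg.p Reg.c₁ ⨟
    ite (eq Reg.tmp Reg.zer) (ite (eq Reg.c₁ Reg.one) (ret true) (one Reg.comp)) (ret true) ⨟
    zero Reg.tmp

/-- Test whether `p` is composite. -/
def composite : Prog 33 :=
  forLoop Reg.c₁ Reg.p tryDivisor ⨟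
  ite (ne Reg.comp Reg.zer) (zero Reg.comp ⨟ ret true) (ret false)

/-- Let `p` be the least prime number greater than `q`. -/
def findPrime : Prog 33 :=
  copy Reg.c₁ Reg.q Reg.p ⨟ inc Reg.p ⨟ loop composite (inc Reg.p)

/-- Update the fingerprint at the end of a word. -/
def finishWord : Prog 33 :=
  addMod Reg.c₁ Reg.h Reg.x Reg.p ⨟ mulMod Reg.c₁ Reg.c₂ Reg.tmp Reg.acc Reg.h Reg.p ⨟
  ite (eq Reg.j Reg.m) (copy Reg.c₁ Reg.acc Reg.A ⨟ copy Reg.c₁ Reg.e Reg.acc) (ret true) ⨟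
  inc Reg.j ⨟ one Reg.h

/-- Update the fingerprint when a letter is read. -/
def hashLetter : Letter → Prog 33
  | .bit b => mulMod Reg.c₁ Reg.c₂ Reg.tmp Reg.h Reg.y Reg.p ⨟
      bif b then incMod Reg.h Reg.p else ret true
  | .hash => finishWord

end Prog

/-- Intermediate results of the computation of fingerprints: the hash value `h` of a part of the
current word, the product `acc` for the current half, the product `A` for the first half and the
number `j` of the current word. -/
structure HashState where
  h : ℕ
  acc : ℕ
  A : ℕ
  j : ℕ

/-- The step of the computation of fingerprints for one letter. -/
def HashState.step (x y p m e : ℕ) (σ : HashState) : Letter → HashState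
  | .bit b => { σ with h := (σ.h * y + b.toNat) % p }
  | .hash =>
    -- The value 1 is the leading coefficient of the next word. At the separator of word `m` the
    -- finished product is saved in `A`, and the other half starts from `e`.
    { h := 1
      acc := if σ.j = m then e else σ.acc * ((σ.h + x) % p) % p
      A := if σ.j = m then σ.acc * ((σ.h + x) % p) % p else σ.A
      j := σ.j + 1 }

/-- The intermediate results are remainders modulo `p`. -/
structure HashState.Reduced (p : ℕ) (σ : HashState) : Prop where
  h_lt : σ.h < p
  acc_lt : σ.acc < p
  A_lt : σ.A < p

theorem HashState.Reduced.step {x y p m e : ℕ} {σ : HashState} (h : σ.Reduced p) (hp : 1 < p)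
    (he : e < p) (a : Letter) : (σ.step x y p m e a).Reduced p := by
  cases a with
  | bit b => exact ⟨Nat.mod_lt _ (by omega), h.acc_lt, h.A_lt⟩
  | hash =>
    refine ⟨hp, ?_, ?_⟩ <;> simp only [HashState.step] <;> split_ifs
    · exact he
    · exact Nat.mod_lt _ (by omega)
    · exact Nat.mod_lt _ (by omega)
    · exact h.A_lt

namespace Vars

/-- The variables between the calls of procedures. -/
abbrev idle (v : Vars) : Vars := { v with c₁ := 0, c₂ := 0, tmp := 0, comp := 0, one := 1 }

/-- Assign intermediate results of the computation of fingerprints. -/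
abbrev withHash (v : Vars) (σ : HashState) : Vars :=
  { v with h := σ.h, acc := σ.acc, A := σ.A, j := σ.j }

end Vars

namespace Runs

open Prog Vars

variable {t M : ℕ} (ht : t ≤ 2) (v : Vars)

include ht

theorem composite (hp : 2 ≤ v.p) (hpM : v.p ≤ M) :
    ∃ b, Runs t M Prog.composite v.idle.st [] b v.idle.st ∧ (b = true ↔ ¬ v.p.Prime) := by
  classical
  have hI : ∀ (i : Fin 33) (_ : 2 ≤ i.val := by decide), t ≤ i.val := fun i hi => ht.trans hi
  -- The flag `comp` before the divisor `k` is tried; `f v.p` vanishes exactly if `v.p` is prime.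
  let f : ℕ → ℕ := fun k => if ∃ a < k, a ≠ 1 ∧ a ∣ v.p then 1 else 0
  have hf : ∀ k, f k ≤ 1 := fun k => by simp only [f]; split_ifs <;> simp
  have h₁ := forLoop₀ (t := t) (M := M) (c := Reg.c₁) (x := Reg.p) (N := v.p)
    (p := tryDivisor)
    (hI _) (hI _) (by decide) hpM
    (fun k => { v.idle with comp := f k }.st) (fun k _ => rfl) (fun k _ => rfl) (by
      intro k hk
      simp only [set_c₁]
      have a₁ := addMod (s := { v.idle with comp := f k, c₁ := k }.st) (t := t) (M := M)
        (c := Reg.c₂) (a := Reg.tmp) (y := Reg.p) (x := Reg.c₁) (hI _) (hI _) (hI _) (hI _)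
        (by decide) (by decide) (by decide) (by decide) (by decide) (A := 0) rfl
        -- The loop starts with the divisor 0, for which the remainder is `v.p` and nothing is
        -- flagged; this is why the second alternative of `addMod` is taken.
        (by simp) (by simpa using hpM) (by simp; omega) (Or.inr (by simpa using hpM))
      simp only [reg_p, reg_c₁, set_tmp, Nat.zero_add] at a₁
      have hmod : v.p % k ≤ M := (Nat.mod_le _ _).trans hpM
      have a₂ := fun h => Runs.eq_true (s := { v.idle with comp := f k, c₁ := k, tmp := v.p % k }.st)
        (t := t) (M := M) (i := Reg.tmp) (j := Reg.zer) (hI _) (hI _) (by decide)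
        (by simpa using hmod) h
      have a₂' := fun h => Runs.eq_false (s := { v.idle with comp := f k, c₁ := k, tmp := v.p % k }.st)
        (t := t) (M := M) (i := Reg.tmp) (j := Reg.zer) (hI _) (hI _) (by decide)
        (by simpa using hmod) (by simp) h
      have a₃ := fun h => Runs.eq_true (s := { v.idle with comp := f k, c₁ := k, tmp := v.p % k }.st)
        (t := t) (M := M) (i := Reg.c₁) (j := Reg.one) (hI _) (hI _) (by decide) (by simp; omega) h
      have a₃' := fun h => Runs.eq_false
        (s := { v.idle with comp := f k, c₁ := k, tmp := v.p % k }.st) (t := t)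
        (M := M) (i := Reg.c₁) (j := Reg.one) (hI _) (hI _) (by decide)
        (by simp; omega) (by simp; omega) h
      have a₄ := Runs.one (s := { v.idle with comp := f k, c₁ := k, tmp := v.p % k }.st) (t := t)
        (M := M) (i := Reg.comp) (hI _) (by simpa using (hf k).trans (by omega))
      have a₅ := fun f' => Runs.zero (s := { v.idle with comp := f', c₁ := k, tmp := v.p % k }.st)
        (t := t) (M := M) (i := Reg.tmp) (hI _) (by simpa using hmod)
      simp only [set_comp, set_tmp, reg_tmp, reg_zer, reg_c₁, reg_one] at a₂ a₂' a₃ a₃' a₄ a₅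
      have hsucc : f (k + 1) = if v.p % k = 0 ∧ k ≠ 1 then 1 else f k := by
        simp only [f]
        split_ifs with g₁ g₂ g₃ g₂ g₃
        · rfl
        · rfl
        · obtain ⟨a, ha, ha'⟩ := g₁
          rcases Nat.lt_succ_iff_lt_or_eq.1 ha with h | rfl
          · exact (g₃ ⟨a, h, ha'⟩).elim
          · exact (g₂ ⟨Nat.mod_eq_zero_of_dvd ha'.2, ha'.1⟩).elim
        · exact (g₁ ⟨k, by omega, g₂.2, Nat.dvd_of_mod_eq_zero g₂.1⟩).elim
        · obtain ⟨a, ha, ha'⟩ := g₃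
          exact (g₁ ⟨a, by omega, ha'⟩).elim
        · rfl
      rw [hsucc]
      by_cases hz : v.p % k = 0
      · by_cases h1 : k = 1
        · rw [if_neg (by simp [h1])]
          exact ⟨_, a₁.seq₀ (((a₂ hz).ite_true ((a₃ h1).ite_true (Runs.ret true))).seq₀ (a₅ _))⟩
        · rw [if_pos ⟨hz, h1⟩]
          exact ⟨_, a₁.seq₀ (((a₂ hz).ite_true ((a₃' h1).ite_false a₄)).seq₀ (a₅ _))⟩
      · rw [if_neg (by simp [hz])]
        exact ⟨_, a₁.seq₀ (((a₂' hz).ite_false (Runs.ret true)).seq₀ (a₅ _))⟩)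
  have h₂ := fun h => Runs.ne_true (s := { v.idle with comp := f v.p }.st) (t := t) (M := M)
    (i := Reg.comp) (j := Reg.zer) (hI _) (hI _) (by decide)
    (by simpa using (hf _).trans (by omega)) (by simp) h
  have h₂' := fun h => Runs.ne_false (s := { v.idle with comp := f v.p }.st) (t := t) (M := M)
    (i := Reg.comp) (j := Reg.zer) (hI _) (hI _) (by decide)
    (by simpa using (hf _).trans (by omega)) h
  have h₃ := Runs.zero (s := { v.idle with comp := f v.p }.st) (t := t) (M := M)
    (i := Reg.comp) (hI _) (by simpa using (hf _).trans (by omega))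
  simp only [set_comp, reg_comp, reg_zer] at h₂ h₂' h₃
  have hf₀ : f 0 = 0 := by simp [f]
  have hprime : f v.p = 0 ↔ v.p.Prime := by
    rw [Nat.prime_def_lt]
    simp only [f]
    split_ifs with g
    · obtain ⟨a, ha, ha₁, ha₂⟩ := g
      simp only [false_iff]
      exact fun h => ha₁ (h.2 a ha ha₂)
    · simp only [true_iff]
      exact ⟨hp, fun a ha hd => by
        by_contra h1
        exact g ⟨a, ha, h1, hd⟩⟩
  simp only [hf₀] at h₁
  by_cases hc : f v.p = 0
  · refine ⟨false, h₁.seq₀ ?_, by simpa using hprime.1 hc⟩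
    have h₂ := h₂' hc
    rw [hc] at h₂ ⊢
    exact h₂.ite_false (Runs.ret false)
  · exact ⟨true, h₁.seq₀ ((h₂ hc).ite_true (h₃.seq₀ (Runs.ret true))),
      by simpa using fun h => hc (hprime.2 h)⟩

/-- Bertrand's postulate ends the search at or before `2 * v.q`, so all candidates fit into the
registers. The least such prime is taken because the search rejects only composite numbers. -/
theorem findPrime (hq : 0 < v.q) (hqM : 2 * v.q ≤ M) (hpM : v.p ≤ M) :
    ∃ p, p.Prime ∧ v.q < p ∧ p ≤ 2 * v.q ∧
      Runs t M Prog.findPrime v.idle.st [] true { v.idle with p := p }.st := by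
  have hI : ∀ (i : Fin 33) (_ : 2 ≤ i.val := by decide), t ≤ i.val := fun i hi => ht.trans hi
  have hex : ∃ p, p.Prime ∧ v.q < p ∧ p ≤ 2 * v.q := by
    simpa [and_assoc] using Nat.exists_prime_lt_and_le_two_mul v.q (by omega)
  classical
  obtain ⟨p, hpp, hqp, hp2, hmin⟩ : ∃ p, p.Prime ∧ v.q < p ∧ p ≤ 2 * v.q ∧
      ∀ k, v.q < k → k < p → ¬ k.Prime := by
    have h := Nat.find_spec hex
    exact ⟨Nat.find hex, h.1, h.2.1, h.2.2, fun k hk hkp hkP =>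
      Nat.find_min hex hkp ⟨hkP, hk, by omega⟩⟩
  refine ⟨p, hpp, hqp, hp2, ?_⟩
  have h₁ := Runs.copy (s := v.idle.st) (t := t) (M := M) (c := Reg.c₁) (a := Reg.q) (d := Reg.p)
    (hI _) (hI _) (hI _) (by decide) (by decide) (by decide) rfl (by simp; omega)
    (by simpa using hpM)
  have h₂ := Runs.inc (s := { v.idle with p := v.q }.st) (t := t) (M := M) (i := Reg.p) (hI _)
    (by simp; omega)
  simp only [reg_q, reg_p, set_p] at h₁ h₂
  have h₃ : ∀ d k, v.q < k → k + d = p →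
      Runs t M (.loop .composite (.inc Reg.p)) { v.idle with p := k }.st [] true
        { v.idle with p := p }.st := by
    intro d
    induction d with
    | zero =>
      rintro k hk rfl
      obtain ⟨b, h, hb⟩ := composite ht { v with p := k } hpp.two_le (by dsimp; omega) (M := M)
      obtain rfl : b = false := Bool.eq_false_iff.2 fun h' => hb.1 h' hpp
      exact loop_false h
    | succ d ih =>
      intro k hk hkp
      obtain ⟨b, e₁, hb⟩ :=
        composite ht { v with p := k } (by dsimp; omega) (by dsimp; omega) (M := M)
      obtain rfl := hb.2 (hmin k hk (by omega))
      have e₂ := Runs.inc (s := { v.idle with p := k }.st) (t := t) (M := M) (i := Reg.p) (hI _)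
        (by simp; omega)
      simp only [reg_p, set_p] at e₂
      exact loop_true e₁ e₂ (ih (k + 1) (by omega) (by omega))
  exact h₁.seq₀ (h₂.seq₀ (h₃ (p - (v.q + 1)) (v.q + 1) (by omega) (by omega)))

theorem finishWord {σ : HashState} (hσ : σ.Reduced v.p) (hp : 1 < v.p) (hpM : v.p ≤ M)
    (hj : σ.j ≤ M) (he : v.e < v.p) (hx : v.x ≤ M) (hm : v.m ≤ M) :
    Runs t M Prog.finishWord (v.withHash σ).idle.st [] true
      (v.withHash (σ.step v.x v.y v.p v.m v.e .hash)).idle.st := by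
  have hI : ∀ (i : Fin 33) (_ : 2 ≤ i.val := by decide), t ≤ i.val := fun i hi => ht.trans hi
  obtain ⟨hh, hacc, hA⟩ := hσ
  have h₁ := Runs.addMod (s := (v.withHash σ).idle.st) (t := t) (M := M)
        (c := Reg.c₁) (a := Reg.h) (y := Reg.x) (x := Reg.p) (hI _) (hI _) (hI _) (hI _)
        (by decide) (by decide) (by decide) (by decide) (by decide) (A := σ.h) rfl
        (by simpa using (Nat.mod_eq_of_lt hh).symm) (by simpa using hx) (by simpa using hpM)
        (Or.inl (by simp; omega))
  simp only [reg_x, reg_p, set_h] at h₁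
  have hh' : (σ.h + v.x) % v.p < v.p := Nat.mod_lt _ (by omega)
  have h₂ := Runs.mulMod (s := { (v.withHash σ).idle with h := (σ.h + v.x) % v.p }.st) (t := t)
    (M := M) (c := Reg.c₁) (c' := Reg.c₂) (y := Reg.tmp) (a := Reg.acc) (d := Reg.h) (x := Reg.p)
    (hI _) (hI _) (hI _) (hI _) (hI _) (hI _) (by decide) (by decide) (by decide) (by decide)
    (by decide) (by decide) (by decide) (by decide) (by decide) (by decide) (by decide)
    rfl rfl rfl (by simp; omega) (by simp; omega) (by simp; omega) (by simp; omega)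
  simp only [reg_acc, reg_p, reg_h, set_acc] at h₂
  have hacc' : σ.acc * ((σ.h + v.x) % v.p) % v.p < v.p := Nat.mod_lt _ (by omega)
  generalize hB : σ.acc * ((σ.h + v.x) % v.p) % v.p = B at h₂ hacc'
  generalize hC : (σ.h + v.x) % v.p = C at h₁ h₂ hh' hB
  have h₃ := fun h => Runs.eq_true (s := { (v.withHash σ).idle with h := C, acc := B }.st) (t := t)
    (M := M) (i := Reg.j) (j := Reg.m) (hI _) (hI _) (by decide) (by simpa using hj) h
  have h₃' := fun h => Runs.eq_false (s := { (v.withHash σ).idle with h := C, acc := B }.st) (t := t)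
    (M := M) (i := Reg.j) (j := Reg.m) (hI _) (hI _) (by decide) (by simpa using hj)
    (by simpa using hm) h
  have h₄ := Runs.copy (s := { (v.withHash σ).idle with h := C, acc := B }.st) (t := t)
    (M := M) (c := Reg.c₁) (a := Reg.acc) (d := Reg.A)
    (hI _) (hI _) (hI _) (by decide) (by decide) (by decide) rfl (by simp; omega) (by simp; omega)
  have h₅ := Runs.copy (s := { (v.withHash σ).idle with h := C, acc := B, A := B }.st) (t := t)
    (M := M) (c := Reg.c₁) (a := Reg.e) (d := Reg.acc)
    (hI _) (hI _) (hI _) (by decide) (by decide) (by decide) rfl (by simp; omega) (by simp; omega)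
  simp only [reg_acc, reg_j, reg_m, reg_e, set_acc, set_A] at h₃ h₃' h₄ h₅
  have h₆ := fun acc A => Runs.inc (s := { (v.withHash σ).idle with h := C, acc := acc, A := A }.st)
    (t := t) (M := M) (i := Reg.j) (hI _) (by simpa using hj)
  have h₇ := fun acc A => Runs.one
    (s := { (v.withHash σ).idle with h := C, acc := acc, A := A, j := σ.j + 1 }.st)
    (t := t) (M := M) (i := Reg.h) (hI _) (by simp; omega)
  simp only [reg_j, set_j, set_h] at h₆ h₇
  refine h₁.seq₀ (h₂.seq₀ ?_)
  simp only [HashState.step, hC, hB]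
  by_cases hjm : σ.j = v.m
  · rw [if_pos hjm, if_pos hjm]
    exact ((h₃ hjm).ite_true (h₄.seq₀ h₅)).seq₀ ((h₆ _ _).seq₀ (h₇ _ _))
  · rw [if_neg hjm, if_neg hjm]
    exact ((h₃' hjm).ite_false (Runs.ret true)).seq₀ ((h₆ _ _).seq₀ (h₇ _ _))

theorem hashLetter {σ : HashState} (hσ : σ.Reduced v.p) (hp : 1 < v.p) (hpM : v.p ≤ M)
    (hj : σ.j ≤ M) (he : v.e < v.p) (hx : v.x ≤ M) (hy : v.y ≤ M) (hm : v.m ≤ M) (a : Letter) :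
    ∃ b, Runs t M (Prog.hashLetter a) (v.withHash σ).idle.st [] b
      (v.withHash (σ.step v.x v.y v.p v.m v.e a)).idle.st := by
  cases a with
  | hash => exact ⟨_, finishWord ht v hσ hp hpM hj he hx hm⟩
  | bit b =>
    have hI : ∀ (i : Fin 33) (_ : 2 ≤ i.val := by decide), t ≤ i.val := fun i hi => ht.trans hi
    obtain ⟨hh, hacc, hA⟩ := hσ
    have h₂ := Runs.mulMod (s := (v.withHash σ).idle.st) (t := t)
      (M := M) (c := Reg.c₁) (c' := Reg.c₂) (y := Reg.tmp) (a := Reg.h) (d := Reg.y) (x := Reg.p)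
      (hI _) (hI _) (hI _) (hI _) (hI _) (hI _) (by decide) (by decide) (by decide) (by decide)
      (by decide) (by decide) (by decide) (by decide) (by decide) (by decide) (by decide)
      rfl rfl rfl (by simp; omega) (by simp; omega) (by simp; omega) (by simp; omega)
    simp only [reg_y, reg_p, reg_h, set_h] at h₂
    have hlt : σ.h * v.y % v.p < v.p := Nat.mod_lt _ (by omega)
    cases b with
    | false => exact ⟨_, h₂.seq₀ (Runs.ret true)⟩
    | true =>
      obtain ⟨b, h₃⟩ := Runs.incMod
        (s := { (v.withHash σ).idle with h := σ.h * v.y % v.p }.st) (t := t) (M := M) (a := Reg.h)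
        (x := Reg.p) (hI _) (hI _) (by decide) (k := σ.h * v.y) (by simp) (by simp; omega)
        (by simp; omega)
      simp only [reg_p, set_h] at h₃
      exact ⟨_, h₂.seq₀ h₃⟩

end Runs

/-! ## Parsing the input -/

def Letter.isHash : Letter → Bool
  | .bit _ => false
  | .hash => true

/-- The number of the words of the input. -/
def hashes (w : List Letter) : ℕ := w.countP Letter.isHash

/-- 1 if the last word of the input is not terminated. -/
def lastBit (w : List Letter) : ℕ := if w.getLast?.elim true Letter.isHash then 0 else 1

theorem encodeList_append (vs vs' : List (List Bool)) :
    encodeList (vs ++ vs') = encodeList vs ++ encodeList vs' := List.flatMap_append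

theorem encodeList_cons (v : List Bool) (vs : List (List Bool)) :
    encodeList (v :: vs) = v.map .bit ++ .hash :: encodeList vs := by
  simp [encodeList]

theorem hashes_encodeList (vs : List (List Bool)) : hashes (encodeList vs) = vs.length := by
  induction vs with
  | nil => rfl
  | cons v vs ih =>
    have h : List.countP Letter.isHash (v.map Letter.bit) = 0 := by
      rw [List.countP_eq_zero]
      intro a ha
      obtain ⟨b, -, rfl⟩ := List.mem_map.1 ha
      simp [Letter.isHash]
    rw [hashes] at ih
    rw [encodeList_cons, hashes, List.countP_append, List.countP_cons, ih, h]
    simp [Letter.isHash]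

/-- The first `#` of a string marks the end of its first word, so strings decode uniquely. This is
needed because membership in a problem asks only for some decoding. -/
theorem encodeList_injective : Function.Injective encodeList := by
  have key : ∀ (v v' : List Bool) (l l' : List Letter),
      v.map Letter.bit ++ .hash :: l = v'.map Letter.bit ++ .hash :: l' → v = v' ∧ l = l' := by
    intro v
    induction v with
    | nil =>
      intro v' l l' h
      cases v' with
      | nil => simpa using h
      | cons b v' => simp at h
    | cons a v ih =>
      intro v' l l' h
      cases v' with
      | nil => simp at h
      | cons b v' =>
        simp only [List.map_cons, List.cons_append, List.cons.injEq, Letter.bit.injEq] at h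
        obtain ⟨rfl, h⟩ := h
        obtain ⟨rfl, rfl⟩ := ih v' l l' h
        exact ⟨rfl, rfl⟩
  intro vs
  induction vs with
  | nil =>
    intro vs' h
    cases vs' with
    | nil => rfl
    | cons v vs' => simp [encodeList] at h
  | cons v vs ih =>
    intro vs' h
    cases vs' with
    | nil => simp [encodeList] at h
    | cons v' vs' =>
      rw [encodeList_cons, encodeList_cons] at h
      obtain ⟨rfl, h'⟩ := key _ _ _ _ h
      rw [ih h']

/-- Every string is an encoded list followed by an unfinished word, and the last letter shows
whether that word is empty. -/
theorem lastBit_eq_zero {w : List Letter} : lastBit w = 0 ↔ ∃ vs, w = encodeList vs := by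
  have h : ∀ w : List Letter, ∃ (vs : List (List Bool)) (v : List Bool),
      w = encodeList vs ++ v.map Letter.bit := by
    intro w
    induction w using List.reverseRecOn with
    | nil => exact ⟨[], [], rfl⟩
    | append_singleton w a ih =>
      obtain ⟨vs, v, rfl⟩ := ih
      cases a with
      | bit b => exact ⟨vs, v ++ [b], by simp⟩
      | hash => exact ⟨vs ++ [v], [], by simp [encodeList]⟩
  constructor
  · intro h0
    obtain ⟨vs, v, rfl⟩ := h w
    induction v using List.reverseRecOn with
    | nil => exact ⟨vs, by simp⟩
    | append_singleton v b _ => simp [lastBit, ← List.append_assoc, Letter.isHash] at h0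
  · rintro ⟨vs, rfl⟩
    induction vs using List.reverseRecOn with
    | nil => rfl
    | append_singleton vs v _ =>
      simp [lastBit, encodeList, ← List.append_assoc, Letter.isHash]

/-- The instances of the problems. -/
def IsInstance (w : List Letter) : Prop := lastBit w = 0 ∧ hashes w % 2 = 0

theorem IsInstance.exists {w : List Letter} (h : IsInstance w) :
    ∃ vs vs' : List (List Bool), vs.length = hashes w / 2 ∧ vs'.length = hashes w / 2 ∧
      w = encodeList vs ++ encodeList vs' := by
  obtain ⟨ws, rfl⟩ := lastBit_eq_zero.1 h.1
  have h₂ := h.2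
  rw [hashes_encodeList] at h₂ ⊢
  refine ⟨ws.take (ws.length / 2), ws.drop (ws.length / 2), by simp; omega, by simp; omega, ?_⟩
  rw [← encodeList_append, List.take_append_drop]

theorem isInstance_of_mem_listProblem {P} {w : List Letter} (h : w ∈ listProblem P) :
    IsInstance w := by
  obtain ⟨vs, vs', hl, rfl, -⟩ := h
  rw [← encodeList_append]
  exact ⟨lastBit_eq_zero.2 ⟨_, rfl⟩, by rw [hashes_encodeList]; simp; omega⟩

/-- Unique decoding fixes the concatenated list, and equal lengths force the cut into its middle. -/
theorem mem_listProblem_iff {P} {vs vs' : List (List Bool)} (hl : vs.length = vs'.length) :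
    encodeList vs ++ encodeList vs' ∈ listProblem P ↔ P vs vs' := by
  constructor
  · rintro ⟨us, us', hl', he, hP⟩
    rw [← encodeList_append, ← encodeList_append] at he
    have he := encodeList_injective he
    have hlen := congrArg List.length he
    simp only [List.length_append] at hlen
    obtain ⟨rfl, rfl⟩ := List.append_inj he (by omega)
    exact hP
  · exact fun h => ⟨vs, vs', hl, rfl, h⟩

namespace Prog

/-- Put marks at the left ends of the internal tapes. -/
def prepare (t : ℕ) : Prog 33 :=
  op (fun v i => if i.val < t then v i else .mark) (fun _ => true) 0 .stay ⨟ one Reg.one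

def scanLetter : Prog 33 :=
  ite (look 0 .hash) (zero Reg.lb ⨟ ite (eq Reg.par Reg.zer) (inc Reg.par) (zero Reg.par ⨟ inc Reg.m))
    (one Reg.lb) ⨟ inc Reg.n ⨟ move 0 .right

/-- Compute the length of the input and the number of its words. -/
def scan : Prog 33 :=
  loop (ite (look 0 .blank) (ret false) (ret true)) scanLetter ⨟
    ite (eq Reg.lb Reg.zer) (eq Reg.par Reg.zer) (ret false)

/-- Let `d` be `2 * n * n + 1`. -/
def computeBound : Prog 33 :=
  forLoop Reg.c₁ Reg.n (forLoop Reg.c₂ Reg.n (inc Reg.d ⨟ inc Reg.d)) ⨟ inc Reg.d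

end Prog

theorem wordTape_lt {l : List Letter} {k : ℕ} (h : k < l.length) : wordTape l k = l[k].sym := by
  simp [wordTape, h]

theorem wordTape_ge {l : List Letter} {k : ℕ} (h : l.length ≤ k) : wordTape l k = .blank := by
  simp [wordTape, h]

/-- The variables when the prefix `u` of the input `w` has been scanned. -/
abbrev Vars.scanned (w u : List Letter) : Vars :=
  Vars.idle { con₀ := w, pos₀ := u.length, n := u.length, m := hashes u / 2, par := hashes u % 2,
              lb := lastBit u }

namespace Runs

open Prog Vars

variable {t M : ℕ}

/-- The initial memory is not an encoded state, because the markers on the internal tapes are still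
missing; hence `Run` instead of `Runs`. -/
theorem prepare (w : List Letter) (ht₀ : 0 < t) (ht : t ≤ 2) :
    Run (SpaceOk t (Nat.log 2 M + 2)) (.prepare t) (initMem 33 w) [] true
      ((scanned w []).st.enc t) := by
  have h₁ : Run (SpaceOk t (Nat.log 2 M + 2))
      (.op (fun v i => if i.val < t then v i else .mark) (fun _ => true) 0 .stay) (initMem 33 w) []
      true (({ con₀ := w } : Vars).st.enc t) := by
    refine Run.op (g := fun _ => true) (fun i _ => Nat.zero_le _) ?_ (St.spaceOk_enc _)
    constructor
    · intro i
      have : Function.update (fun _ : Fin 33 => Move.stay) 0 Move.stay = fun _ => Move.stay := by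
        simp
      rw [this]
      simp [Move.Moves, St.enc, initMem, Vars.st]
    · intro i
      have hreg : ∀ i, ({ con₀ := w } : Vars).st.reg i = 0 := by
        intro i
        fin_cases i <;> rfl
      funext p
      simp only [St.enc, initMem, Mem.read, hreg]
      split_ifs with h h0 h0
      · obtain rfl : i = 0 := Fin.ext h0
        by_cases hp : p = 0
        · subst hp; simp [Vars.st, wordTape]
        · rw [Function.update_of_ne hp]; simp [Vars.st, wordTape]
      · have : i ≠ 0 := fun h => h0 (by rw [h]; rfl)
        by_cases hp : p = 0
        · subst hp; simp [Vars.st, wordTape, this]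
        · rw [Function.update_of_ne hp]; simp [Vars.st, wordTape, this]
      · omega
      · by_cases hp : p = 0
        · subst hp; simp [regTape]
        · rw [Function.update_of_ne hp]
          exact regTape_eq_blank.2 (Nat.pos_of_ne_zero hp)
  have h₂ := Runs.one (s := ({ con₀ := w } : Vars).st) (t := t) (M := M) (i := Reg.one)
    (ht.trans (by decide)) (by simp)
  simp only [set_one] at h₂
  exact h₁.seq₀ h₂

theorem scanLetter (ht₀ : 0 < t) (ht : t ≤ 2) {w u l : List Letter} {a : Letter}
    (hw : w = u ++ a :: l) (hM : w.length ≤ M) (hM₁ : 1 ≤ M) :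
    ∃ b, Runs t M .scanLetter (scanned w u).st [] b (scanned w (u ++ [a])).st := by
  have hI : ∀ (i : Fin 33) (_ : 2 ≤ i.val := by decide), t ≤ i.val := fun i hi => ht.trans hi
  have hlen : w.length = u.length + 1 + l.length := by rw [hw]; simp; omega
  have hhash : hashes u ≤ M := by
    have : hashes u ≤ u.length := List.countP_le_length
    omega
  have hlb : lastBit u ≤ 1 := by unfold lastBit; split_ifs <;> simp
  have hread : wordTape ((scanned w u).st.con 0) ((scanned w u).st.pos 0) = a.sym := by
    simp only [st_pos₀, st_con₀]
    rw [wordTape_lt (by omega)]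
    simp [hw]
  have h₁ := fun h => Runs.look_true (s := (scanned w u).st) (t := t) (M := M) (i := 0)
    (a := .hash) ht₀ (hread.trans h)
  have h₁' := fun h => Runs.look_false (s := (scanned w u).st) (t := t) (M := M) (i := 0)
    (a := .hash) ht₀ (hread.trans_ne h)
  have g₁ := fun v : Vars => Runs.inc (s := v.st) (t := t) (M := M) (i := Reg.n) (hI _)
  have g₂ := fun v : Vars => Runs.moveRight (s := v.st) (t := t) (M := M) (i := 0) ht₀
  simp only [set_n, reg_n, st_pos₀, set_pos₀] at g₁ g₂
  cases a with
  | bit b =>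
    have h₃ := Runs.one (s := (scanned w u).st) (t := t) (M := M) (i := Reg.lb) (hI _)
      (by simp; omega)
    simp only [set_lb] at h₃
    refine ⟨true, ((h₁' (by simp [Letter.sym])).ite_false h₃).seq₀
      ((g₁ _ (by dsimp only; omega)).seq₀ ?_)⟩
    have h₄ := g₂ { scanned w u with lb := 1, n := u.length + 1 }
    simpa [scanned, hashes, lastBit, Letter.isHash] using h₄
  | hash =>
    have h₃ := Runs.zero (s := (scanned w u).st) (t := t) (M := M) (i := Reg.lb) (hI _)
      (by simp; omega)
    simp only [set_lb] at h₃
    have h₄ := fun h => Runs.eq_true (s := { scanned w u with lb := 0 }.st)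
        (t := t) (M := M) (i := Reg.par) (j := Reg.zer) (hI _) (hI _) (by decide)
        (by simp; omega) h
    have h₄' := fun h => Runs.eq_false (s := { scanned w u with lb := 0 }.st)
        (t := t) (M := M) (i := Reg.par) (j := Reg.zer) (hI _) (hI _) (by decide)
        (by simp; omega) (by simp) h
    have h₅ := Runs.inc (s := { scanned w u with lb := 0 }.st) (t := t) (M := M) (i := Reg.par)
      (hI _) (by simp; omega)
    have h₆ := Runs.zero (s := { scanned w u with lb := 0 }.st) (t := t) (M := M) (i := Reg.par)
      (hI _) (by simp; omega)
    have h₇ := Runs.inc (s := { scanned w u with lb := 0, par := 0 }.st) (t := t) (M := M)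
      (i := Reg.m) (hI _) (by simp; omega)
    simp only [reg_par, reg_zer, set_par, reg_m, set_m] at h₄ h₄' h₅ h₆ h₇
    have hs : hashes (u ++ [.hash]) = hashes u + 1 := by simp [hashes, Letter.isHash]
    have hl : lastBit (u ++ [.hash]) = 0 := by simp [lastBit, Letter.isHash]
    by_cases hp : hashes u % 2 = 0
    · refine ⟨true, ((h₁ rfl).ite_true
        (h₃.seq₀ ((h₄ hp).ite_true h₅))).seq₀ ((g₁ _ (by dsimp only; omega)).seq₀ ?_)⟩
      have h₄ := g₂ { scanned w u with lb := 0, par := hashes u % 2 + 1, n := u.length + 1 }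
      have e₁ : (hashes u + 1) / 2 = hashes u / 2 := by omega
      have e₂ : (hashes u + 1) % 2 = hashes u % 2 + 1 := by omega
      simpa [scanned, hs, hl, e₁, e₂] using h₄
    · refine ⟨true, ((h₁ rfl).ite_true
        (h₃.seq₀ ((h₄' hp).ite_false (h₆.seq₀ h₇)))).seq₀ ((g₁ _ (by dsimp only; omega)).seq₀ ?_)⟩
      have h₄ := g₂ { scanned w u with
          lb := 0, par := 0, m := hashes u / 2 + 1, n := u.length + 1 }
      have e₁ : (hashes u + 1) / 2 = hashes u / 2 + 1 := by omega
      have e₂ : (hashes u + 1) % 2 = 0 := by omega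
      simpa [scanned, hs, hl, e₁, e₂] using h₄

theorem scan (ht₀ : 0 < t) (ht : t ≤ 2) (w : List Letter) (hM : w.length ≤ M) (hM₁ : 1 ≤ M) :
    ∃ b, Runs t M .scan (scanned w []).st [] b (scanned w w).st ∧ (b = true ↔ IsInstance w) := by
  have hI : ∀ (i : Fin 33) (_ : 2 ≤ i.val := by decide), t ≤ i.val := fun i hi => ht.trans hi
  have hloop : ∀ l u, w = u ++ l →
      Runs t M (.loop (.ite (.look 0 .blank) (.ret false) (.ret true)) .scanLetter)
        (scanned w u).st [] true (scanned w w).st := by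
    intro l
    induction l with
    | nil =>
      intro u hu
      rw [List.append_nil] at hu
      subst hu
      exact loop_false ((Runs.look_true ht₀ (wordTape_ge le_rfl)).ite_true (Runs.ret false))
    | cons a l ih =>
      intro u hu
      obtain ⟨b, hb⟩ := scanLetter ht₀ ht hu hM hM₁
      have h : wordTape ((scanned w u).st.con 0) ((scanned w u).st.pos 0) ≠ .blank := by
        rw [st_con₀, st_pos₀, wordTape_lt (by simp [hu])]
        exact Letter.sym_ne_blank _
      exact loop_true ((Runs.look_false ht₀ h).ite_false (Runs.ret true)) hb (ih (u ++ [a]) (by simp [hu]))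
  have hlb : lastBit w ≤ 1 := by unfold lastBit; split_ifs <;> simp
  have h₁ := Runs.eq_true (s := (scanned w w).st)
    (t := t) (M := M) (i := Reg.lb) (j := Reg.zer) (hI _) (hI _) (by decide) (by simp; omega)
  have h₁' := Runs.eq_false (s := (scanned w w).st)
    (t := t) (M := M) (i := Reg.lb) (j := Reg.zer) (hI _) (hI _) (by decide) (by simp; omega)
    (by simp)
  have h₂ := Runs.eq_true (s := (scanned w w).st)
    (t := t) (M := M) (i := Reg.par) (j := Reg.zer) (hI _) (hI _) (by decide) (by simp; omega)
  have h₂' := Runs.eq_false (s := (scanned w w).st)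
    (t := t) (M := M) (i := Reg.par) (j := Reg.zer) (hI _) (hI _) (by decide) (by simp; omega)
    (by simp)
  simp only [reg_lb, reg_par, reg_zer] at h₁ h₁' h₂ h₂'
  have hl := hloop w [] rfl
  by_cases hz : lastBit w = 0
  · by_cases hp : hashes w % 2 = 0
    · exact ⟨_, hl.seq₀ ((h₁ hz).ite_true (h₂ hp)), by simp [IsInstance, hz, hp]⟩
    · exact ⟨_, hl.seq₀ ((h₁ hz).ite_true (h₂' hp)), by simp [IsInstance, hp]⟩
  · exact ⟨_, hl.seq₀ ((h₁' hz).ite_false (Runs.ret false)), by simp [IsInstance, hz]⟩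

theorem computeBound (ht : t ≤ 2) (v : Vars) (hM : v.d + 2 * (v.n * v.n) + 1 ≤ M) :
    Runs t M .computeBound v.idle.st [] true
      { v.idle with d := v.d + 2 * (v.n * v.n) + 1 }.st := by
  have hI : ∀ (i : Fin 33) (_ : 2 ≤ i.val := by decide), t ≤ i.val := fun i hi => ht.trans hi
  have hn : v.n ≤ M := by nlinarith [v.n.zero_le]
  have h₁ := forLoop₀ (t := t) (M := M) (c := Reg.c₁) (x := Reg.n) (N := v.n)
    (p := .forLoop Reg.c₂ Reg.n (.inc Reg.d ⨟ .inc Reg.d)) (hI _) (hI _) (by decide) hn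
    (fun k => { v.idle with d := v.d + 2 * (k * v.n) }.st) (fun k _ => rfl) (fun k _ => rfl) (by
      intro k hk
      have hkn : k * v.n + v.n ≤ v.n * v.n := by
        have : (k + 1) * v.n ≤ v.n * v.n := Nat.mul_le_mul_right _ hk
        rwa [add_mul, one_mul] at this
      have e : v.d + 2 * ((k + 1) * v.n) = v.d + 2 * (k * v.n) + 2 * v.n := by ring
      simp only [set_c₁, e]
      generalize k * v.n = z at hkn
      have h₂ := forLoop₀ (t := t) (M := M) (c := Reg.c₂) (x := Reg.n) (N := v.n)
        (p := .inc Reg.d ⨟ .inc Reg.d) (hI _) (hI _) (by decide) hn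
        (fun i => { v.idle with d := v.d + 2 * z + 2 * i, c₁ := k }.st) (fun k _ => rfl)
        (fun k _ => rfl) (by
          intro i hi
          have e := fun z => Runs.inc (s := { v.idle with d := z, c₁ := k, c₂ := i }.st) (t := t)
            (M := M) (i := Reg.d) (hI _)
          simp only [reg_d, set_d] at e
          simp only [set_c₂]
          exact ⟨_, (e _ (by omega)).seq₀ (e _ (by omega))⟩)
      exact ⟨_, h₂⟩)
  have h₂ := Runs.inc (s := { v.idle with d := v.d + 2 * (v.n * v.n) }.st) (t := t)
            (M := M) (i := Reg.d) (hI _) (by simp; omega)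
  simp only [reg_d, set_d] at h₂
  simp only [Nat.zero_mul, Nat.mul_zero, Nat.add_zero] at h₁
  exact h₁.seq₀ h₂

end Runs

/-! ## Fingerprints of lists of words -/

section Fingerprints

open Polynomial

variable {F : Type*} [Field F]

/-- The polynomial with leading coefficient 1 whose other coefficients are the letters of a word. -/
noncomputable def wordPoly (F : Type*) [Field F] (v : List Bool) : F[X] :=
  v.foldl (fun P b => P * X + C (b.toNat : F)) 1

theorem wordPoly_append (v : List Bool) (b : Bool) :
    wordPoly F (v ++ [b]) = wordPoly F v * X + C (b.toNat : F) := by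
  simp [wordPoly]

theorem wordPoly_monic (v : List Bool) :
    (wordPoly F v).Monic ∧ (wordPoly F v).natDegree = v.length := by
  induction v using List.reverseRecOn with
  | nil => simp [wordPoly]
  | append_singleton v b ih =>
    have h₁ : (wordPoly F v * X).Monic := ih.1.mul monic_X
    have h₂ : (wordPoly F v * X).natDegree = v.length + 1 := by
      rw [ih.1.natDegree_mul monic_X, ih.2, natDegree_X]
    have h₃ : (C (b.toNat : F)).degree < (wordPoly F v * X).degree := by
      rw [degree_eq_natDegree h₁.ne_zero, h₂]
      exact degree_C_le.trans_lt (by exact_mod_cast Nat.succ_pos _)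
    rw [wordPoly_append]
    exact ⟨h₁.add_of_left h₃, by rw [natDegree_add_eq_left_of_degree_lt h₃, h₂]; simp⟩

/-- The degree gives the length of the word, even if it begins with zeros, and the coefficients give
its letters, as 0 and 1 differ in a field. -/
theorem wordPoly_injective : Function.Injective (wordPoly F) := by
  intro u
  induction u using List.reverseRecOn with
  | nil =>
    intro v h
    have := congrArg natDegree h
    rw [(wordPoly_monic _).2, (wordPoly_monic _).2] at this
    exact (List.eq_nil_of_length_eq_zero this.symm).symm
  | append_singleton u b ih =>
    intro v h
    have hl := congrArg natDegree h
    rw [(wordPoly_monic _).2, (wordPoly_monic _).2] at hl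
    induction v using List.reverseRecOn with
    | nil => simp at hl
    | append_singleton v c _ =>
      rw [wordPoly_append, wordPoly_append] at h
      have h₁ : wordPoly F u = wordPoly F v := by
        ext i
        simpa using congrArg (fun P => coeff P (i + 1)) h
      have h₂ := congrArg (fun P => coeff P 0) h
      simp only [coeff_add, coeff_mul_X_zero, coeff_C_zero, zero_add] at h₂
      rw [ih h₁]
      cases b <;> cases c <;> simp_all

/-- The polynomial whose roots are the negatives of the polynomials of the words. -/
noncomputable def listPoly (F : Type*) [Field F] (vs : List (List Bool)) : F[X][X] :=
  (vs.map fun v => X + C (wordPoly F v)).prod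

/-- Over the domain `F[X]` a product of linear factors determines its roots with multiplicities, and
the roots determine the words. -/
theorem perm_of_listPoly_eq {vs vs' : List (List Bool)} (h : listPoly F vs = listPoly F vs') :
    vs.Perm vs' := by
  have key : ∀ vs : List (List Bool),
      (listPoly F vs).roots = (vs : Multiset (List Bool)).map fun v => -wordPoly F v := by
    intro vs
    have : listPoly F vs = (((vs : Multiset (List Bool)).map fun v => -wordPoly F v).map
        fun P => X - C P).prod := by
      simp [listPoly, Function.comp_def]
    rw [this, roots_multiset_prod_X_sub_C]
  have := key vs
  rw [h, key vs'] at this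
  exact Multiset.coe_eq_coe.1
    (Multiset.map_injective (fun a b hab => wordPoly_injective (neg_injective hab)) this).symm

theorem natDegree_listPoly (vs : List (List Bool)) : (listPoly F vs).natDegree ≤ vs.length := by
  induction vs with
  | nil => simp [listPoly]
  | cons v vs ih =>
    have : listPoly F (v :: vs) = (X + C (wordPoly F v)) * listPoly F vs := by simp [listPoly]
    rw [this]
    refine natDegree_mul_le.trans ?_
    rw [natDegree_X_add_C, List.length_cons]
    omega

/-- The degree in the inner variable is bounded by the total number of letters, that in the outer
variable by the number of words. -/
theorem natDegree_coeff_listPoly (vs : List (List Bool)) (i : ℕ) :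
    ((listPoly F vs).coeff i).natDegree ≤ (vs.map List.length).sum := by
  induction vs generalizing i with
  | nil =>
    simp only [listPoly, List.map_nil, List.prod_nil, coeff_one]
    split_ifs <;> simp
  | cons v vs ih =>
    have : listPoly F (v :: vs) = (X + C (wordPoly F v)) * listPoly F vs := by simp [listPoly]
    rw [this, add_mul, coeff_add, coeff_C_mul, List.map_cons, List.sum_cons]
    refine natDegree_add_le_of_degree_le ?_ (natDegree_mul_le.trans ?_)
    · cases i with
      | zero => simp
      | succ i => rw [coeff_X_mul]; exact (ih i).trans (Nat.le_add_left _ _)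
    · rw [(wordPoly_monic v).2]
      exact Nat.add_le_add_left (ih i) _

/-- A bivariate polynomial has few zeros in a grid. -/
theorem card_zeros_le [DecidableEq F] {R : F[X][X]} (hR : R ≠ 0) {a b : ℕ} (ha : R.natDegree ≤ a)
    (hb : ∀ i, (R.coeff i).natDegree ≤ b) (S : Finset F) :
    ((S ×ˢ S).filter fun z => (R.map (evalRingHom z.2)).eval z.1 = 0).card ≤ (a + b) * S.card := by
  have h₁ : ((S ×ˢ S).filter fun z => (R.map (evalRingHom z.2)).eval z.1 = 0).card =
      ∑ y ∈ S, (S.filter fun x => (R.map (evalRingHom y)).eval x = 0).card := by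
    rw [Finset.card_filter, Finset.sum_product_right]
    simp only [Finset.card_filter]
  have hc : R.leadingCoeff ≠ 0 := leadingCoeff_ne_zero.2 hR
  -- For fixed `y` there are at most `a` zeros unless the leading coefficient vanishes at `y`; this
  -- happens for at most `b` values `y`, for which all of `S` is counted.
  have h₂ : ∀ y ∈ S, (S.filter fun x => (R.map (evalRingHom y)).eval x = 0).card ≤
      a + if R.leadingCoeff.eval y = 0 then S.card else 0 := by
    intro y _
    split_ifs with hy
    · exact (Finset.card_filter_le _ _).trans (Nat.le_add_left _ _)
    · have hne : R.map (evalRingHom y) ≠ 0 := by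
        intro h0
        have := congrArg (fun P => coeff P R.natDegree) h0
        simp only [coeff_map, coeff_zero, coe_evalRingHom] at this
        exact hy this
      have hsub : (S.filter fun x => (R.map (evalRingHom y)).eval x = 0) ⊆
          (R.map (evalRingHom y)).roots.toFinset := by
        intro x hx
        rw [Multiset.mem_toFinset, mem_roots hne]
        exact (Finset.mem_filter.1 hx).2
      refine (Finset.card_le_card hsub).trans ((Multiset.toFinset_card_le _).trans
        ((card_roots' _).trans (natDegree_map_le.trans ha)))
  have h₃ : (S.filter fun y => R.leadingCoeff.eval y = 0).card ≤ b := by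
    have hsub : (S.filter fun y => R.leadingCoeff.eval y = 0) ⊆ R.leadingCoeff.roots.toFinset := by
      intro x hx
      rw [Multiset.mem_toFinset, mem_roots hc]
      exact (Finset.mem_filter.1 hx).2
    exact (Finset.card_le_card hsub).trans ((Multiset.toFinset_card_le _).trans
        ((card_roots' _).trans (hb _)))
  rw [h₁]
  refine (Finset.sum_le_sum h₂).trans ?_
  rw [Finset.sum_add_distrib, Finset.sum_ite, Finset.sum_const_zero, Finset.sum_const,
    Finset.sum_const, smul_eq_mul, smul_eq_mul, add_zero, add_mul, mul_comm S.card]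
  exact Nat.add_le_add_left (Nat.mul_le_mul_right _ h₃) _

/-- The value of the fingerprint of a list of words at a point. -/
def listEval (vs : List (List Bool)) (x y : F) : F :=
  (vs.map fun v => x + v.foldl (fun h b => h * y + (b.toNat : F)) 1).prod

theorem eval_wordPoly (v : List Bool) (y : F) :
    (wordPoly F v).eval y = v.foldl (fun h b => h * y + (b.toNat : F)) 1 := by
  induction v using List.reverseRecOn with
  | nil => simp [wordPoly]
  | append_singleton v b ih => rw [wordPoly_append, List.foldl_append]; simp [ih]

theorem eval_listPoly (vs : List (List Bool)) (x y : F) :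
    ((listPoly F vs).map (evalRingHom y)).eval x = listEval vs x y := by
  induction vs with
  | nil => simp [listPoly, listEval]
  | cons v vs ih =>
    have : listPoly F (v :: vs) = (X + C (wordPoly F v)) * listPoly F vs := by simp [listPoly]
    rw [this, Polynomial.map_mul, eval_mul, ih]
    simp [listEval, eval_wordPoly]

theorem listEval_perm {vs vs' : List (List Bool)} (h : vs.Perm vs') (x y : F) :
    listEval vs x y = listEval vs' x y := (h.map _).prod_eq

theorem length_encodeList (vs : List (List Bool)) :
    (encodeList vs).length = vs.length + (vs.map List.length).sum := by
  induction vs with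
  | nil => rfl
  | cons v vs ih => rw [encodeList_cons]; simp [ih]; omega

/-- The count of zeros is applied to the difference of the two polynomials. The length of an
encoding bounds both the number of its words and the number of its letters, so both degrees are at
most `n`. -/
theorem card_listEval_eq_le [DecidableEq F] {vs vs' : List (List Bool)} (h : ¬ vs.Perm vs')
    {n : ℕ} (hn : (encodeList vs).length ≤ n) (hn' : (encodeList vs').length ≤ n) (S : Finset F) :
    ((S ×ˢ S).filter fun z => listEval vs z.1 z.2 = listEval vs' z.1 z.2).card ≤
      2 * n * S.card := by
  rw [length_encodeList] at hn hn'
  have hne : listPoly F vs - listPoly F vs' ≠ 0 := fun h0 =>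
    h (perm_of_listPoly_eq (sub_eq_zero.1 h0))
  have := card_zeros_le hne (a := n) (b := n)
    ((natDegree_sub_le _ _).trans (max_le ((natDegree_listPoly _).trans (by omega))
      ((natDegree_listPoly _).trans (by omega))))
    (fun i => by
      rw [coeff_sub]
      exact (natDegree_sub_le _ _).trans (max_le ((natDegree_coeff_listPoly _ _).trans (by omega))
        ((natDegree_coeff_listPoly _ _).trans (by omega)))) S
  simpa only [Polynomial.map_sub, eval_sub, eval_listPoly, sub_eq_zero, ← two_mul] using this

/-- For every `y` the fingerprint of `vs` vanishes at `x = -(wordPoly F v).eval y`. Then the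
fingerprint of `vs'` vanishes there too, so some word of `vs'` takes the same value as `v` at `y`.
That word may depend on `y`, but the product of all differences vanishes everywhere; with degree at
most `n * n`, below the size of the field, it is zero, and hence so is one of its factors. -/
theorem mem_of_listEval_eq_zero [Fintype F] {vs vs' : List (List Bool)} {n : ℕ}
    (hn : (encodeList vs).length ≤ n) (hn' : (encodeList vs').length ≤ n)
    (hF : n * n < Fintype.card F)
    (h : ∀ x y : F, listEval vs x y = 0 → listEval vs' x y = 0) {v : List Bool} (hv : v ∈ vs) :
    v ∈ vs' := by
  have hlen : ∀ {vs : List (List Bool)} {v}, v ∈ vs → v.length ≤ (encodeList vs).length := by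
    intro vs v hv
    rw [length_encodeList]
    exact (List.le_sum_of_mem (List.mem_map_of_mem hv)).trans (Nat.le_add_left _ _)
  by_contra hv'
  -- If `v` were not in `vs'`, no factor would be zero and `P` would have fewer roots than the field
  -- has elements.
  let P : F[X] := (vs'.map fun u => wordPoly F v - wordPoly F u).prod
  have hP : P ≠ 0 := by
    refine List.prod_ne_zero fun h0 => ?_
    obtain ⟨u, hu, he⟩ := List.mem_map.1 h0
    exact hv' (wordPoly_injective (sub_eq_zero.1 he) ▸ hu)
  have hdeg : P.natDegree ≤ n * n := by
    refine (natDegree_list_prod_le _).trans ?_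
    refine (List.sum_le_card_nsmul _ n ?_).trans ?_
    · intro k hk
      obtain ⟨Q, hQ, rfl⟩ := List.mem_map.1 hk
      obtain ⟨u, hu, rfl⟩ := List.mem_map.1 hQ
      refine (natDegree_sub_le _ _).trans (max_le ?_ ?_)
      · rw [(wordPoly_monic v).2]; exact (hlen hv).trans hn
      · rw [(wordPoly_monic u).2]; exact (hlen hu).trans hn'
    · rw [length_encodeList] at hn'
      rw [smul_eq_mul]
      simp only [List.length_map]
      exact Nat.mul_le_mul_right _ (by omega)
  have hroots : ∀ y : F, P.IsRoot y := by
    intro y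
    have h0 : listEval vs (-(wordPoly F v).eval y) y = 0 := by
      refine List.prod_eq_zero (List.mem_map.2 ⟨v, hv, ?_⟩)
      rw [eval_wordPoly, neg_add_cancel]
    have h1 := h _ _ h0
    obtain ⟨u, hu, he⟩ := List.mem_map.1 (List.prod_eq_zero_iff.1 h1)
    rw [← eval_wordPoly] at he
    rw [IsRoot, eval_list_prod, List.prod_eq_zero_iff]
    refine List.mem_map.2 ⟨_, List.mem_map.2 ⟨u, hu, rfl⟩, ?_⟩
    rw [eval_sub, ← neg_eq_zero, ← he]
    ring
  have : Fintype.card F ≤ P.natDegree := by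
    classical
    rw [← Finset.card_univ]
    refine (Finset.card_le_card (t := P.roots.toFinset) fun y _ => ?_).trans
      ((Multiset.toFinset_card_le _).trans (card_roots' _))
    rw [Multiset.mem_toFinset, mem_roots hP]
    exact hroots y
  omega

end Fingerprints

/-! ### Fingerprints modulo a prime, computed letter by letter. -/

/-- The hash value of a word. -/
def wordHash (y p : ℕ) (v : List Bool) : ℕ := v.foldl (fun h b => (h * y + b.toNat) % p) 1

/-- The fingerprint of a list of words with an additional factor `a`. -/
def listHash (x y p a : ℕ) (vs : List (List Bool)) : ℕ :=
  vs.foldl (fun a v => a * ((wordHash y p v + x) % p) % p) a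

theorem listHash_append (x y p a : ℕ) (vs : List (List Bool)) (v : List Bool) :
    listHash x y p a (vs ++ [v]) = listHash x y p a vs * ((wordHash y p v + x) % p) % p := by
  simp [listHash]

theorem cast_listHash {p : ℕ} [Fact p.Prime] (x y a : ℕ) (vs : List (List Bool)) :
    (listHash x y p a vs : ZMod p) = a * listEval vs (x : ZMod p) (y : ZMod p) := by
  have h : ∀ v, (wordHash y p v : ZMod p) = v.foldl (fun h b => h * (y : ZMod p) + (b.toNat : ZMod p)) 1 := by
    intro v
    induction v using List.reverseRecOn with
    | nil => simp [wordHash]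
    | append_singleton v b ih =>
      rw [wordHash] at ih ⊢
      simp only [List.foldl_append, List.foldl_cons, List.foldl_nil]
      rw [← ih]; simp
  induction vs using List.reverseRecOn with
  | nil => simp [listHash, listEval]
  | append_singleton vs v ih =>
    rw [listHash_append]
    simp only [ZMod.natCast_mod, Nat.cast_mul, Nat.cast_add, ih, h, listEval, List.map_append,
      List.prod_append, List.map_cons, List.map_nil, List.prod_cons, List.prod_nil]
    ring

theorem listHash_lt {x y p a : ℕ} (ha : a < p) (vs : List (List Bool)) :
    listHash x y p a vs < p := by
  induction vs using List.reverseRecOn with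
  | nil => exact ha
  | append_singleton vs v ih => rw [listHash_append]; exact Nat.mod_lt _ (by omega)

/-- The machine compares natural numbers; as both are reduced modulo `p`, this is the same as
comparing elements of `ZMod p`. -/
theorem listHash_eq_iff {p : ℕ} [Fact p.Prime] {x y a a' : ℕ} (ha : a < p) (ha' : a' < p)
    {vs vs' : List (List Bool)} :
    listHash x y p a vs = listHash x y p a' vs' ↔
      (a : ZMod p) * listEval vs (x : ZMod p) (y : ZMod p) =
        a' * listEval vs' (x : ZMod p) (y : ZMod p) := by
  rw [← cast_listHash, ← cast_listHash, ZMod.natCast_eq_natCast_iff, Nat.ModEq,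
    Nat.mod_eq_of_lt (listHash_lt ha _), Nat.mod_eq_of_lt (listHash_lt ha' _)]

theorem listHash_eq_zero_iff {p : ℕ} [Fact p.Prime] {x y a : ℕ} (ha : a < p)
    {vs : List (List Bool)} :
    listHash x y p a vs = 0 ↔ (a : ZMod p) * listEval vs (x : ZMod p) (y : ZMod p) = 0 := by
  rw [← cast_listHash, ZMod.natCast_eq_zero_iff]
  exact ⟨fun h => h ▸ dvd_zero _, fun h => Nat.eq_zero_of_dvd_of_lt h (listHash_lt ha _)⟩

namespace HashState

variable {x y p m e : ℕ}

theorem foldl_word {σ : HashState} (hh : σ.h = 1) (v : List Bool) :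
    (v.map Letter.bit).foldl (step x y p m e) σ = { σ with h := wordHash y p v } := by
  induction v using List.reverseRecOn with
  | nil => rw [wordHash, List.foldl_nil, ← hh]; rfl
  | append_singleton v b ih =>
    rw [List.map_append, List.foldl_append, ih]
    simp [step, wordHash]

/-- The hypothesis `h` excludes the word number `m`, so the switch between the halves does not occur
while `vs` is read. -/
theorem foldl_encodeList {σ : HashState} (hh : σ.h = 1) {vs : List (List Bool)}
    (h : σ.j + vs.length ≤ m ∨ m < σ.j) :
    (encodeList vs).foldl (step x y p m e) σ =
      { σ with acc := listHash x y p σ.acc vs, j := σ.j + vs.length } := by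
  induction vs using List.reverseRecOn with
  | nil => rfl
  | append_singleton vs v ih =>
    simp only [List.length_append, List.length_cons, List.length_nil, Nat.zero_add] at h ⊢
    rw [encodeList_append, List.foldl_append, ih (by omega), encodeList_cons, List.foldl_append,
      foldl_word (by exact hh)]
    simp only [encodeList, List.flatMap_nil, List.foldl_cons, List.foldl_nil, step]
    rw [if_neg (by omega), if_neg (by omega), listHash_append, hh]
    rfl

/-- The last word of `vs` has the number `m`, so the switch happens exactly at its end. An empty
`vs` would start behind the number `m` and never trigger it. -/
theorem foldl_encodeList_append {σ : HashState} (hh : σ.h = 1) {vs vs' : List (List Bool)}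
    (hvs : vs ≠ []) (h : σ.j + vs.length = m + 1) :
    (encodeList vs ++ encodeList vs').foldl (step x y p m e) σ =
      { h := 1, acc := listHash x y p e vs', A := listHash x y p σ.acc vs,
        j := m + 1 + vs'.length } := by
  obtain ⟨us, u, rfl⟩ := (List.eq_nil_or_concat vs).resolve_left hvs
  rw [List.concat_eq_append] at h ⊢
  simp only [List.length_append, List.length_cons, List.length_nil, Nat.zero_add] at h
  have h₁ : (encodeList (us ++ [u])).foldl (step x y p m e) σ =
      { h := 1, acc := e, A := listHash x y p σ.acc (us ++ [u]), j := m + 1 } := by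
    rw [encodeList_append, List.foldl_append, foldl_encodeList hh (by omega), encodeList_cons,
      List.foldl_append, foldl_word (by exact hh)]
    simp only [encodeList, List.flatMap_nil, List.foldl_cons, List.foldl_nil, step]
    rw [if_pos (by omega), if_pos (by omega), listHash_append, ← h]
    rfl
  rw [List.foldl_append, h₁, foldl_encodeList rfl (Or.inr (Nat.lt_succ_self m))]

theorem reduced_foldl {σ : HashState} (h : σ.Reduced p) (hp : 1 < p) (he : e < p)
    (w : List Letter) : (w.foldl (step x y p m e) σ).Reduced p := by
  induction w using List.reverseRecOn with
  | nil => exact h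
  | append_singleton w a ih => rw [List.foldl_append]; exact ih.step hp he a

theorem j_foldl_le (σ : HashState) (w : List Letter) :
    (w.foldl (step x y p m e) σ).j ≤ σ.j + w.length := by
  induction w using List.reverseRecOn with
  | nil => simp
  | append_singleton w a ih =>
    rw [List.foldl_append]
    cases a <;> simp [step] <;> omega

end HashState

/-! ## The randomized algorithm for multiset equality -/

/-- The pair of numbers with the binary digits that are read alternately from a list. -/
def sampleFrom : ℕ → ℕ → List Bool → ℕ × ℕ
  | x, y, a :: b :: cs => sampleFrom (2 * x + a.toNat) (2 * y + b.toNat) cs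
  | x, y, _ => (x, y)

theorem sampleFrom_append (k x y : ℕ) {cs : List Bool} (h : cs.length = 2 * k) (a b : Bool) :
    sampleFrom x y (cs ++ [a, b]) =
      (2 * (sampleFrom x y cs).1 + a.toNat, 2 * (sampleFrom x y cs).2 + b.toNat) := by
  induction k generalizing x y cs with
  | zero =>
    obtain rfl := List.eq_nil_of_length_eq_zero h
    rfl
  | succ k ih =>
    match cs, h with
    | c :: d :: cs, h => exact ih _ _ (cs := cs) (by simp only [List.length_cons] at h; omega)

theorem sampleFrom_lt (k x y : ℕ) {cs : List Bool} (h : cs.length = 2 * k) :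
    (sampleFrom x y cs).1 < 2 ^ k * (x + 1) ∧ (sampleFrom x y cs).2 < 2 ^ k * (y + 1) := by
  induction k generalizing x y cs with
  | zero =>
    obtain rfl := List.eq_nil_of_length_eq_zero h
    simp [sampleFrom]
  | succ k ih =>
    match cs, h with
    | c :: d :: cs, h =>
      have := ih (2 * x + c.toNat) (2 * y + d.toNat) (cs := cs)
        (by simp only [List.length_cons] at h; omega)
      have hc := c.toNat_le
      have hd := d.toNat_le
      rw [pow_succ, mul_assoc, mul_assoc]
      exact ⟨this.1.trans_le (Nat.mul_le_mul_left _ (by omega)),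
        this.2.trans_le (Nat.mul_le_mul_left _ (by omega))⟩

/-- Appending `k` binary digits to `x` and to `y` reaches each point of a square of side `2 ^ k`
exactly once; the first pair of tosses selects one of its four quadrants. The factor `4 ^ k`
replaces a division in `ℝ≥0∞`. -/
theorem coinAverage_sampleFrom (g : ℕ × ℕ → Bool) (k x y : ℕ) :
    coinAverage (2 * k) (fun cs => g (sampleFrom x y cs)) * 4 ^ k =
      (((Finset.Ico (2 ^ k * x) (2 ^ k * (x + 1)) ×ˢ Finset.Ico (2 ^ k * y) (2 ^ k * (y + 1))).filter
        fun z => g z = true).card : ℝ≥0∞) := by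
  induction k generalizing x y with
  | zero =>
    by_cases h : g (x, y) <;> simp [coinAverage, sampleFrom, h, Finset.filter_singleton]
  | succ k ih =>
    have hIco : ∀ x, Finset.Ico (2 ^ (k + 1) * x) (2 ^ (k + 1) * (x + 1)) =
        (Finset.Ico (2 ^ k * (2 * x + 1)) (2 ^ k * (2 * x + 1 + 1))).disjUnion
          (Finset.Ico (2 ^ k * (2 * x)) (2 ^ k * (2 * x + 1)))
          (Finset.Ico_disjoint_Ico_consecutive _ _ _).symm := by
      intro x
      rw [Finset.disjUnion_eq_union, Finset.union_comm, Finset.Ico_union_Ico_eq_Ico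
        (Nat.mul_le_mul_left _ (by omega)) (Nat.mul_le_mul_left _ (by omega)), pow_succ, mul_assoc,
        mul_assoc]
      rfl
    have hcard : ∀ (A B C D : Finset ℕ) (h : Disjoint A B) (h' : Disjoint C D),
        ((A.disjUnion B h ×ˢ C.disjUnion D h').filter fun z => g z = true).card =
          ((A ×ˢ C).filter fun z => g z = true).card + ((A ×ˢ D).filter fun z => g z = true).card +
          (((B ×ˢ C).filter fun z => g z = true).card +
            ((B ×ˢ D).filter fun z => g z = true).card) := by
      intro A B C D h h'
      simp only [Finset.card_filter, Finset.sum_product, Finset.sum_disjUnion,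
        Finset.sum_add_distrib]
      omega
    have harith : ∀ a b c d r : ℝ≥0∞, ((a + b) / 2 + (c + d) / 2) / 2 * (r * 4) =
        a * r + b * r + (c * r + d * r) := by
      intro a b c d r
      have h2 : ∀ z : ℝ≥0∞, z / 2 * 2 = z := fun z =>
        ENNReal.div_mul_cancel (by norm_num) (by norm_num)
      calc _ = (((a + b) / 2 + (c + d) / 2) / 2 * 2) * 2 * r := by ring
        _ = ((a + b) / 2 * 2 + (c + d) / 2 * 2) * r := by rw [h2]; ring
        _ = _ := by rw [h2, h2]; ring
    rw [hIco, hIco, hcard]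
    push_cast
    rw [← ih, ← ih, ← ih, ← ih, pow_succ]
    exact harith _ _ _ _ _

theorem coinAverage_eq_zero {K : ℕ} {f : List Bool → Bool} (h : ∀ cs, cs.length = K → f cs = false) :
    coinAverage K f = 0 := by
  induction K generalizing f with
  | zero => simp [coinAverage, h [] rfl]
  | succ K ih =>
    rw [coinAverage, ih fun cs hl => h _ (by simp [hl]), ih fun cs hl => h _ (by simp [hl])]
    simp

theorem half_le_coinAverage_sampleFrom {g : ℕ × ℕ → Bool} {k : ℕ}
    (h : 2 * ((Finset.range (2 ^ k) ×ˢ Finset.range (2 ^ k)).filter fun z => g z = false).card ≤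
      2 ^ k * 2 ^ k) :
    1 / 2 ≤ coinAverage (2 * k) (fun cs => g (sampleFrom 0 0 cs)) := by
  have h₁ := coinAverage_sampleFrom g k 0 0
  have h₂ := Finset.card_filter_add_card_filter_not
    (s := Finset.range (2 ^ k) ×ˢ Finset.range (2 ^ k)) (fun z => g z = true)
  simp only [Finset.card_product, Finset.card_range, Bool.not_eq_true] at h₂
  simp only [Nat.mul_zero, Nat.zero_add, Nat.mul_one, Nat.Ico_zero_eq_range] at h₁
  generalize ((Finset.range (2 ^ k) ×ˢ Finset.range (2 ^ k)).filter fun z => g z = true).card = a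
    at h₁ h₂
  have h₃ : 4 ^ k ≤ 2 * a := by
    have : (4 : ℕ) ^ k = 2 ^ k * 2 ^ k := by rw [← mul_pow]; norm_num
    omega
  have h₄ : (4 : ℝ≥0∞) ^ k ≤ 2 * a := by exact_mod_cast h₃
  have h₅ : (4 : ℝ≥0∞) ^ k ≠ 0 := by simp
  have h₆ : (4 : ℝ≥0∞) ^ k ≠ ⊤ := ENNReal.pow_ne_top (by norm_num)
  rw [← ENNReal.mul_le_mul_iff_left h₅ h₆, h₁, one_div, mul_comm, ← div_eq_mul_inv]
  exact ENNReal.div_le_of_le_mul' h₄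

namespace Prog

/-- If the power `q` of 2 is too small, replace it by the next one. -/
def extendScale : Prog 33 :=
  ite (eq Reg.c₁ Reg.q) (double Reg.c₂ Reg.tmp Reg.q ⨟ inc Reg.k) (ret true)

/-- Compute a power `q` of 2 that is not less than `d`, and its exponent `k`. -/
def computeScale : Prog 33 := one Reg.q ⨟ forLoop Reg.c₁ Reg.d extendScale

/-- Append a random bit to `x` and a random bit to `y`. -/
def sampleBits : Prog 33 :=
  double Reg.c₂ Reg.tmp Reg.x ⨟ ite flip (inc Reg.x) (ret true) ⨟
    double Reg.c₂ Reg.tmp Reg.y ⨟ ite flip (inc Reg.y) (ret true)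

/-- Choose random numbers `x` and `y` less than `q`. -/
def sample : Prog 33 := forLoop Reg.c₁ Reg.k sampleBits

/-- Initialize the computation of fingerprints. -/
def startHash : Prog 33 := copy Reg.c₁ Reg.x Reg.e ⨟ inc Reg.e ⨟ one Reg.acc ⨟ one Reg.h

/-- Read a letter from right to left and update the fingerprint. -/
def hashBackward : Prog 33 :=
  move 0 .left ⨟ ite (look 0 .hash) (hashLetter .hash)
    (ite (look 0 (.bit true)) (hashLetter (.bit true)) (hashLetter (.bit false)))

/-- The forward phase of the randomized algorithm. -/
def multisetForward : Prog 33 :=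
  prepare 1 ⨟ ite scan (computeBound ⨟ computeScale ⨟ findPrime ⨟ sample ⨟ startHash ⨟ ret true)
    (ret false)

/-- The backward phase of the randomized algorithm. -/
def multisetBackward : Prog 33 :=
  forLoop Reg.c₀ Reg.n hashBackward ⨟ finishWord ⨟ ne Reg.acc Reg.A

end Prog

namespace Runs

open Prog Vars

variable {t M : ℕ} (ht : t ≤ 2) (v : Vars)

include ht

/-- The power is doubled exactly when the counter `i` catches up with it, which keeps `i ≤ 2 ^ k ≤ 2
* i + 1` invariant. -/
theorem computeScale (hd : 2 * v.d + 1 ≤ M) (hq : v.q ≤ M) (hk : v.k = 0) :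
    ∃ k, v.d ≤ 2 ^ k ∧ 2 ^ k ≤ 2 * v.d + 1 ∧
      Runs t M .computeScale v.idle.st [] true { v.idle with q := 2 ^ k, k := k }.st := by
  have hI : ∀ (i : Fin 33) (_ : 2 ≤ i.val := by decide), t ≤ i.val := fun i hi => ht.trans hi
  have h₁ := Runs.one (s := v.idle.st) (t := t) (M := M) (i := Reg.q) (hI _) (by simpa using hq)
  simp only [set_q] at h₁
  obtain ⟨s', h₂, k, hk₁, hk₂, rfl⟩ := forLoop (t := t) (M := M) (c := Reg.c₁) (x := Reg.d)
    (N := v.d) (p := extendScale) (hI _) (hI _) (by decide) (by omega)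
    (fun i _ s => ∃ k, i ≤ 2 ^ k ∧ 2 ^ k ≤ 2 * i + 1 ∧ s = { v.idle with q := 2 ^ k, k := k }.st)
    (fun _ => 0) (by rintro i cs s ⟨k, -, -, rfl⟩; exact ⟨rfl, rfl⟩) (by
      rintro i cs s hi ⟨k, hk₁, hk₂, rfl⟩ ds hds
      obtain rfl := List.eq_nil_of_length_eq_zero hds
      have hkk : k < 2 ^ k := Nat.lt_two_pow_self
      have e₁ := Runs.eq_true (s := { v.idle with q := 2 ^ k, k := k, c₁ := i }.st) (t := t) (M := M)
        (i := Reg.c₁) (j := Reg.q) (hI _) (hI _) (by decide) (by simp; omega)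
      have e₂ := Runs.eq_false (s := { v.idle with q := 2 ^ k, k := k, c₁ := i }.st) (t := t) (M := M)
        (i := Reg.c₁) (j := Reg.q) (hI _) (hI _) (by decide) (by simp; omega) (by simp; omega)
      simp only [reg_c₁, reg_q] at e₁ e₂
      by_cases he : i = 2 ^ k
      · have e₃ := Runs.double (s := { v.idle with q := 2 ^ k, k := k, c₁ := i }.st) (t := t)
          (M := M) (c := Reg.c₂) (y := Reg.tmp) (a := Reg.q) (hI _) (hI _) (hI _) (by decide)
          (by decide) (by decide) rfl rfl (by simp; omega)
        have e₄ := Runs.inc (s := { v.idle with q := 2 * 2 ^ k, k := k, c₁ := i }.st) (t := t)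
          (M := M) (i := Reg.k) (hI _) (by simp; omega)
        simp only [reg_q, set_q, reg_k, set_k] at e₃ e₄
        refine ⟨true, { v.idle with q := 2 * 2 ^ k, k := k + 1 }.st, ?_, k + 1, by omega, by omega, ?_⟩
        · simp only [set_c₁]
          exact (e₁ he).ite_true (e₃.seq₀ e₄)
        · simp only [pow_succ, mul_comm]
      · refine ⟨true, { v.idle with q := 2 ^ k, k := k }.st, ?_, k, by omega, by omega, rfl⟩
        simp only [set_c₁]
        exact (e₂ he).ite_false (Runs.ret true))
    (s := { v.idle with q := 1 }.st) ⟨0, by simp, by simp, by simp [hk]⟩ (cs := []) (by simp)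
  exact ⟨k, hk₁, hk₂, h₁.seq₀ h₂⟩

theorem sample (hx : v.x = 0) (hy : v.y = 0) (hk : v.k ≤ M) (hM : 2 * 2 ^ v.k ≤ M)
    {cs : List Bool} (hcs : cs.length = 2 * v.k) :
    Runs t M .sample v.idle.st cs true
      { v.idle with x := (sampleFrom 0 0 cs).1, y := (sampleFrom 0 0 cs).2 }.st := by
  have hI : ∀ (i : Fin 33) (_ : 2 ≤ i.val := by decide), t ≤ i.val := fun i hi => ht.trans hi
  obtain ⟨s', h₂, -, rfl⟩ := forLoop (t := t) (M := M) (c := Reg.c₁) (x := Reg.k)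
    (N := v.k) (p := sampleBits) (hI _) (hI _) (by decide) hk
    (fun k cs s => cs.length = 2 * k ∧ s =
      { v.idle with x := (sampleFrom 0 0 cs).1, y := (sampleFrom 0 0 cs).2 }.st)
    (fun _ => 2) (by rintro i cs s ⟨-, rfl⟩; exact ⟨rfl, rfl⟩) (by
      rintro i cs s hi ⟨hcs, rfl⟩ ds hds
      obtain ⟨a, b, rfl⟩ := List.length_eq_two.1 hds
      have hlt := sampleFrom_lt i 0 0 hcs
      have happ := sampleFrom_append i 0 0 hcs a b
      have hpow : 2 ^ i * 2 ≤ 2 ^ v.k := by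
        rw [← pow_succ]; exact Nat.pow_le_pow_right (by norm_num) hi
      generalize sampleFrom 0 0 cs = z at hlt happ
      obtain ⟨x, y⟩ := z
      simp only [Nat.zero_add, Nat.mul_one] at hlt happ
      have e₁ := fun x y (hx : 2 * x ≤ M) => Runs.double
          (s := { v.idle with x := x, y := y, c₁ := i }.st) (t := t)
          (M := M) (c := Reg.c₂) (y := Reg.tmp) (a := Reg.x) (hI _) (hI _) (hI _) (by decide)
          (by decide) (by decide) rfl rfl (by simpa using hx)
      have e₂ := fun x y (hx : 2 * y ≤ M) => Runs.double
          (s := { v.idle with x := x, y := y, c₁ := i }.st) (t := t)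
          (M := M) (c := Reg.c₂) (y := Reg.tmp) (a := Reg.y) (hI _) (hI _) (hI _) (by decide)
          (by decide) (by decide) rfl rfl (by simpa using hx)
      have e₃ : ∀ x y (a : Bool), x ≤ M → ∃ b, Runs t M (.ite .flip (.inc Reg.x) (.ret true))
          { v.idle with x := x, y := y, c₁ := i }.st [a] b
          { v.idle with x := x + a.toNat, y := y, c₁ := i }.st := by
        intro x y a hx
        cases a
        · exact ⟨_, (Runs.flip false).ite (Runs.ret true)⟩
        · have e := Runs.inc (s := { v.idle with x := x, y := y, c₁ := i }.st) (t := t) (M := M)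
            (i := Reg.x) (hI _) (by simpa using hx)
          simp only [reg_x, set_x] at e
          exact ⟨_, (Runs.flip true).ite e⟩
      have e₄ : ∀ x y (a : Bool), y ≤ M → ∃ b, Runs t M (.ite .flip (.inc Reg.y) (.ret true))
          { v.idle with x := x, y := y, c₁ := i }.st [a] b
          { v.idle with x := x, y := y + a.toNat, c₁ := i }.st := by
        intro x y a hx
        cases a
        · exact ⟨_, (Runs.flip false).ite (Runs.ret true)⟩
        · have e := Runs.inc (s := { v.idle with x := x, y := y, c₁ := i }.st) (t := t) (M := M)
            (i := Reg.y) (hI _) (by simpa using hx)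
          simp only [reg_y, set_y] at e
          exact ⟨_, (Runs.flip true).ite e⟩
      simp only [reg_x, set_x, reg_y, set_y] at e₁ e₂
      obtain ⟨c, e₃⟩ := e₃ (2 * x) y a (by omega)
      obtain ⟨c', e₄⟩ := e₄ (2 * x + a.toNat) (2 * y) b (by omega)
      refine ⟨c', { v.idle with x := 2 * x + a.toNat, y := 2 * y + b.toNat }.st, ?_, ?_, ?_⟩
      · simp only [set_c₁]
        exact (e₁ _ _ (by omega)).seq₀ (e₃.seq ((e₂ _ _ (by omega)).seq₀ e₄))
      · simp [hcs]; omega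
      · rw [happ])
    (s := v.idle.st) ⟨rfl, by cases v; dsimp only at hx hy; subst hx hy; rfl⟩ (cs := cs) (by simp [hcs, mul_comm])
  exact h₂

theorem startHash (hx : v.x + 1 ≤ M) (he : v.e ≤ M) (hacc : v.acc ≤ M) (hh : v.h ≤ M) :
    Runs t M .startHash v.idle.st [] true
      { v.idle with e := v.x + 1, acc := 1, h := 1 }.st := by
  have hI : ∀ (i : Fin 33) (_ : 2 ≤ i.val := by decide), t ≤ i.val := fun i hi => ht.trans hi
  have h₁ := Runs.copy (s := v.idle.st) (t := t) (M := M) (c := Reg.c₁) (a := Reg.x) (d := Reg.e)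
    (hI _) (hI _) (hI _) (by decide) (by decide) (by decide) rfl (by simp; omega) (by simpa using he)
  have h₂ := Runs.inc (s := { v.idle with e := v.x }.st) (t := t) (M := M) (i := Reg.e) (hI _)
    (by simp; omega)
  have h₃ := Runs.one (s := { v.idle with e := v.x + 1 }.st) (t := t) (M := M) (i := Reg.acc) (hI _)
    (by simpa using hacc)
  have h₄ := Runs.one (s := { v.idle with e := v.x + 1, acc := 1 }.st) (t := t) (M := M)
    (i := Reg.h) (hI _) (by simpa using hh)
  simp only [reg_x, set_e, reg_e, set_acc, set_h] at h₁ h₂ h₃ h₄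
  exact h₁.seq₀ (h₂.seq₀ (h₃.seq₀ h₄))

theorem hashBackward (ht₀ : 0 < t) {σ : HashState} (hσ : σ.Reduced v.p) (hp : 1 < v.p)
    (hpM : v.p ≤ M) (hj : σ.j ≤ M) (he : v.e < v.p) (hx : v.x ≤ M) (hy : v.y ≤ M) (hm : v.m ≤ M)
    {k : ℕ} {a : Letter} (ha : v.con₀[k]? = some a) :
    ∃ b, Runs t M Prog.hashBackward ({ v with pos₀ := k + 1 }.withHash σ).idle.st [] b
      ({ v with pos₀ := k }.withHash (σ.step v.x v.y v.p v.m v.e a)).idle.st := by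
  have h₁ := Runs.moveLeft (s := ({ v with pos₀ := k + 1 }.withHash σ).idle.st) (t := t) (M := M)
    (i := 0) ht₀ (k := k) rfl
  simp only [set_pos₀] at h₁
  have hread : wordTape (({ v with pos₀ := k }.withHash σ).idle.st.con 0)
      (({ v with pos₀ := k }.withHash σ).idle.st.pos 0) = a.sym := by
    simp [wordTape, ha]
  obtain ⟨b, h₂⟩ := hashLetter ht { v with pos₀ := k } hσ hp hpM hj he hx hy hm a
  have h₃ := fun x h => Runs.look_true (s := ({ v with pos₀ := k }.withHash σ).idle.st) (t := t)
    (M := M) (i := 0) (a := x) ht₀ (hread.trans h)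
  have h₄ := fun x h => Runs.look_false (s := ({ v with pos₀ := k }.withHash σ).idle.st) (t := t)
    (M := M) (i := 0) (a := x) ht₀ (hread.trans_ne h)
  cases a with
  | hash => exact ⟨_, h₁.seq₀ ((h₃ _ rfl).ite_true h₂)⟩
  | bit c =>
    cases c with
    | false =>
      exact ⟨_, h₁.seq₀ ((h₄ _ (by simp [Letter.sym])).ite_false
        ((h₄ _ (by simp [Letter.sym])).ite_false h₂))⟩
    | true =>
      exact ⟨_, h₁.seq₀ ((h₄ _ (by simp [Letter.sym])).ite_false ((h₃ _ rfl).ite_true h₂))⟩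

/-- Read from right to left, the leftmost word is not followed by a separator. The additional
`finishWord` supplies it, which explains the appended `Letter.hash`. -/
theorem multisetBackward (ht₀ : 0 < t) {σ : HashState} (hσ : σ.Reduced v.p) (hp : 1 < v.p)
    (hpM : v.p ≤ M) (hj : σ.j + v.n + 1 ≤ M) (he : v.e < v.p) (hx : v.x ≤ M) (hy : v.y ≤ M)
    (hm : v.m ≤ M) (hc : v.c₀ = 0) (hn : v.n = v.con₀.length) (hpos : v.pos₀ = v.con₀.length) :
    ∃ s' b, Runs t M .multisetBackward (v.withHash σ).idle.st [] b s' ∧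
      (b = true ↔ ((v.con₀.reverse ++ [Letter.hash]).foldl (HashState.step v.x v.y v.p v.m v.e) σ).acc ≠
        ((v.con₀.reverse ++ [Letter.hash]).foldl (HashState.step v.x v.y v.p v.m v.e) σ).A) := by
  have hI : ∀ (i : Fin 33) (_ : 2 ≤ i.val := by decide), t ≤ i.val := fun i hi => ht.trans hi
  -- The intermediate result after the last `k` letters of the input have been read.
  let τ : ℕ → HashState := fun k =>
    (v.con₀.reverse.take k).foldl (HashState.step v.x v.y v.p v.m v.e) σ
  have hτ : ∀ k, (τ k).Reduced v.p := fun k => HashState.reduced_foldl hσ hp he _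
  have hτj : ∀ k ≤ v.n, (τ k).j ≤ σ.j + v.n := fun k hk =>
    (HashState.j_foldl_le σ _).trans (by simp; omega)
  have h₁ := forLoop₀ (t := t) (M := M) (c := Reg.c₀) (x := Reg.n) (N := v.n)
    (p := .hashBackward) (hI _) (hI _) (by decide) (by omega)
    (fun k => ({ v with pos₀ := v.n - k }.withHash (τ k)).idle.st)
    (fun k _ => by simpa using hc) (fun k _ => rfl) (by
      intro k hk
      have hk' : v.n - (k + 1) < v.con₀.length := by omega
      obtain ⟨b, h⟩ := hashBackward ht { v with c₀ := k } ht₀ (hτ k) hp hpM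
        (by have := hτj k hk.le; omega) he hx hy hm (k := v.n - (k + 1))
        (List.getElem?_eq_getElem hk')
      have e₁ : v.n - (k + 1) + 1 = v.n - k := by omega
      have e₂ : (τ k).step v.x v.y v.p v.m v.e v.con₀[v.n - (k + 1)] = τ (k + 1) := by
        simp only [τ]
        rw [List.take_succ_eq_append_getElem (by simp; omega), List.foldl_append,
          List.getElem_reverse]
        simp only [List.foldl_cons, List.foldl_nil]
        congr 2
        omega
      simp only [e₁, e₂] at h
      simp only [set_c₀]
      exact ⟨b, h⟩)
  have h₀ : ({ v with pos₀ := v.n - 0 }.withHash (τ 0)).idle.st = (v.withHash σ).idle.st := by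
    have e : v.n - 0 = v.pos₀ := by omega
    simp only [e]
    rfl
  rw [h₀] at h₁
  have h₂ := finishWord ht { v with pos₀ := v.n - v.n } (hτ v.n) hp hpM
    (by have := hτj v.n le_rfl; omega) he hx hm
  have hlast : (τ v.n).step v.x v.y v.p v.m v.e .hash =
      (v.con₀.reverse ++ [Letter.hash]).foldl (HashState.step v.x v.y v.p v.m v.e) σ := by
    simp only [τ]
    rw [List.take_of_length_le (by simp [hn])]
    simp
  have hred := HashState.reduced_foldl (x := v.x) (y := v.y) (m := v.m) hσ hp he
    (v.con₀.reverse ++ [Letter.hash])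
  simp only [hlast] at h₂
  generalize (v.con₀.reverse ++ [Letter.hash]).foldl (HashState.step v.x v.y v.p v.m v.e) σ = ρ
    at h₂ hred ⊢
  have h₃ := Runs.ne_true (s := ({ v with pos₀ := v.n - v.n }.withHash ρ).idle.st) (t := t) (M := M)
    (i := Reg.acc) (j := Reg.A) (hI _) (hI _) (by decide)
    (by have := hred.acc_lt; simp; omega) (by have := hred.A_lt; simp; omega)
  have h₄ := Runs.ne_false (s := ({ v with pos₀ := v.n - v.n }.withHash ρ).idle.st) (t := t) (M := M)
    (i := Reg.acc) (j := Reg.A) (hI _) (hI _) (by decide)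
    (by have := hred.acc_lt; simp; omega)
  simp only [reg_acc, reg_A] at h₃ h₄
  by_cases hb : ρ.acc = ρ.A
  · exact ⟨_, false, h₁.seq₀ (h₂.seq₀ (h₄ hb)), by simp [hb]⟩
  · exact ⟨_, true, h₁.seq₀ (h₂.seq₀ (h₃ hb)), by simp [hb]⟩

end Runs

/-! ## Multiset equality is in `co-RST` -/

/-- The bound on the numbers in the registers. -/
def regBound (N : ℕ) : ℕ := 24 * (N + 1) ^ 5

/-- For `N ≥ 2` the polynomial is at most `N ^ 15`, so its binary logarithm is at most 15 times that
of `N`; the additive 3 raises the factor to 18. -/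
theorem regBound_mem_OLog (u : ℕ) : (fun N => u * (Nat.log 2 (regBound N) + 2 + 1)) ∈ OLog := by
  refine Asymptotics.IsBigO.of_bound (u * 18 / Real.log 2) ?_
  filter_upwards [Filter.eventually_ge_atTop 2] with N hN
  have h₁ : regBound N ≤ N ^ 15 :=
    calc 24 * (N + 1) ^ 5 ≤ 2 ^ 5 * (2 * N) ^ 5 :=
          Nat.mul_le_mul (by norm_num) (Nat.pow_le_pow_left (by omega) _)
      _ = 2 ^ 10 * N ^ 5 := by ring
      _ ≤ N ^ 10 * N ^ 5 := Nat.mul_le_mul_right _ (Nat.pow_le_pow_left hN _)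
      _ = N ^ 15 := by ring
  have hlog2 : 0 < Real.log 2 := Real.log_pos (by norm_num)
  have hN' : (2 : ℝ) ≤ N := by exact_mod_cast hN
  have hlogN : Real.log 2 ≤ Real.log N := Real.log_le_log (by norm_num) hN'
  have h₂ : (Nat.log 2 (regBound N) : ℝ) ≤ 15 * (Real.log N / Real.log 2) :=
    calc (Nat.log 2 (regBound N) : ℝ) ≤ Nat.log 2 (N ^ 15) := by
          exact_mod_cast Nat.log_mono_right h₁
      _ ≤ Real.logb 2 ((N ^ 15 : ℕ) : ℝ) := by exact_mod_cast Real.natLog_le_logb _ _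
      _ = 15 * (Real.log N / Real.log 2) := by
          rw [Real.logb, Nat.cast_pow, Real.log_pow]; push_cast; ring
  have h₃ : 1 ≤ Real.log N / Real.log 2 := (one_le_div hlog2).2 hlogN
  have h₄ : (0 : ℝ) ≤ u := Nat.cast_nonneg _
  have h₅ : 0 ≤ Real.log N := hlog2.le.trans hlogN
  rw [Real.norm_of_nonneg (Nat.cast_nonneg _), Real.norm_of_nonneg h₅]
  push_cast
  calc (u : ℝ) * (Nat.log 2 (regBound N) + 2 + 1) ≤ u * (18 * (Real.log N / Real.log 2)) :=
        mul_le_mul_of_nonneg_left (by linarith) h₄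
    _ = _ := by ring

/-- Each `#` ends the word to its left, so backwards it precedes this word. The appended `#` shifts
all separators by one word and leaves an empty word in front. -/
theorem encodeList_reverse (ws : List (List Bool)) :
    (encodeList ws).reverse ++ [Letter.hash] =
      encodeList ([] :: (ws.map List.reverse).reverse) := by
  induction ws with
  | nil => rfl
  | cons v ws ih =>
    rw [encodeList_cons] at ih
    rw [encodeList_cons, encodeList_cons, List.reverse_append, List.reverse_cons, ih, List.map_cons,
      List.reverse_cons, encodeList_append]
    simp [encodeList]

/-- The intermediate results before the first letter is read. -/
def HashState.initial (j : ℕ) : HashState := { h := 1, acc := 1, A := 0, j := j }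

/-- The final fingerprints of a run of the randomized algorithm. -/
def finalHash (w : List Letter) (p x y : ℕ) : HashState :=
  (w.reverse ++ [Letter.hash]).foldl (HashState.step x y p (hashes w / 2) (x + 1)) (.initial 0)

/-- The half `vs'` is read first, together with the empty word, which contributes the factor `1 +
x`. To balance it, the product for `vs` starts with `e = x + 1`. This common factor cancels because
`0 < x + 1 < p`. -/
theorem finalHash_acc_eq_iff {p x y : ℕ} [Fact p.Prime] (hx : x + 1 < p) {vs vs' : List (List Bool)}
    (h : vs.length = vs'.length) :
    (finalHash (encodeList vs ++ encodeList vs') p x y).acc =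
        (finalHash (encodeList vs ++ encodeList vs') p x y).A ↔
      listEval (vs.map List.reverse).reverse (x : ZMod p) (y : ZMod p) =
        listEval (vs'.map List.reverse).reverse (x : ZMod p) (y : ZMod p) := by
  have hp := (Fact.out : p.Prime).two_le
  have e : finalHash (encodeList vs ++ encodeList vs') p x y =
      { h := 1, acc := listHash x y p (x + 1) (vs.map List.reverse).reverse,
        A := listHash x y p 1 ([] :: (vs'.map List.reverse).reverse),
        j := hashes (encodeList vs ++ encodeList vs') / 2 + 1 + vs.length } := by
    have hh : hashes (encodeList vs ++ encodeList vs') / 2 = vs'.length := by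
      rw [← encodeList_append, hashes_encodeList, List.length_append]; omega
    rw [finalHash, ← encodeList_append, encodeList_reverse, encodeList_append, hh, List.map_append,
      List.reverse_append, ← List.cons_append, encodeList_append,
      HashState.foldl_encodeList_append rfl (by simp) (by simp [HashState.initial])]
    simp [HashState.initial]
  have hx0 : (x : ZMod p) + 1 ≠ 0 := by
    intro h0
    have : ((x + 1 : ℕ) : ZMod p) = 0 := by push_cast; exact h0
    rw [ZMod.natCast_eq_zero_iff] at this
    exact absurd (Nat.le_of_dvd (by omega) this) (by omega)
  rw [e]
  dsimp only
  rw [listHash_eq_iff (by omega) (by omega)]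
  simp only [listEval, List.map_cons, List.prod_cons, List.foldl_nil, Nat.cast_add, Nat.cast_one,
    one_mul]
  exact mul_right_inj' hx0

theorem perm_reverse_iff {vs vs' : List (List Bool)} :
    ((vs.map List.reverse).reverse).Perm ((vs'.map List.reverse).reverse) ↔ vs.Perm vs' := by
  rw [List.reverse_perm', List.perm_reverse, List.map_perm_map_iff List.reverse_injective]

/-- Different multisets have different fingerprints at most points of a large grid. -/
theorem card_finalHash_le {p q n : ℕ} [Fact p.Prime] (hq : q < p) (hqn : 2 * (n * n) + 1 ≤ q)
    {vs vs' : List (List Bool)} (h : vs.length = vs'.length)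
    (hn : (encodeList vs ++ encodeList vs').length = n) (hne : ¬ vs.Perm vs') :
    2 * ((Finset.range q ×ˢ Finset.range q).filter fun z =>
        (finalHash (encodeList vs ++ encodeList vs') p z.1 z.2).acc =
          (finalHash (encodeList vs ++ encodeList vs') p z.1 z.2).A).card ≤ q * q := by
  classical
  have hlen : ∀ vs : List (List Bool),
      (encodeList (vs.map List.reverse).reverse).length = (encodeList vs).length := by
    intro vs
    rw [length_encodeList, length_encodeList]
    simp [Function.comp_def]
  have hpos : vs ≠ [] := by
    rintro rfl
    exact hne (by rw [List.eq_nil_of_length_eq_zero h.symm])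
  -- Lists that differ have at least one word in each half, and each word ends with a `#`. This is
  -- needed for `4 * n ≤ q`.
  have hn₂ : 2 ≤ n := by
    have := List.length_pos_iff.2 hpos
    rw [← hn, ← encodeList_append, length_encodeList, List.length_append]
    omega
  have hle : (encodeList vs).length ≤ n ∧ (encodeList vs').length ≤ n := by
    rw [List.length_append] at hn
    omega
  -- The sample range is embedded into the field; as `q < p`, different samples remain different.
  let S : Finset (ZMod p) := (Finset.range q).image fun x : ℕ => (x : ZMod p)
  have hS : S.card ≤ q := Finset.card_image_le.trans (Finset.card_range q).le
  have h₁ := card_listEval_eq_le (F := ZMod p) (n := n) (mt perm_reverse_iff.1 hne)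
    (by rw [hlen]; exact hle.1) (by rw [hlen]; exact hle.2) S
  have hinj : ∀ x y : ℕ, x < q → y < q → (x : ZMod p) = y → x = y := by
    intro x y hx hy hxy
    rw [ZMod.natCast_eq_natCast_iff, Nat.ModEq, Nat.mod_eq_of_lt (by omega),
      Nat.mod_eq_of_lt (by omega)] at hxy
    exact hxy
  have h₂ : ((Finset.range q ×ˢ Finset.range q).filter fun z =>
        (finalHash (encodeList vs ++ encodeList vs') p z.1 z.2).acc =
          (finalHash (encodeList vs ++ encodeList vs') p z.1 z.2).A).card ≤ 2 * n * S.card := by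
    refine (Finset.card_le_card_of_injOn (fun z => ((z.1 : ZMod p), (z.2 : ZMod p))) ?_ ?_).trans h₁
    · rintro ⟨x, y⟩ hz
      simp only [Finset.coe_filter, Finset.mem_product, Finset.mem_range, Set.mem_ofPred_eq] at hz ⊢
      exact ⟨⟨Finset.mem_image_of_mem _ (Finset.mem_range.2 hz.1.1),
        Finset.mem_image_of_mem _ (Finset.mem_range.2 hz.1.2)⟩,
        (finalHash_acc_eq_iff (by omega) h).1 hz.2⟩
    · rintro ⟨x, y⟩ hz ⟨x', y'⟩ hz' he
      simp only [Finset.coe_filter, Finset.mem_product, Finset.mem_range, Set.mem_ofPred_eq] at hz hz'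
      simp only [Prod.mk.injEq] at he
      rw [hinj x x' hz.1.1 hz'.1.1 he.1, hinj y y' hz.1.2 hz'.1.2 he.2]
  have h₃ : 4 * n ≤ q := by nlinarith
  calc _ ≤ 2 * (2 * n * S.card) := Nat.mul_le_mul_left _ h₂
    _ ≤ 2 * (2 * n * q) := by gcongr
    _ = 4 * n * q := by ring
    _ ≤ q * q := Nat.mul_le_mul_right _ h₃

/-- The numbers `k` and `p` are fixed before `cs`: they do not depend on the tosses, and the tree
needs a number `2 * k` of tosses known in advance. -/
theorem Runs.multisetForward {M : ℕ} (w : List Letter) (hM : regBound w.length ≤ M) :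
    (¬ IsInstance w ∧ ∃ s, Run (Prog.SpaceOk 1 (Nat.log 2 M + 2)) .multisetForward
        (Prog.initMem 33 w) [] false s) ∨
      IsInstance w ∧ ∃ k p, p.Prime ∧ 2 ^ k < p ∧ p ≤ M ∧
        2 * (w.length * w.length) + 1 ≤ 2 ^ k ∧
        ∀ cs : List Bool, cs.length = 2 * k →
          ∃ v : Vars, v.con₀ = w ∧ v.pos₀ = w.length ∧ v.n = w.length ∧ v.m = hashes w / 2 ∧
            v.p = p ∧ v.x = (sampleFrom 0 0 cs).1 ∧ v.y = (sampleFrom 0 0 cs).2 ∧ v.e = v.x + 1 ∧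
            v.c₀ = 0 ∧ Run (Prog.SpaceOk 1 (Nat.log 2 M + 2)) .multisetForward (Prog.initMem 33 w)
              cs true ((v.withHash (.initial 0)).idle.st.enc 1) := by
  have hM' : 16 * (w.length * w.length) + 8 * w.length + 24 ≤ M := by
    refine le_trans ?_ hM
    calc 16 * (w.length * w.length) + 8 * w.length + 24 ≤ 24 * (w.length + 1) ^ 2 := by nlinarith
      _ ≤ _ := Nat.mul_le_mul_left _ (Nat.pow_le_pow_right (by omega) (by norm_num))
  have h₀ := Runs.prepare (t := 1) (M := M) w (by norm_num) (by norm_num)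
  obtain ⟨b, h₁, hb⟩ := Runs.scan (t := 1) (M := M) (by norm_num) (by norm_num) w (by omega)
    (by omega)
  by_cases hw : IsInstance w
  · obtain rfl := hb.2 hw
    refine Or.inr ⟨hw, ?_⟩
    have h₂ := Runs.computeBound (t := 1) (M := M) (by norm_num) (Vars.scanned w w)
      (by dsimp only; omega)
    obtain ⟨k, hk₁, hk₂, h₃⟩ := Runs.computeScale (t := 1) (M := M) (by norm_num)
      { Vars.scanned w w with d := 0 + 2 * (w.length * w.length) + 1 } (by dsimp only; omega)
      (by dsimp only; omega) rfl
    dsimp only at hk₁ hk₂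
    obtain ⟨p, hp, hp₁, hp₂, h₄⟩ := Runs.findPrime (t := 1) (M := M) (by norm_num)
      { Vars.scanned w w with d := 0 + 2 * (w.length * w.length) + 1, q := 2 ^ k, k := k }
      (by dsimp only; omega) (by dsimp only; omega) (by dsimp only; omega)
    dsimp only at hp₁ hp₂
    refine ⟨k, p, hp, hp₁, by omega, by omega, fun cs hcs => ?_⟩
    have hkk : k < 2 ^ k := Nat.lt_two_pow_self
    have hlt := sampleFrom_lt k 0 0 hcs
    have h₅ := Runs.sample (t := 1) (M := M) (by norm_num)
      { Vars.scanned w w with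
        d := 0 + 2 * (w.length * w.length) + 1, q := 2 ^ k, k := k, p := p } rfl rfl
      (by dsimp only; omega) (by dsimp only; omega) hcs
    have h₆ := Runs.startHash (t := 1) (M := M) (by norm_num)
      { Vars.scanned w w with
        d := 0 + 2 * (w.length * w.length) + 1, q := 2 ^ k, k := k, p := p,
        x := (sampleFrom 0 0 cs).1, y := (sampleFrom 0 0 cs).2 }
      (by dsimp only; omega) (by dsimp only; omega) (by dsimp only; omega) (by dsimp only; omega)
    refine ⟨{ Vars.scanned w w with
        d := 0 + 2 * (w.length * w.length) + 1, q := 2 ^ k, k := k, p := p,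
        x := (sampleFrom 0 0 cs).1, y := (sampleFrom 0 0 cs).2,
        e := (sampleFrom 0 0 cs).1 + 1 }, rfl, rfl, rfl, rfl, rfl, rfl, rfl, rfl, rfl, ?_⟩
    have h₇ := h₅.seq (h₆.seq₀ (Runs.ret true))
    rw [List.append_nil] at h₇
    exact h₀.seq (h₁.ite_true (h₂.seq₀ (h₃.seq₀ (h₄.seq₀ h₇))))
  · obtain rfl : b = false := Bool.eq_false_iff.2 fun h => hw (hb.1 h)
    exact Or.inl ⟨hw, _, h₀.seq (h₁.ite_false (Runs.ret false))⟩

/-- Acceptance means that the fingerprints differ. For equal multisets this never happens, and for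
different ones it fails on at most half of the grid. -/
theorem multisetEquality_compl_mem_RST :
    MultisetEqualityᶜ ∈ RST Letter {fun _ => 1 + 1} OLog 1 := by
  refine mem_RST_of_prog (t := 1) (u := 32) (by omega) (p := .multisetForward)
    (q := .multisetBackward) (r := .ret true) (by decide) (by decide) (by decide)
    (regBound_mem_OLog 32) fun w => ?_
  rcases Runs.multisetForward w le_rfl with ⟨hw, s, hs⟩ | ⟨hw, k, p, hp, hkp, hpM, hk, h⟩
  -- Malformed inputs belong to the complement and are accepted without any toss, by the branch `ret
  -- true`.
  · refine ⟨0, fun _ => true, Run.tree fun cs hcs => ?_, fun _ => ?_, fun hw' => ?_⟩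
    · obtain rfl := List.eq_nil_of_length_eq_zero hcs
      exact ⟨s, hs.ite (.halt hs.ok_end)⟩
    · simp [coinAverage]
    · exact (hw (isInstance_of_mem_listProblem (not_not.1 hw'))).elim
  · have : Fact p.Prime := ⟨hp⟩
    obtain ⟨vs, vs', hvs, hvs', hw'⟩ := hw.exists
    have hvv : vs.length = vs'.length := by omega
    have hL : w ∈ MultisetEquality ↔ vs.Perm vs' := by
      rw [hw', MultisetEquality, mem_listProblem_iff hvv, Multiset.coe_eq_coe]
    let g : ℕ × ℕ → Bool := fun z =>
      decide ((finalHash w p z.1 z.2).acc ≠ (finalHash w p z.1 z.2).A)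
    refine ⟨2 * k, fun cs => g (sampleFrom 0 0 cs), Run.tree fun cs hcs => ?_, fun hne => ?_,
      fun heq => ?_⟩
    · obtain ⟨v, rfl, h₂, h₃, h₄, rfl, h₅, h₆, h₇, h₈, h₉⟩ := h cs hcs
      have hlt := sampleFrom_lt k 0 0 hcs
      have hm : hashes v.con₀ ≤ v.con₀.length := List.countP_le_length
      have hp₂ := hp.two_le
      have hM' : v.con₀.length + 1 ≤ regBound v.con₀.length := by
        calc v.con₀.length + 1 ≤ 1 * (v.con₀.length + 1) ^ 5 := by
              rw [one_mul]; exact Nat.le_self_pow (by norm_num) _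
          _ ≤ _ := Nat.mul_le_mul_right _ (by norm_num)
      obtain ⟨s', b, hr, hb⟩ := Runs.multisetBackward (t := 1) (M := regBound v.con₀.length)
        (by norm_num) v (by norm_num) (σ := .initial 0) ⟨hp₂, hp₂, by simp [HashState.initial]; omega⟩
        hp₂ hpM (by simp [HashState.initial]; omega) (by omega) (by omega) (by omega) (by omega)
        h₈ h₃ h₂
      refine ⟨s'.enc 1, ?_⟩
      have : g (sampleFrom 0 0 cs) = b := by
        rw [Bool.eq_iff_iff, hb, h₄, h₇, h₅, h₆]
        simp only [g, decide_eq_true_eq]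
        rfl
      rw [this, ← List.append_nil cs]
      exact h₉.ite hr
    · refine half_le_coinAverage_sampleFrom (g := g) ?_
      have := card_finalHash_le hkp hk hvv (by rw [← hw']) (mt hL.2 hne)
      rw [← hw'] at this
      simpa [g] using this
    · refine coinAverage_eq_zero fun cs hcs => ?_
      have hlt := sampleFrom_lt k 0 0 hcs
      have heq' := listEval_perm (perm_reverse_iff.2 (hL.1 (not_not.1 heq)))
        ((sampleFrom 0 0 cs).1 : ZMod p) ((sampleFrom 0 0 cs).2 : ZMod p)
      have := (finalHash_acc_eq_iff (by omega) hvv).2 heq'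
      rw [← hw'] at this
      simpa [g] using this

/-! ## Nondeterministic checks that read guessed copies of the input -/

/-- The letter that is given by two bits. -/
def letterOf (a b : Bool) : Letter := bif a then .bit b else .hash

/-- The word that is given by a list of bits. -/
def decodeBits : List Bool → List Letter
  | a :: b :: cs => letterOf a b :: decodeBits cs
  | _ => []

theorem length_decodeBits (k : ℕ) {cs : List Bool} (h : cs.length = 2 * k) :
    (decodeBits cs).length = k := by
  induction k generalizing cs with
  | zero =>
    obtain rfl := List.eq_nil_of_length_eq_zero h
    rfl
  | succ k ih =>
    match cs, h with
    | a :: b :: cs, h =>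
      rw [decodeBits, List.length_cons, ih (cs := cs) (by simp only [List.length_cons] at h; omega)]

theorem decodeBits_append (k : ℕ) {cs : List Bool} (h : cs.length = 2 * k) (ds : List Bool) :
    decodeBits (cs ++ ds) = decodeBits cs ++ decodeBits ds := by
  induction k generalizing cs with
  | zero =>
    obtain rfl := List.eq_nil_of_length_eq_zero h
    rfl
  | succ k ih =>
    match cs, h with
    | a :: b :: cs, h =>
      simp only [List.cons_append, decodeBits, List.cons.injEq, true_and]
      exact ih (cs := cs) (by simp only [List.length_cons] at h; omega)

theorem exists_decodeBits (z : List Letter) :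
    ∃ cs : List Bool, cs.length = 2 * z.length ∧ decodeBits cs = z := by
  induction z with
  | nil => exact ⟨[], rfl, rfl⟩
  | cons a z ih =>
    obtain ⟨cs, h, rfl⟩ := ih
    cases a with
    | bit b => exact ⟨true :: b :: cs, by simp [h]; omega, rfl⟩
    | hash => exact ⟨false :: false :: cs, by simp [h]; omega, rfl⟩

/-- The power of a word. -/
def wordPow (w : List Letter) (L : ℕ) : List Letter := (List.replicate L w).flatten

theorem length_wordPow (w : List Letter) (L : ℕ) : (wordPow w L).length = w.length * L := by
  simp [wordPow, mul_comm]

theorem wordPow_add (w : List Letter) (L L' : ℕ) :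
    wordPow w (L + L') = wordPow w L ++ wordPow w L' := by
  simp only [wordPow, ← List.replicate_append_replicate, List.flatten_append]

theorem wordPow_one (w : List Letter) : wordPow w 1 = w := by simp [wordPow]

/-- If `z` is a prefix of `w ++ z`, then `z` begins with `w`, and removing this block from both
sides leaves a shorter word with the same property. One backward comparison thus certifies all
guessed readings at once. -/
theorem prefix_append_iff {w z : List Letter} {L : ℕ} (h : z.length = w.length * L) :
    z <+: w ++ z ↔ z = wordPow w L := by
  constructor
  · intro hz
    induction L generalizing z with
    | zero => exact List.eq_nil_of_length_eq_zero h
    | succ L ih =>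
      obtain ⟨z', rfl⟩ : w <+: z := List.prefix_of_prefix_length_le (List.prefix_append _ _) hz
        (by rw [h]; exact Nat.le_mul_of_pos_right _ (Nat.succ_pos _))
      rw [add_comm, wordPow_add, wordPow_one, ih (z := z')]
      · simp only [List.length_append] at h
        rw [mul_add, mul_one] at h
        omega
      · exact (List.prefix_append_right_inj w).1 hz
  · rintro rfl
    have : w ++ wordPow w L = wordPow w L ++ w := by
      rw [← wordPow_one w, wordPow_one w]
      nth_rw 1 [← wordPow_one w]
      rw [← wordPow_add, add_comm, wordPow_add, wordPow_one]
    rw [this]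
    exact List.prefix_append _ _

/-- The variables when the word `z` has been guessed on input `w`. -/
abbrev Vars.guessed (v : Vars) (w z : List Letter) (β : ℕ) : Vars :=
  { v with con₀ := w ++ z, pos₀ := w.length + z.length, con₁ := z, pos₁ := z.length,
           tot := z.length, bad := β }

namespace Prog

/-- Write a letter of the guessed word on both external tapes. -/
def copyLetter (a : Letter) : Prog 33 :=
  put 0 a.sym .right ⨟ put 1 a.sym .right ⨟ inc Reg.tot

/-- Guess a letter and process it. -/
def guessLetter (body : Letter → Prog 33) : Prog 33 :=
  ite flip
    (ite flip (copyLetter (.bit true) ⨟ body (.bit true))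
      (copyLetter (.bit false) ⨟ body (.bit false)))
    (ite flip (copyLetter .hash ⨟ body .hash) (copyLetter .hash ⨟ body .hash))

/-- Guess a word of the length of the input and process its letters. -/
def guessWord (body : Letter → Prog 33) : Prog 33 := forLoop Reg.c₀ Reg.n (guessLetter body)

end Prog

namespace Runs

open Prog Vars

variable {M : ℕ}

theorem copyLetter (v : Vars) (w z : List Letter) (β : ℕ) (hz : z.length ≤ M) (a : Letter) :
    Runs 2 M (.copyLetter a) (v.guessed w z β).idle.st [] true
      (v.guessed w (z ++ [a]) β).idle.st := by
  have h₁ := Runs.append (s := (v.guessed w z β).idle.st) (t := 2) (M := M) (i := 0) (by decide)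
    (by simp) a
  simp only [st_pos₀, st_con₀, set_pos₀, set_con₀] at h₁
  have h₂ := Runs.append (s := { (v.guessed w z β).idle with
    con₀ := w ++ z ++ [a], pos₀ := w.length + z.length + 1 }.st) (t := 2) (M := M) (i := 1)
    (by decide) (by simp) a
  simp only [st_pos₁, st_con₁, set_pos₁, set_con₁] at h₂
  have h₃ := Runs.inc (s := { (v.guessed w z β).idle with
    con₀ := w ++ z ++ [a], pos₀ := w.length + z.length + 1,
    con₁ := z ++ [a], pos₁ := z.length + 1 }.st) (t := 2) (M := M) (i := Reg.tot)
    (by decide) (by simpa using hz)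
  simp only [reg_tot, set_tot] at h₃
  have h₄ : Runs 2 M (.copyLetter a) _ [] true _ := h₁.seq₀ (h₂.seq₀ h₃)
  simp only [List.append_assoc] at h₄
  simpa only [Vars.guessed, List.length_append, List.length_cons, List.length_nil, Nat.zero_add,
    Nat.add_assoc] using h₄

theorem guessLetter {body : Letter → Prog 33} (v : Vars) (w z : List Letter) (β : ℕ)
    (hz : z.length ≤ M) (c d : Bool) {s : St 33} {b : Bool}
    (h : Runs 2 M (body (letterOf c d)) (v.guessed w (z ++ [letterOf c d]) β).idle.st [] b s) :
    Runs 2 M (.guessLetter body) (v.guessed w z β).idle.st [c, d] b s := by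
  have h₁ := (copyLetter v w z β hz (letterOf c d)).seq₀ h
  cases c <;> cases d <;> exact (Runs.flip _).ite (cs' := [_]) ((Runs.flip _).ite (cs' := []) h₁)

/-- The rule for `guessWord`: `emb σ` are the variables in a state `σ`. -/
theorem guessWord {τ : Type*} {body : Letter → Prog 33} (w : List Letter) (emb : τ → Vars)
    (step : τ → Letter → τ) (Good : ℕ → τ → Prop) (hc : ∀ σ, (emb σ).c₀ = 0)
    (hn : ∀ σ, (emb σ).n = w.length)
    (hbody : ∀ k < w.length, ∀ σ, Good k σ → ∀ z β a, ∃ b,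
      Runs 2 M (body a) ({ emb σ with c₀ := k }.guessed w z β).idle.st [] b
        ({ emb (step σ a) with c₀ := k }.guessed w z β).idle.st ∧ Good (k + 1) (step σ a))
    {σ : τ} (hσ : Good 0 σ) (z : List Letter) (β : ℕ) (hz : z.length + w.length ≤ M)
    {cs : List Bool} (hcs : cs.length = 2 * w.length) :
    Runs 2 M (.guessWord body) ((emb σ).guessed w z β).idle.st cs true
        ((emb ((decodeBits cs).foldl step σ)).guessed w (z ++ decodeBits cs) β).idle.st ∧
      Good w.length ((decodeBits cs).foldl step σ) := by
  obtain ⟨s', h₁, h₂, h₃, rfl⟩ := forLoop (t := 2) (M := M) (c := Reg.c₀) (x := Reg.n)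
    (N := w.length) (p := .guessLetter body) (by decide) (by decide) (by decide) (by omega)
    (fun k cs s => cs.length = 2 * k ∧ Good k ((decodeBits cs).foldl step σ) ∧
      s = ((emb ((decodeBits cs).foldl step σ)).guessed w (z ++ decodeBits cs) β).idle.st)
    (fun _ => 2) (by rintro i cs s ⟨-, -, rfl⟩; exact ⟨hc _, hn _⟩) (by
      rintro k cs s hk ⟨hcs, hG, rfl⟩ ds hds
      obtain ⟨a, d, rfl⟩ := List.length_eq_two.1 hds
      have hd : decodeBits (cs ++ [a, d]) = decodeBits cs ++ [letterOf a d] :=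
        decodeBits_append k hcs _
      have hl := length_decodeBits k hcs
      rw [hd, List.foldl_append]
      simp only [List.foldl_cons, List.foldl_nil]
      obtain ⟨b, h, hG'⟩ := hbody k hk _ hG (z ++ (decodeBits cs ++ [letterOf a d])) β
        (letterOf a d)
      rw [← List.append_assoc] at h
      have h' := guessLetter _ w (z ++ decodeBits cs) β (by simp [hl]; omega) a d h
      rw [List.append_assoc] at h'
      refine ⟨b, _, ?_, by simp [hcs]; omega, hG', rfl⟩
      simp only [set_c₀]
      exact h')
    (s := ((emb σ).guessed w z β).idle.st) ⟨rfl, hσ, by simp [decodeBits]⟩ (cs := cs)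
    (by simp [hcs, mul_comm])
  exact ⟨h₁, h₃⟩

end Runs

/-- The program `C` transforms `v` to `v'` while it guesses `L` words of the length of the input
`w`, and it may set the flag `bad`.  If all guessed words are equal to the input, it sets the flag
unless `Q`. -/
def Verifies (w : List Letter) (M : ℕ) (v v' : Vars) (C : Prog 33) (L : ℕ) (Q : Prop) : Prop :=
  ∀ (z : List Letter) (β : ℕ) (cs : List Bool), cs.length = 2 * (w.length * L) → β ≤ 1 →
    z.length + w.length * L ≤ M → ∃ b β', β' ≤ 1 ∧
      Runs 2 M C (v.guessed w z β).idle.st cs b (v'.guessed w (z ++ decodeBits cs) β').idle.st ∧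
      (decodeBits cs = wordPow w L → (β' = 0 ↔ β = 0 ∧ Q))

namespace Verifies

open Prog Vars

variable {w : List Letter} {M : ℕ} {v v' v'' : Vars} {C C' : Prog 33} {L L' : ℕ} {Q Q' : Prop}

theorem of_runs (h : ∀ z β, β ≤ 1 → ∃ b, Runs 2 M C (v.guessed w z β).idle.st [] b
    (v'.guessed w z β).idle.st) : Verifies w M v v' C 0 True := by
  intro z β cs hcs hβ _
  obtain rfl := List.eq_nil_of_length_eq_zero hcs
  obtain ⟨b, hb⟩ := h z β hβ
  exact ⟨b, β, hβ, by simpa [decodeBits] using hb, by simp⟩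

theorem congr (h : Verifies w M v v' C L Q) (hL : L = L') (hQ : Q ↔ Q') :
    Verifies w M v v' C L' Q' := by
  subst hL
  obtain rfl := propext hQ
  exact h

theorem wordPow_split {w : List Letter} {L L' : ℕ} {cs ds : List Bool}
    (hcs : cs.length = 2 * (w.length * L)) (h : decodeBits (cs ++ ds) = wordPow w (L + L')) :
    decodeBits cs = wordPow w L ∧ decodeBits ds = wordPow w L' := by
  rw [decodeBits_append _ hcs, wordPow_add] at h
  exact List.append_inj h (by rw [length_decodeBits _ hcs, length_wordPow])

/-- The tosses are cut where `C` has guessed its `L` words. If the whole guess is a power of `w`, so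
are both parts, and the flag collects both conditions. -/
theorem seq (h : Verifies w M v v' C L Q) (h' : Verifies w M v' v'' C' L' Q') :
    Verifies w M v v'' (C ⨟ C') (L + L') (Q ∧ Q') := by
  intro z β cs hcs hβ hM
  rw [mul_add] at hcs hM
  obtain ⟨ds, ds', rfl, hds⟩ : ∃ ds ds', cs = ds ++ ds' ∧ ds.length = 2 * (w.length * L) :=
    ⟨cs.take (2 * (w.length * L)), cs.drop (2 * (w.length * L)), by simp, by simp; omega⟩
  rw [List.length_append] at hcs
  have hl := length_decodeBits _ hds
  obtain ⟨b, β', hβ', h₁, h₂⟩ := h z β ds hds hβ (by omega)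
  obtain ⟨b', β'', hβ'', h₃, h₄⟩ := h' (z ++ decodeBits ds) β' ds' (by omega) hβ'
    (by rw [List.length_append]; omega)
  refine ⟨b', β'', hβ'', ?_, fun hd => ?_⟩
  · rw [decodeBits_append _ hds, ← List.append_assoc]
    exact h₁.seq h₃
  · obtain ⟨e, e'⟩ := wordPow_split hds hd
    rw [h₄ e', h₂ e, and_assoc]

/-- Here `V k` are the variables before iteration `k` with counter 0, while `U k` and `U' k` are
those with counter `k` at the start and at the end of the body. -/
theorem forLoop {c r : Fin 33} (hc : 2 ≤ c.val) (hr : 2 ≤ r.val) (hcr : c ≠ r) {N : ℕ} (hN : N ≤ M)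
    {V U U' : ℕ → Vars} {P : ℕ → Prop}
    (h₀ : ∀ k z β, ((V k).guessed w z β).idle.st.reg c = 0)
    (h₁ : ∀ k z β, ((V k).guessed w z β).idle.st.reg r = N)
    (hU : ∀ k z β, ((V k).guessed w z β).idle.st.set c k = ((U k).guessed w z β).idle.st)
    (hU' : ∀ k z β, ((V (k + 1)).guessed w z β).idle.st.set c k = ((U' k).guessed w z β).idle.st)
    (h : ∀ k < N, Verifies w M (U k) (U' k) C L (P k)) :
    Verifies w M (V 0) (V N) (.forLoop c r C) (L * N) (∀ k < N, P k) := by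
  intro z β cs hcs hβ hM
  obtain ⟨s', h₁, h₂, β', hβ', rfl, h₄⟩ := Runs.forLoop (t := 2) (M := M) (c := c) (x := r)
    (N := N) (p := C) hc hr hcr hN
    (fun k cs s => cs.length = 2 * (w.length * (L * k)) ∧ ∃ β' ≤ 1,
      s = ((V k).guessed w (z ++ decodeBits cs) β').idle.st ∧
      (decodeBits cs = wordPow w (L * k) → (β' = 0 ↔ β = 0 ∧ ∀ i < k, P i)))
    (fun _ => 2 * (w.length * L)) (by rintro i cs s ⟨-, β', -, rfl, -⟩; exact ⟨h₀ _ _ _, h₁ _ _ _⟩) (by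
      rintro k cs s hk ⟨hcs, β', hβ', rfl, hQ⟩ ds hds
      have hle : w.length * (L * k) + w.length * L ≤ w.length * (L * N) := by
        rw [← mul_add, ← Nat.mul_succ]
        exact Nat.mul_le_mul_left _ (Nat.mul_le_mul_left _ hk)
      obtain ⟨b, β'', hβ'', h₁, h₂⟩ := h k hk (z ++ decodeBits cs) β' ds hds hβ'
        (by rw [List.length_append, length_decodeBits _ hcs]; omega)
      refine ⟨b, _, ?_, ?_, β'', hβ'', rfl, fun hd => ?_⟩
      · rw [hU, hU', decodeBits_append _ hcs, ← List.append_assoc]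
        exact h₁
      · rw [List.length_append, hcs, hds]; ring
      · rw [Nat.mul_succ] at hd
        obtain ⟨e, e'⟩ := wordPow_split hcs hd
        rw [h₂ e', hQ e, and_assoc]
        refine and_congr_right fun _ => ⟨fun h i hi => ?_, fun h => ⟨fun i hi => h i (by omega),
          h k (by omega)⟩⟩
        rcases Nat.lt_succ_iff_lt_or_eq.1 hi with hi | rfl
        · exact h.1 i hi
        · exact h.2)
    (s := ((V 0).guessed w z β).idle.st) ⟨rfl, β, hβ, by simp [decodeBits], by simp⟩ (cs := cs)
    (by simp [hcs]; ring)
  exact ⟨_, β', hβ', h₁, h₄⟩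

end Verifies

/-! ## Nondeterministic checks of fingerprints -/

namespace Prog

/-- Compute the fingerprints of both halves of the input at the point `(x, y)` and execute a test
for them. -/
def checkPoint (T : Prog 33) : Prog 33 :=
  one Reg.h ⨟ one Reg.acc ⨟ one Reg.A ⨟ one Reg.j ⨟ one Reg.e ⨟ guessWord hashLetter ⨟ T ⨟
    zero Reg.h ⨟ zero Reg.acc ⨟ zero Reg.A ⨟ zero Reg.j ⨟ zero Reg.e

/-- Test the fingerprints of both halves at all points. -/
def checkPoints (T : Prog 33) : Prog 33 :=
  forLoop Reg.x Reg.p (forLoop Reg.y Reg.p (checkPoint T))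

/-- Test whether the fingerprints are equal. -/
def testEq : Prog 33 := ite (eq Reg.acc Reg.A) (ret true) (one Reg.bad)

/-- Test whether both fingerprints are zero or both are not. -/
def testZero : Prog 33 :=
  ite (eq Reg.acc Reg.zer) (ite (eq Reg.A Reg.zer) (ret true) (one Reg.bad))
    (ite (eq Reg.A Reg.zer) (one Reg.bad) (ret true))

end Prog

/-- `T` sets the flag `bad` unless `R` holds for the fingerprints. -/
def Tests (M : ℕ) (T : Prog 33) (R : ℕ → ℕ → Prop) : Prop :=
  ∀ v : Vars, v.acc ≤ M → v.A ≤ M → v.bad ≤ 1 → ∃ b β, β ≤ 1 ∧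
    Runs 2 M T v.idle.st [] b { v.idle with bad := β }.st ∧ (β = 0 ↔ v.bad = 0 ∧ R v.acc v.A)

/-- The fingerprints at a point if the guessed word is correct. -/
def pointHash (w : List Letter) (p m x y : ℕ) : HashState :=
  -- Words are numbered from 1, so that the separator of word `m` ends the first half. For `m = 0`
  -- there is no switch, and `A := 1` is the right empty product.
  w.foldl (HashState.step x y p m 1) { h := 1, acc := 1, A := 1, j := 1 }

section

open Prog Vars

variable {M : ℕ}

theorem tests_testEq (hM : 1 ≤ M) : Tests M testEq (fun a b => a = b) := by
  intro v ha hA hb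
  by_cases h : v.acc = v.A
  · exact ⟨_, v.bad, hb, (Runs.eq_true (i := Reg.acc) (j := Reg.A) (by decide) (by decide)
      (by decide) (by simpa using ha) (by simpa using h)).ite_true (Runs.ret true), by simp [h]⟩
  · have h₁ := Runs.eq_false (s := v.idle.st) (t := 2) (M := M) (i := Reg.acc) (j := Reg.A)
      (by decide) (by decide) (by decide) (by simpa using ha) (by simpa using hA) (by simpa using h)
    have h₂ := Runs.one (s := v.idle.st) (t := 2) (M := M) (i := Reg.bad) (by decide)
      (by simp; omega)
    simp only [set_bad] at h₂
    exact ⟨_, 1, le_rfl, h₁.ite_false h₂, by simp [h]⟩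

theorem tests_testZero (hM : 1 ≤ M) : Tests M testZero (fun a b => a = 0 ↔ b = 0) := by
  intro v ha hA hb
  have h₁ := Runs.eq_true (s := v.idle.st) (t := 2) (M := M) (i := Reg.acc) (j := Reg.zer)
    (by decide) (by decide) (by decide) (by simpa using ha)
  have h₁' := Runs.eq_false (s := v.idle.st) (t := 2) (M := M) (i := Reg.acc) (j := Reg.zer)
    (by decide) (by decide) (by decide) (by simpa using ha) (by simp)
  have h₂ := Runs.eq_true (s := v.idle.st) (t := 2) (M := M) (i := Reg.A) (j := Reg.zer)
    (by decide) (by decide) (by decide) (by simpa using hA)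
  have h₂' := Runs.eq_false (s := v.idle.st) (t := 2) (M := M) (i := Reg.A) (j := Reg.zer)
    (by decide) (by decide) (by decide) (by simpa using hA) (by simp)
  have h₃ := Runs.one (s := v.idle.st) (t := 2) (M := M) (i := Reg.bad) (by decide)
    (by simp; omega)
  simp only [set_bad, reg_acc, reg_A, reg_zer] at h₁ h₁' h₂ h₂' h₃
  by_cases ha0 : v.acc = 0
  · by_cases hA0 : v.A = 0
    · exact ⟨_, v.bad, hb, (h₁ ha0).ite_true ((h₂ hA0).ite_true (Runs.ret true)), by simp [ha0, hA0]⟩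
    · exact ⟨_, 1, le_rfl, (h₁ ha0).ite_true ((h₂' hA0).ite_false h₃), by simp [ha0, hA0]⟩
  · by_cases hA0 : v.A = 0
    · exact ⟨_, 1, le_rfl, (h₁' ha0).ite_false ((h₂ hA0).ite_true h₃), by simp [ha0, hA0]⟩
    · exact ⟨_, v.bad, hb, (h₁' ha0).ite_false ((h₂' hA0).ite_false (Runs.ret true)),
        by simp [ha0, hA0]⟩

/-- A wrong guess still leaves all registers reduced and bounded, so the run exists for every toss
sequence; only the meaning of the flag depends on a correct guess. -/
theorem verifies_checkPoint {w : List Letter} {v : Vars} {T : Prog 33} {R : ℕ → ℕ → Prop}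
    (hT : Tests M T R) (hh : v.h = 0) (hacc : v.acc = 0) (hA : v.A = 0) (hj : v.j = 0)
    (he : v.e = 0) (hc : v.c₀ = 0) (hn : v.n = w.length) (hp : 1 < v.p) (hpM : v.p ≤ M)
    (hx : v.x ≤ M) (hy : v.y ≤ M) (hm : v.m ≤ M) (hM : w.length + 1 ≤ M) :
    Verifies w M v v (checkPoint T) 1
      (R (pointHash w v.p v.m v.x v.y).acc (pointHash w v.p v.m v.x v.y).A) := by
  intro z β cs hcs hβ hzM
  rw [mul_one] at hcs hzM
  have h₁ := Runs.one (s := (v.guessed w z β).idle.st) (t := 2) (M := M) (i := Reg.h) (by decide)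
    (by simp [hh])
  have h₂ := Runs.one (s := { (v.guessed w z β).idle with h := 1 }.st) (t := 2) (M := M)
    (i := Reg.acc) (by decide) (by simp [hacc])
  have h₃ := Runs.one (s := { (v.guessed w z β).idle with h := 1, acc := 1 }.st) (t := 2) (M := M)
    (i := Reg.A) (by decide) (by simp [hA])
  have h₄ := Runs.one (s := { (v.guessed w z β).idle with h := 1, acc := 1, A := 1 }.st) (t := 2)
    (M := M) (i := Reg.j) (by decide) (by simp [hj])
  have h₅ := Runs.one (s := { (v.guessed w z β).idle with h := 1, acc := 1, A := 1, j := 1 }.st)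
    (t := 2) (M := M) (i := Reg.e) (by decide) (by simp [he])
  simp only [set_h, set_acc, set_A, set_j, set_e] at h₁ h₂ h₃ h₄ h₅
  obtain ⟨h₆, hred, hjle⟩ := Runs.guessWord (M := M) (body := hashLetter) w
    (fun σ : HashState => { v with e := 1 }.withHash σ) (HashState.step v.x v.y v.p v.m 1)
    (fun k σ => σ.Reduced v.p ∧ σ.j ≤ k + 1) (fun _ => hc) (fun _ => hn) (by
      rintro k hk σ ⟨hσ, hσj⟩ z β a
      obtain ⟨b, h⟩ := Runs.hashLetter (t := 2) (M := M) le_rfl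
        ({ v with e := 1, c₀ := k }.guessed w z β) hσ hp hpM (by omega) hp hx hy hm a
      exact ⟨b, h, hσ.step hp hp a, by cases a <;> simp [HashState.step] <;> omega⟩)
    (σ := { h := 1, acc := 1, A := 1, j := 1 }) ⟨⟨hp, hp, hp⟩, le_rfl⟩ z β hzM hcs
  have hpoint : decodeBits cs = w → (decodeBits cs).foldl (HashState.step v.x v.y v.p v.m 1)
      { h := 1, acc := 1, A := 1, j := 1 } = pointHash w v.p v.m v.x v.y := fun h => by
    rw [h, pointHash]
  generalize (decodeBits cs).foldl (HashState.step v.x v.y v.p v.m 1)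
      { h := 1, acc := 1, A := 1, j := 1 } = ρ at h₆ hred hjle hpoint
  generalize z ++ decodeBits cs = z' at h₆
  obtain ⟨hρh, hρacc, hρA⟩ := hred
  obtain ⟨b, β', hβ', h₇, hR⟩ := hT (({ v with e := 1 }.withHash ρ).guessed w z' β)
    (by dsimp only; omega) (by dsimp only; omega) hβ
  have h₈ := Runs.zero (s := { (({ v with e := 1 }.withHash ρ).guessed w z' β).idle with
    bad := β' }.st) (t := 2) (M := M) (i := Reg.h) (by decide) (by simp; omega)
  have h₉ := Runs.zero (s := { (({ v with e := 1 }.withHash ρ).guessed w z' β).idle with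
    bad := β', h := 0 }.st) (t := 2) (M := M) (i := Reg.acc) (by decide) (by simp; omega)
  have hh₁ := Runs.zero (s := { (({ v with e := 1 }.withHash ρ).guessed w z' β).idle with
    bad := β', h := 0, acc := 0 }.st) (t := 2) (M := M) (i := Reg.A) (by decide) (by simp; omega)
  have hh₂ := Runs.zero (s := { (({ v with e := 1 }.withHash ρ).guessed w z' β).idle with
    bad := β', h := 0, acc := 0, A := 0 }.st) (t := 2) (M := M) (i := Reg.j) (by decide)
    (by simp; omega)
  have hh₃ := Runs.zero (s := { (({ v with e := 1 }.withHash ρ).guessed w z' β).idle with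
    bad := β', h := 0, acc := 0, A := 0, j := 0 }.st) (t := 2) (M := M) (i := Reg.e) (by decide)
    (by simp; omega)
  simp only [set_h, set_acc, set_A, set_j, set_e] at h₈ h₉ hh₁ hh₂ hh₃
  have hv : { (({ v with e := 1 }.withHash ρ).guessed w z' β).idle with
      bad := β', h := 0, acc := 0, A := 0, j := 0, e := 0 } = (v.guessed w z' β').idle := by
    cases v
    dsimp only at hh hacc hA hj he
    subst hh hacc hA hj he
    rfl
  rw [hv] at hh₃
  have h := h₆.seq (h₇.seq₀ (h₈.seq₀ (h₉.seq₀ (hh₁.seq₀ (hh₂.seq₀ hh₃)))))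
  rw [List.append_nil] at h
  refine ⟨_, β', hβ', h₁.seq₀ (h₂.seq₀ (h₃.seq₀ (h₄.seq₀ (h₅.seq₀ h)))), fun hd => ?_⟩
  rw [wordPow_one] at hd
  rw [← hpoint hd]
  exact hR

theorem verifies_checkPoints {w : List Letter} {v : Vars} {T : Prog 33} {R : ℕ → ℕ → Prop}
    (hT : Tests M T R) (hh : v.h = 0) (hacc : v.acc = 0) (hA : v.A = 0) (hj : v.j = 0)
    (he : v.e = 0) (hc : v.c₀ = 0) (hn : v.n = w.length) (hp : 1 < v.p) (hpM : v.p ≤ M)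
    (hx : v.x = 0) (hy : v.y = 0) (hm : v.m ≤ M) (hM : w.length + 1 ≤ M) :
    Verifies w M v v (checkPoints T) (v.p * v.p) (∀ x < v.p, ∀ y < v.p,
      R (pointHash w v.p v.m x y).acc (pointHash w v.p v.m x y).A) := by
  refine (Verifies.forLoop (w := w) (M := M) (c := Reg.x) (r := Reg.p) (L := 1 * v.p) (N := v.p)
    (C := .forLoop Reg.y Reg.p (checkPoint T))
    (by decide) (by decide) (by decide) hpM (V := fun _ => v) (U := fun x => { v with x := x })
    (U' := fun x => { v with x := x }) (fun _ _ _ => hx) (fun _ _ _ => rfl)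
    (fun _ _ _ => set_x _ _) (fun _ _ _ => set_x _ _) fun x hxp => ?_).congr (by ring) Iff.rfl
  exact Verifies.forLoop (w := w) (M := M) (c := Reg.y) (r := Reg.p) (L := 1) (N := v.p)
    (C := checkPoint T)
    (P := fun y => R (pointHash w v.p v.m x y).acc (pointHash w v.p v.m x y).A)
    (by decide) (by decide) (by decide) hpM (V := fun _ => { v with x := x })
    (U := fun y => { v with x := x, y := y })
    (U' := fun y => { v with x := x, y := y }) (fun _ _ _ => hy) (fun _ _ _ => rfl)
    (fun _ _ _ => set_y _ _) (fun _ _ _ => set_y _ _) fun y hyp =>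
    verifies_checkPoint (v := { v with x := x, y := y }) hT hh hacc hA hj he hc hn hp hpM
      (by dsimp only; omega) (by dsimp only; omega) hm hM

end

theorem pointHash_eq {vs vs' : List (List Bool)} (h : vs.length = vs'.length) (p x y : ℕ) :
    (pointHash (encodeList vs ++ encodeList vs') p vs.length x y).acc = listHash x y p 1 vs' ∧
    (pointHash (encodeList vs ++ encodeList vs') p vs.length x y).A = listHash x y p 1 vs := by
  cases vs with
  | nil =>
    obtain rfl := List.eq_nil_of_length_eq_zero h.symm
    exact ⟨rfl, rfl⟩
  | cons v vs =>
    rw [pointHash, HashState.foldl_encodeList_append rfl (by simp) (by simp [add_comm])]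
    exact ⟨rfl, rfl⟩

theorem zmod_eq_natCast {p : ℕ} [NeZero p] (x : ZMod p) : ∃ k < p, (k : ZMod p) = x :=
  ⟨x.val, x.val_lt, ZMod.natCast_zmod_val x⟩

/-- Different multisets agree at no more than `2 * n * p` points, where `n` is the input length;
this is less than the number `p * p` of all points. -/
theorem forall_pointHash_eq_iff {p : ℕ} (hp : p.Prime) {vs vs' : List (List Bool)}
    (h : vs.length = vs'.length)
    (hpn : 2 * (encodeList vs ++ encodeList vs').length < p) :
    (∀ x < p, ∀ y < p, (pointHash (encodeList vs ++ encodeList vs') p vs.length x y).acc =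
        (pointHash (encodeList vs ++ encodeList vs') p vs.length x y).A) ↔ vs.Perm vs' := by
  have : Fact p.Prime := ⟨hp⟩
  have hp₂ := hp.one_lt
  simp only [(pointHash_eq h p _ _).1, (pointHash_eq h p _ _).2]
  constructor
  · intro H
    by_contra hne
    have hle : (encodeList vs).length ≤ (encodeList vs ++ encodeList vs').length ∧
        (encodeList vs').length ≤ (encodeList vs ++ encodeList vs').length := by simp
    have h₁ := card_listEval_eq_le (F := ZMod p) hne hle.1 hle.2 Finset.univ
    rw [Finset.filter_true_of_mem, Finset.card_product, Finset.card_univ, ZMod.card] at h₁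
    · have := Nat.mul_lt_mul_of_pos_right hpn hp.pos
      omega
    · rintro ⟨x, y⟩ -
      obtain ⟨x, hx, rfl⟩ := zmod_eq_natCast x
      obtain ⟨y, hy, rfl⟩ := zmod_eq_natCast y
      have := (listHash_eq_iff hp₂ hp₂).1 (H x hx y hy)
      simpa using this.symm
  · intro hperm x hx y hy
    rw [listHash_eq_iff hp₂ hp₂, listEval_perm hperm]

/-- Whether a product vanishes depends only on the set of its factors. Conversely,
`mem_of_listEval_eq_zero` is applied in both directions; it needs a prime above the square of the
input length. -/
theorem forall_pointHash_eq_zero_iff {p : ℕ} (hp : p.Prime) {vs vs' : List (List Bool)}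
    (h : vs.length = vs'.length)
    (hpn : (encodeList vs ++ encodeList vs').length * (encodeList vs ++ encodeList vs').length < p) :
    (∀ x < p, ∀ y < p, ((pointHash (encodeList vs ++ encodeList vs') p vs.length x y).acc = 0 ↔
        (pointHash (encodeList vs ++ encodeList vs') p vs.length x y).A = 0)) ↔
      {v | v ∈ vs} = {v | v ∈ vs'} := by
  have : Fact p.Prime := ⟨hp⟩
  have hp₂ := hp.one_lt
  simp only [(pointHash_eq h p _ _).1, (pointHash_eq h p _ _).2, listHash_eq_zero_iff hp₂,
    Nat.cast_one, one_mul]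
  constructor
  · intro H
    have hle : (encodeList vs).length ≤ (encodeList vs ++ encodeList vs').length ∧
        (encodeList vs').length ≤ (encodeList vs ++ encodeList vs').length := by simp
    have H' : ∀ x y : ZMod p, listEval vs' x y = 0 ↔ listEval vs x y = 0 := by
      intro x y
      obtain ⟨x, hx, rfl⟩ := zmod_eq_natCast x
      obtain ⟨y, hy, rfl⟩ := zmod_eq_natCast y
      exact H x hx y hy
    ext v
    exact ⟨mem_of_listEval_eq_zero (F := ZMod p) hle.1 hle.2 (by rwa [ZMod.card])
        fun x y => (H' x y).2,
      mem_of_listEval_eq_zero (F := ZMod p) hle.2 hle.1 (by rwa [ZMod.card])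
        fun x y => (H' x y).1⟩
  · intro hset x hx y hy
    have hmem : ∀ v, v ∈ vs ↔ v ∈ vs' := fun v => Set.ext_iff.1 hset v
    simp only [listEval, List.prod_eq_zero_iff, List.mem_map, hmem]

/-! ## Nondeterministic algorithms -/

namespace Prog

/-- Move both external heads to the left and compare the letters. -/
def compareLetters : Prog 33 :=
  move 0 .left ⨟ move 1 .left ⨟ ite (test 0 fun v => decide (v 0 = v 1)) (ret true) (one Reg.bad)

/-- The forward phase of a nondeterministic algorithm. -/
def guessForward (C : Prog 33) : Prog 33 :=
  prepare 2 ⨟ ite scan (computeBound ⨟ copy Reg.c₁ Reg.d Reg.q ⨟ findPrime ⨟ C ⨟ ret true)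
    (ret false)

/-- The backward phase of a nondeterministic algorithm: test whether the guessed word `z` is a
prefix of the inscription `w ++ z` of the first tape. -/
def guessBackward : Prog 33 :=
  forLoop Reg.c₀ Reg.n (move 0 .left) ⨟ forLoop Reg.c₀ Reg.tot compareLetters ⨟ eq Reg.bad Reg.zer

end Prog

theorem prefix_iff_wordTape {z z' : List Letter} (h : z.length ≤ z'.length) :
    z <+: z' ↔ ∀ i < z.length, wordTape z' i = wordTape z i := by
  rw [List.prefix_iff_getElem?]
  refine forall₂_congr fun i hi => ?_
  rw [wordTape_lt hi, wordTape_lt (hi.trans_le h), List.getElem?_eq_getElem (hi.trans_le h),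
    Option.some_inj, Letter.sym_injective.eq_iff]

/-- After `w.length` steps to the left the first head has exactly `z.length` cells to its left, like
the second head, and both tapes can be compared from right to left down to cell 0. -/
theorem Runs.guessBackward {M : ℕ} {v : Vars} {w z : List Letter} {β : ℕ} (hβ : β ≤ 1)
    (hn : v.n = w.length) (hc : v.c₀ = 0) (hw : w.length ≤ M) (hz : z.length ≤ M) (hM : 1 ≤ M) :
    ∃ s b, Runs 2 M .guessBackward (v.guessed w z β).idle.st [] b s ∧
      (b = true ↔ β = 0 ∧ z <+: w ++ z) := by
  classical
  have h₁ := forLoop₀ (t := 2) (M := M) (c := Reg.c₀) (x := Reg.n) (N := w.length)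
    (p := .move 0 .left) (by decide) (by decide) (by decide) hw
    (fun k => { (v.guessed w z β).idle with pos₀ := w.length - k + z.length }.st)
    (fun k _ => hc) (fun k _ => hn) (by
      intro k hk
      have h := Runs.moveLeft (s := { (v.guessed w z β).idle with
        pos₀ := w.length - k + z.length, c₀ := k }.st) (t := 2) (M := M) (i := 0) (by decide)
        (k := w.length - (k + 1) + z.length) (by simp; omega)
      simp only [Vars.set_pos₀] at h
      simp only [Vars.set_c₀]
      exact ⟨_, h⟩)
  -- The flag `bad` after `k` comparisons, that is, after the cells from `z.length - k` on have been
  -- checked.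
  let f : ℕ → ℕ := fun k =>
    if β = 0 ∧ ∀ i, z.length - k ≤ i → i < z.length → wordTape (w ++ z) i = wordTape z i
      then 0 else 1
  have hf : ∀ k, f k ≤ 1 := fun k => by simp only [f]; split_ifs <;> simp
  have h₂ := forLoop₀ (t := 2) (M := M) (c := Reg.c₀) (x := Reg.tot) (N := z.length)
    (p := .compareLetters) (by decide) (by decide) (by decide) hz
    (fun k => { (v.guessed w z (f k)).idle with
      pos₀ := z.length - k, pos₁ := z.length - k }.st)
    (fun k _ => hc) (fun k _ => rfl) (by
      intro k hk
      have e₁ := Runs.moveLeft (s := { (v.guessed w z (f k)).idle with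
        pos₀ := z.length - k, pos₁ := z.length - k, c₀ := k }.st) (t := 2) (M := M) (i := 0)
        (by decide) (k := z.length - (k + 1)) (by simp; omega)
      have e₂ := Runs.moveLeft (s := { (v.guessed w z (f k)).idle with
        pos₀ := z.length - (k + 1), pos₁ := z.length - k, c₀ := k }.st) (t := 2) (M := M) (i := 1)
        (by decide) (k := z.length - (k + 1)) (by simp; omega)
      have e₃ := Runs.one (s := { (v.guessed w z (f k)).idle with
        pos₀ := z.length - (k + 1), pos₁ := z.length - (k + 1), c₀ := k }.st) (t := 2) (M := M)
        (i := Reg.bad) (by decide) (by simpa using (hf k).trans hM)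
      simp only [Vars.set_pos₀, Vars.set_pos₁, Vars.set_bad] at e₁ e₂ e₃
      simp only [Vars.set_c₀]
      have hsucc : f (k + 1) =
          if wordTape (w ++ z) (z.length - (k + 1)) = wordTape z (z.length - (k + 1)) then f k
            else 1 := by
        have hz1 : z.length - (k + 1) + 1 = z.length - k := by omega
        split_ifs with h
        · simp only [f]
          refine if_congr (and_congr_right fun _ => ⟨fun H i hi hi' => H i (by omega) hi',
            fun H i hi hi' => ?_⟩) rfl rfl
          rcases Nat.lt_or_ge i (z.length - k) with h' | h'
          · obtain rfl : i = z.length - (k + 1) := by omega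
            exact h
          · exact H i h' hi'
        · exact if_neg fun H => h (H.2 _ le_rfl (by omega))
      rw [hsucc]
      have hread : ∀ c, decide (wordTape (w ++ z) (z.length - (k + 1)) =
          wordTape z (z.length - (k + 1))) = c →
          Runs 2 M (.test 0 fun v => decide (v 0 = v 1)) { (v.guessed w z (f k)).idle with
            pos₀ := z.length - (k + 1), pos₁ := z.length - (k + 1), c₀ := k }.st [] c
            { (v.guessed w z (f k)).idle with
              pos₀ := z.length - (k + 1), pos₁ := z.length - (k + 1), c₀ := k }.st := by
        intro c hc
        exact Run.test (St.spaceOk_enc _) hc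
      split_ifs with h
      · exact ⟨_, e₁.seq₀ (e₂.seq₀ ((hread true (decide_eq_true h)).ite_true (Runs.ret true)))⟩
      · exact ⟨_, e₁.seq₀ (e₂.seq₀ ((hread false (decide_eq_false h)).ite_false e₃))⟩)
  have hf₀ : f 0 = β := by
    simp only [f]
    interval_cases β
    · exact if_pos ⟨rfl, fun i hi hi' => by omega⟩
    · exact if_neg fun h => by omega
  have hfz : f z.length = 0 ↔ β = 0 ∧ z <+: w ++ z := by
    rw [prefix_iff_wordTape (by simp)]
    simp only [f, Nat.sub_self, Nat.zero_le, true_implies, ite_eq_left_iff, one_ne_zero]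
    tauto
  simp only [hf₀, Nat.sub_zero, Nat.sub_self, Nat.zero_add] at h₁ h₂
  have h₃ := Runs.eq_true (s := { (v.guessed w z (f z.length)).idle with
    pos₀ := 0, pos₁ := 0 }.st) (t := 2) (M := M) (i := Reg.bad) (j := Reg.zer)
    (by decide) (by decide) (by decide) (by simpa using (hf _).trans hM)
  have h₄ := Runs.eq_false (s := { (v.guessed w z (f z.length)).idle with
    pos₀ := 0, pos₁ := 0 }.st) (t := 2) (M := M) (i := Reg.bad) (j := Reg.zer)
    (by decide) (by decide) (by decide) (by simpa using (hf _).trans hM) (by simp)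
  simp only [Vars.reg_bad, Vars.reg_zer] at h₃ h₄
  rw [← hfz]
  by_cases hfz' : f z.length = 0
  · exact ⟨_, true, h₁.seq₀ (h₂.seq₀ (h₃ hfz')), by simp [hfz']⟩
  · exact ⟨_, false, h₁.seq₀ (h₂.seq₀ (h₄ hfz')), by simp [hfz']⟩

/-- The variables when the prime number `p` has been computed. -/
abbrev Vars.checking (w : List Letter) (p : ℕ) : Vars :=
  { Vars.scanned w w with
    d := 0 + 2 * (w.length * w.length) + 1, q := 0 + 2 * (w.length * w.length) + 1, p := p }

theorem le_regBound (N : ℕ) : 8 * (N * N) + N + 8 ≤ regBound N :=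
  calc 8 * (N * N) + N + 8 ≤ 24 * (N + 1) ^ 2 := by nlinarith
    _ ≤ _ := Nat.mul_le_mul_left _ (Nat.pow_le_pow_right (by omega) (by norm_num))

/-- A toss sequence leads to acceptance exactly if the guess is `wordPow w L` and `Q` holds. As
every word can be guessed, some sequence accepts exactly if `Q` holds. -/
theorem mem_NST_of_verifies {P : List (List Bool) → List (List Bool) → Prop} (C : Prog 33)
    (hC : C.avoids 2 Move.isLeft = true)
    (H : ∀ w, IsInstance w → ∀ p, p.Prime → 2 * (w.length * w.length) + 1 < p →
      p ≤ 2 * (2 * (w.length * w.length) + 1) → ∃ v L Q,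
        Verifies w (regBound w.length) (.checking w p) v C L Q ∧ v.n = w.length ∧ v.c₀ = 0 ∧
        w.length * L ≤ regBound w.length ∧ (w ∈ listProblem P ↔ Q)) :
    listProblem P ∈ NST Letter {fun _ => 1 + 2} OLog 2 := by
  refine mem_NST_of_prog (t := 2) (u := 31) (by omega) (p := .guessForward C)
    (q := .guessBackward) (r := .ret false) ?_ (by decide) (by decide)
    (regBound_mem_OLog 31) fun w => ?_
  · have h₁ : (Prog.prepare 2).avoids 2 Move.isLeft = true := by decide
    have h₂ : Prog.scan.avoids 2 Move.isLeft = true := by decide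
    have h₃ : Prog.computeBound.avoids 2 Move.isLeft = true := by decide
    have h₄ : (Prog.copy Reg.c₁ Reg.d Reg.q).avoids 2 Move.isLeft = true := by decide
    have h₅ : Prog.findPrime.avoids 2 Move.isLeft = true := by decide
    simp [Prog.guessForward, Prog.seq, Prog.avoids, h₁, h₂, h₃, h₄, h₅, hC]
  have hM := le_regBound w.length
  have h₀ := Runs.prepare (t := 2) (M := regBound w.length) w (by norm_num) (by norm_num)
  obtain ⟨b, h₁, hb⟩ := Runs.scan (t := 2) (M := regBound w.length) (by norm_num) (by norm_num) w
    (by omega) (by omega)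
  by_cases hw : IsInstance w
  · obtain rfl := hb.2 hw
    have h₂ := Runs.computeBound (t := 2) (M := regBound w.length) (by norm_num)
      (Vars.scanned w w) (by dsimp only; omega)
    have h₃ := Runs.copy (s := { Vars.scanned w w with
        d := 0 + 2 * (w.length * w.length) + 1 }.st) (t := 2) (M := regBound w.length)
      (c := Reg.c₁) (a := Reg.d) (d := Reg.q) (by decide) (by decide) (by decide) (by decide)
      (by decide) (by decide) rfl (by simp; omega) (by simp)
    simp only [Vars.reg_d, Vars.set_q] at h₃
    obtain ⟨p, hp, hp₁, hp₂, h₄⟩ := Runs.findPrime (t := 2) (M := regBound w.length) (by norm_num)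
      { Vars.scanned w w with
        d := 0 + 2 * (w.length * w.length) + 1, q := 0 + 2 * (w.length * w.length) + 1 }
      (by dsimp only; omega) (by dsimp only; omega) (by dsimp only; omega)
    dsimp only at hp₁ hp₂
    obtain ⟨v, L, Q, hV, hvn, hvc, hL, hQ⟩ := H w hw p hp (by omega) (by omega)
    -- The verdict is needed as a function of the tosses; sequences of other lengths get an
    -- arbitrary value.
    have key : ∀ cs : List Bool, ∃ b, cs.length = 2 * (w.length * L) →
        (∃ m, Run (Prog.SpaceOk 2 (Nat.log 2 (regBound w.length) + 2))
          (.ite (.guessForward C) .guessBackward (.ret false)) (Prog.initMem (2 + 31) w) cs b m) ∧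
        (b = true ↔ decodeBits cs = wordPow w L ∧ Q) := by
      intro cs
      by_cases hcs : cs.length = 2 * (w.length * L)
      · have hl := length_decodeBits _ hcs
        obtain ⟨c, β, hβ, h₅, h₆⟩ := hV [] 0 cs hcs (by omega) (by simpa using hL)
        simp only [List.nil_append, Vars.guessed, List.append_nil, List.length_nil,
          Nat.add_zero] at h₅
        obtain ⟨s, b, h₇, h₈⟩ := Runs.guessBackward (v := v) (w := w) (z := decodeBits cs)
          (M := regBound w.length) hβ hvn hvc (by omega) (by omega) (by omega)
        refine ⟨b, fun _ => ⟨⟨s.enc 2, ?_⟩, ?_⟩⟩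
        · have h₉ := h₅.seq (Runs.ret (t := 2) (M := regBound w.length) true)
          rw [List.append_nil] at h₉
          have hf : Run (Prog.SpaceOk 2 (Nat.log 2 (regBound w.length) + 2)) (.guessForward C)
              (Prog.initMem (2 + 31) w) cs true _ :=
            h₀.seq (h₁.ite_true (h₂.seq₀ (h₃.seq₀ (h₄.seq₀ h₉))))
          have := hf.ite (q := .guessBackward) (r := .ret false) h₇
          rwa [List.append_nil] at this
        · rw [h₈, prefix_append_iff hl, and_comm]
          exact and_congr_right fun hd => by simpa using h₆ hd
      · exact ⟨true, fun h => absurd h hcs⟩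
    choose f hf using key
    refine ⟨2 * (w.length * L), f, Run.tree fun cs hcs => (hf cs hcs).1, ?_⟩
    rw [hQ]
    constructor
    · intro hQ
      obtain ⟨cs, hcs, hd⟩ := exists_decodeBits (wordPow w L)
      rw [length_wordPow] at hcs
      exact ⟨cs, hcs, (hf cs hcs).2.2 ⟨hd, hQ⟩⟩
    · rintro ⟨cs, hcs, h⟩
      exact ((hf cs hcs).2.1 h).2
  · obtain rfl : b = false := Bool.eq_false_iff.2 fun h => hw (hb.1 h)
    refine ⟨0, fun _ => false, Run.tree fun cs hcs => ?_, ?_⟩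
    · obtain rfl := List.eq_nil_of_length_eq_zero hcs
      have hf := h₀.seq (h₁.ite_false (q := Prog.computeBound ⨟ Prog.copy Reg.c₁ Reg.d Reg.q ⨟
        Prog.findPrime ⨟ C ⨟ .ret true) (Runs.ret (t := 2) (M := regBound w.length) false))
      exact ⟨_, Run.ite (b := false) (cs' := []) hf (.halt (St.spaceOk_enc _))⟩
    · simp only [Bool.false_eq_true, and_false, exists_false, iff_false]
      exact fun h => hw (isInstance_of_mem_listProblem h)

/-- This explains `regBound`: the prime is quadratic in `n`, the `p * p` readings of length `n`
contribute `16 * (n + 1) ^ 5`, and 8 more are granted for the `L` readings of the test for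
sortedness. The register `tot` counts all these letters. -/
theorem mul_prime_sq_le_regBound {n p L : ℕ} (hp : p ≤ 2 * (2 * (n * n) + 1)) (hL : L ≤ n * n) :
    n * (p * p + L) ≤ regBound n := by
  have h₁ : p ≤ 4 * (n + 1) ^ 2 := by nlinarith
  have h₂ : L ≤ 8 * (n + 1) ^ 4 :=
    calc L ≤ (n + 1) ^ 2 := by nlinarith
      _ ≤ (n + 1) ^ 4 := Nat.pow_le_pow_right (by omega) (by norm_num)
      _ ≤ 8 * (n + 1) ^ 4 := Nat.le_mul_of_pos_left _ (by norm_num)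
  calc n * (p * p + L) ≤ (n + 1) * (4 * (n + 1) ^ 2 * (4 * (n + 1) ^ 2) + 8 * (n + 1) ^ 4) := by
        gcongr; omega
    _ = regBound n := by rw [regBound]; ring

theorem verifies_checkPoints_checking {w : List Letter} {p : ℕ} (hp : p.Prime)
    (hpn : p ≤ 2 * (2 * (w.length * w.length) + 1)) {T : Prog 33} {R : ℕ → ℕ → Prop}
    (hT : Tests (regBound w.length) T R) :
    Verifies w (regBound w.length) (.checking w p) (.checking w p) (.checkPoints T) (p * p)
      (∀ x < p, ∀ y < p, R (pointHash w p (hashes w / 2) x y).acc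
        (pointHash w p (hashes w / 2) x y).A) := by
  have hM := le_regBound w.length
  have hm : hashes w ≤ w.length := List.countP_le_length
  exact verifies_checkPoints (v := .checking w p) hT rfl rfl rfl rfl rfl rfl rfl hp.one_lt
    (by dsimp only; omega) rfl rfl (by dsimp only; omega) (by omega)

theorem multisetEquality_mem_NST : MultisetEquality ∈ NST Letter {fun _ => 1 + 2} OLog 2 := by
  refine mem_NST_of_verifies (.checkPoints .testEq) (by decide) fun w hw p hp hp₁ hp₂ => ?_
  have hM := le_regBound w.length
  refine ⟨_, _, _, verifies_checkPoints_checking hp hp₂ (tests_testEq (by omega)), rfl, rfl,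
    mul_prime_sq_le_regBound (L := 0) hp₂ (Nat.zero_le _), ?_⟩
  obtain ⟨vs, vs', hvs, hvs', rfl⟩ := hw.exists
  have hvv := hvs.trans hvs'.symm
  rw [mem_listProblem_iff hvv, Multiset.coe_eq_coe, ← hvs,
    forall_pointHash_eq_iff hp hvv (by nlinarith)]

theorem setEquality_mem_NST : SetEquality ∈ NST Letter {fun _ => 1 + 2} OLog 2 := by
  refine mem_NST_of_verifies (.checkPoints .testZero) (by decide) fun w hw p hp hp₁ hp₂ => ?_
  have hM := le_regBound w.length
  refine ⟨_, _, _, verifies_checkPoints_checking hp hp₂ (tests_testZero (by omega)), rfl, rfl,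
    mul_prime_sq_le_regBound (L := 0) hp₂ (Nat.zero_le _), ?_⟩
  obtain ⟨vs, vs', hvs, hvs', rfl⟩ := hw.exists
  have hvv := hvs.trans hvs'.symm
  rw [mem_listProblem_iff hvv, ← hvs, forall_pointHash_eq_zero_iff hp hvv (by omega)]

/-! ## Checking that a list is sorted -/

/-- The letter with index `i` of a word as a number; 0 means that there is no such letter. -/
def letterCode (v : List Bool) (i : ℕ) : ℕ := v[i]?.elim 0 fun b => b.toNat + 1

theorem letterCode_of_le {v : List Bool} {i : ℕ} (h : v.length ≤ i) : letterCode v i = 0 := by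
  simp [letterCode, h]

/-- Only the first index where the codes differ matters. The code 0 for the end of a word is the
least one, so a proper prefix precedes its extensions. -/
theorem le_iff_letterCode {u v : List Bool} :
    u ≤ v ↔ ∀ i, (∀ j < i, letterCode u j = letterCode v j) → letterCode u i ≤ letterCode v i := by
  induction u generalizing v with
  | nil =>
    refine iff_of_true ?_ fun i _ => by simp [letterCode]
    cases v with
    | nil => exact le_rfl
    | cons b v => exact (List.nil_lt_cons b v).le
  | cons a u ih =>
    cases v with
    | nil =>
      refine iff_of_false (by simp) fun h => ?_
      have := h 0 (by simp)
      simp [letterCode] at this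
    | cons b v =>
      have hle : a :: u ≤ b :: v ↔ a < b ∨ a = b ∧ u ≤ v := by
        simp only [le_iff_lt_or_eq, List.cons_lt_cons_iff, List.cons.injEq]
        tauto
      have h₀ : ∀ (c : Bool) w, letterCode (c :: w) 0 = c.toNat + 1 := fun c w => rfl
      have hs : ∀ (c : Bool) w i, letterCode (c :: w) (i + 1) = letterCode w i := fun c w i => by
        simp [letterCode]
      rw [hle, ih]
      constructor
      · rintro (hab | ⟨rfl, h⟩) i hi
        · cases i with
          | zero => rw [h₀, h₀]; revert hab; cases a <;> cases b <;> simp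
          | succ i =>
            have := hi 0 (Nat.succ_pos _)
            rw [h₀, h₀] at this
            cases a <;> cases b <;> simp_all
        · cases i with
          | zero => exact le_rfl
          | succ i =>
            rw [hs, hs]
            exact h i fun j hj => by simpa only [hs] using hi (j + 1) (by omega)
      · intro h
        have h' := h 0 (by simp)
        rw [h₀, h₀] at h'
        rcases eq_or_ne a b with rfl | hne
        · refine Or.inr ⟨rfl, fun i hi => ?_⟩
          have := h (i + 1) fun j hj => by
            cases j with
            | zero => rfl
            | succ j => rw [hs, hs]; exact hi j (by omega)
          simpa only [hs] using this
        · left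
          cases a <;> cases b <;> simp_all

/-- While the input is read: index `j` of the current word, index `i` of the next letter of this
word, and the letters that have been found. -/
structure FetchState where
  j : ℕ
  i : ℕ
  a : ℕ
  b : ℕ

/-- Look for the letters with index `r` of the words with indices `ka` and `kb`. -/
def FetchState.step (ka kb r : ℕ) (σ : FetchState) : Letter → FetchState
  | .bit c => { σ with
      a := if σ.i = r ∧ σ.j = ka then c.toNat + 1 else σ.a
      b := if σ.i = r ∧ σ.j = kb then c.toNat + 1 else σ.b
      i := σ.i + 1 }
  | .hash => { σ with j := σ.j + 1, i := 0 }

theorem FetchState.foldl_word {ka kb r : ℕ} {σ : FetchState} (hi : σ.i = 0) (v : List Bool) :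
    (v.map Letter.bit).foldl (step ka kb r) σ =
      { j := σ.j, i := v.length,
        a := if r < v.length ∧ σ.j = ka then letterCode v r else σ.a,
        b := if r < v.length ∧ σ.j = kb then letterCode v r else σ.b } := by
  induction v using List.reverseRecOn with
  | nil =>
    obtain ⟨j, i, a, b⟩ := σ
    dsimp only at hi
    subst hi
    simp
  | append_singleton v c ih =>
    rw [List.map_append, List.foldl_append, ih]
    -- With `P` as `σ.j = ka` or `σ.j = kb`, this serves the registers `a` and `b` alike.
    have key : ∀ (P : Prop) [Decidable P] (x : ℕ),
        (if v.length = r ∧ P then c.toNat + 1 else if r < v.length ∧ P then letterCode v r else x) =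
          if r < v.length + 1 ∧ P then letterCode (v ++ [c]) r else x := by
      intro P _ x
      by_cases hP : P
      · rcases Nat.lt_trichotomy r v.length with h | rfl | h
        · simp [hP, h, h.ne', Nat.lt_succ_of_lt h, letterCode]
        · simp [hP, letterCode]
        · have h₁ : v.length ≠ r := by omega
          have h₂ : ¬ r < v.length := by omega
          have h₃ : ¬ r < v.length + 1 := by omega
          simp [h₁, h₂, h₃]
      · simp [hP]
    simp only [List.map_cons, List.map_nil, List.foldl_cons, List.foldl_nil, step, key,
      List.length_append, List.length_cons, List.length_nil, Nat.zero_add]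

/-- A missing word and a missing letter both leave the initial value 0, which agrees with the code
for the default word `[]`. -/
theorem FetchState.foldl_encodeList (ka kb r : ℕ) (vs : List (List Bool)) :
    (encodeList vs).foldl (step ka kb r) ⟨0, 0, 0, 0⟩ =
      { j := vs.length, i := 0, a := letterCode (vs.getD ka []) r,
        b := letterCode (vs.getD kb []) r } := by
  induction vs using List.reverseRecOn with
  | nil => simp [encodeList, letterCode]
  | append_singleton vs v ih =>
    have key : ∀ k, (if r < v.length ∧ vs.length = k then letterCode v r else
        letterCode (vs.getD k []) r) = letterCode ((vs ++ [v]).getD k []) r := by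
      intro k
      rcases Nat.lt_trichotomy k vs.length with h | rfl | h
      · rw [if_neg (by omega), List.getD_append _ _ _ _ h]
      · rw [List.getD_append_right _ _ _ _ le_rfl]
        simp only [and_true, Nat.sub_self]
        split_ifs with h
        · rfl
        · have h₁ := letterCode_of_le (Nat.le_of_not_lt h)
          simpa [letterCode] using h₁.symm
      · rw [if_neg (by omega), List.getD_eq_default _ _ h.le,
          List.getD_eq_default _ _ (by simp; omega)]
    rw [encodeList_append, List.foldl_append, ih, encodeList_cons, List.foldl_append,
      foldl_word (by rfl)]
    simp only [encodeList, List.flatMap_nil, List.foldl_cons, List.foldl_nil, step, key,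
      List.length_append, List.length_cons, List.length_nil, Nat.zero_add]

namespace Prog

/-- Assign the code of a letter. -/
def setCode (r : Fin 33) (c : Bool) : Prog 33 := one r ⨟ bif c then inc r else ret true

/-- Read a letter and look for the letters with index `tt` of the words `ka` and `kb`. -/
def fetchLetter : Letter → Prog 33
  | .bit c =>
    ite (eq Reg.i Reg.tt)
      (ite (eq Reg.j Reg.ka) (setCode Reg.a c) (ret true) ⨟
        ite (eq Reg.j Reg.kb) (setCode Reg.b c) (ret true)) (ret true) ⨟
    inc Reg.i
  | .hash => inc Reg.j ⨟ zero Reg.i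

/-- Compare two letters if all previous letters are equal. -/
def judge : Prog 33 :=
  ite (eq Reg.res Reg.zer)
    (ite (eq Reg.a Reg.b) (ret true)
      -- Codes are at most 2, so for different codes `b < a` means `b = 0` or `a = b + 1`; tests for
      -- equality suffice.
      (one Reg.res ⨟ ite (eq Reg.b Reg.zer) (one Reg.bad)
        (inc Reg.b ⨟ ite (eq Reg.a Reg.b) (one Reg.bad) (ret true))))
    (ret true)

/-- Compare the letters with index `tt` of the words `ka` and `kb`. -/
def compareAt : Prog 33 :=
  guessWord fetchLetter ⨟ zero Reg.j ⨟ zero Reg.i ⨟ judge ⨟ zero Reg.a ⨟ zero Reg.b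

/-- Set the flag `bad` if the word `ka` is greater than the word `kb`. -/
def compareWords : Prog 33 := forLoop Reg.tt Reg.n compareAt ⨟ zero Reg.res

/-- Set the flag `bad` if the second half of the input is not sorted. -/
def checkSorted : Prog 33 :=
  copy Reg.c₁ Reg.m Reg.ka ⨟ copy Reg.c₁ Reg.m Reg.kb ⨟
    forLoop Reg.k Reg.m (compareWords ⨟ copy Reg.c₁ Reg.kb Reg.ka ⨟ inc Reg.kb)

end Prog

/-- Assign the state of the search for letters. -/
abbrev Vars.withFetch (v : Vars) (σ : FetchState) : Vars :=
  { v with j := σ.j, i := σ.i, a := σ.a, b := σ.b }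

namespace Runs

open Prog Vars

variable {M : ℕ}

theorem setCode {i : Fin 33} (hi : 2 ≤ i.val) {s : St 33} (hs : s.reg i ≤ M) (hM : 1 ≤ M)
    (c : Bool) : Runs 2 M (.setCode i c) s [] true (s.set i (c.toNat + 1)) := by
  have h₁ := Runs.one hi hs
  cases c with
  | false => exact h₁.seq₀ (Runs.ret true)
  | true =>
    have h₂ := Runs.inc (s := s.set i 1) (M := M) hi (by simpa using hM)
    rw [St.reg_set_self, St.set_set] at h₂
    exact h₁.seq₀ h₂

theorem fetchLetter (v : Vars) {σ : FetchState} (hM : 2 ≤ M) (hj : σ.j ≤ M) (hi : σ.i ≤ M)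
    (ha : σ.a ≤ 2) (hb : σ.b ≤ 2) (hka : v.ka ≤ M) (hkb : v.kb ≤ M) (htt : v.tt ≤ M) (a : Letter) :
    Runs 2 M (.fetchLetter a) (v.withFetch σ).idle.st [] true
      (v.withFetch (σ.step v.ka v.kb v.tt a)).idle.st := by
  obtain ⟨j, i, a₀, b₀⟩ := σ
  dsimp only at hj hi ha hb
  cases a with
  | hash =>
    have h₁ := Runs.inc (s := (v.withFetch ⟨j, i, a₀, b₀⟩).idle.st) (t := 2) (M := M) (i := Reg.j)
      (by decide) (by simpa using hj)
    have h₂ := Runs.zero (s := (v.withFetch ⟨j + 1, i, a₀, b₀⟩).idle.st) (t := 2) (M := M)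
      (i := Reg.i) (by decide) (by simpa using hi)
    simp only [reg_j, set_j, set_i] at h₁ h₂
    exact h₁.seq₀ h₂
  | bit c =>
    have hcode : ∀ P : Prop, [Decidable P] → ∀ x, x ≤ 2 → (if P then c.toNat + 1 else x) ≤ 2 := by
      intro P _ x hx
      have := c.toNat_le
      split_ifs <;> omega
    have h₁ := Runs.eq_true (s := (v.withFetch ⟨j, i, a₀, b₀⟩).idle.st) (t := 2) (M := M)
      (i := Reg.i) (j := Reg.tt) (by decide) (by decide) (by decide) (by simpa using hi)
    have h₁' := Runs.eq_false (s := (v.withFetch ⟨j, i, a₀, b₀⟩).idle.st) (t := 2) (M := M)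
      (i := Reg.i) (j := Reg.tt) (by decide) (by decide) (by decide) (by simpa using hi)
      (by simpa using htt)
    have h₂ : ∃ b, Runs 2 M (.ite (.eq Reg.j Reg.ka) (.setCode Reg.a c) (.ret true))
        (v.withFetch ⟨j, i, a₀, b₀⟩).idle.st [] b
        (v.withFetch ⟨j, i, if j = v.ka then c.toNat + 1 else a₀, b₀⟩).idle.st := by
      split_ifs with h
      · have e := setCode (i := Reg.a) (by decide) (s := (v.withFetch ⟨j, i, a₀, b₀⟩).idle.st)
          (M := M) (by simp; omega) (by omega) c
        simp only [set_a] at e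
        exact ⟨_, (Runs.eq_true (by decide) (by decide) (by decide) (by simpa using hj)
          (by simpa using h)).ite_true e⟩
      · exact ⟨_, (Runs.eq_false (by decide) (by decide) (by decide) (by simpa using hj)
          (by simpa using hka) (by simpa using h)).ite_false (Runs.ret true)⟩
    have h₃ : ∀ a, ∃ b, Runs 2 M (.ite (.eq Reg.j Reg.kb) (.setCode Reg.b c) (.ret true))
        (v.withFetch ⟨j, i, a, b₀⟩).idle.st [] b
        (v.withFetch ⟨j, i, a, if j = v.kb then c.toNat + 1 else b₀⟩).idle.st := by
      intro a
      split_ifs with h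
      · have e := setCode (i := Reg.b) (by decide) (s := (v.withFetch ⟨j, i, a, b₀⟩).idle.st)
          (M := M) (by simp; omega) (by omega) c
        simp only [set_b] at e
        exact ⟨_, (Runs.eq_true (by decide) (by decide) (by decide) (by simpa using hj)
          (by simpa using h)).ite_true e⟩
      · exact ⟨_, (Runs.eq_false (by decide) (by decide) (by decide) (by simpa using hj)
          (by simpa using hkb) (by simpa using h)).ite_false (Runs.ret true)⟩
    have h₄ := fun a b => Runs.inc (s := (v.withFetch ⟨j, i, a, b⟩).idle.st) (t := 2) (M := M)
      (i := Reg.i) (by decide) (by simpa using hi)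
    simp only [reg_i, reg_tt, set_i] at h₁ h₁' h₄
    obtain ⟨_, h₂⟩ := h₂
    obtain ⟨_, h₃⟩ := h₃ (if j = v.ka then c.toNat + 1 else a₀)
    by_cases he : i = v.tt
    · simp only [FetchState.step, he, true_and]
      simp only [he] at h₁ h₂ h₃ h₄
      exact ((h₁ trivial).ite_true (h₂.seq₀ h₃)).seq₀ (h₄ _ _)
    · simp only [FetchState.step, he, false_and, if_false]
      exact ((h₁' he).ite_false (Runs.ret true)).seq₀ (h₄ _ _)

theorem judge (v : Vars) (hM : 3 ≤ M) (ha : v.a ≤ 2) (hb : v.b ≤ 2) (hres : v.res ≤ 1)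
    (hbad : v.bad ≤ 1) : ∃ c b, b ≤ 3 ∧ Runs 2 M .judge v.idle.st [] c
      { v.idle with
        res := if v.res = 0 ∧ v.a ≠ v.b then 1 else v.res,
        bad := if v.res = 0 ∧ v.b < v.a then 1 else v.bad,
        b := b }.st := by
  have h₁ := Runs.eq_true (s := v.idle.st) (t := 2) (M := M)
    (i := Reg.res) (j := Reg.zer) (by decide) (by decide) (by decide) (by simp; omega)
  have h₁' := Runs.eq_false (s := v.idle.st) (t := 2) (M := M)
    (i := Reg.res) (j := Reg.zer) (by decide) (by decide) (by decide) (by simp; omega) (by simp)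
  have h₂ := Runs.eq_true (s := v.idle.st) (t := 2) (M := M)
    (i := Reg.a) (j := Reg.b) (by decide) (by decide) (by decide) (by simp; omega)
  have h₂' := Runs.eq_false (s := v.idle.st) (t := 2) (M := M)
    (i := Reg.a) (j := Reg.b) (by decide) (by decide) (by decide) (by simp; omega) (by simp; omega)
  have h₃ := Runs.one (s := v.idle.st) (t := 2) (M := M) (i := Reg.res) (by decide)
    (by simp; omega)
  have h₄ := Runs.eq_true (s := { v.idle with res := 1 }.st) (t := 2) (M := M)
    (i := Reg.b) (j := Reg.zer) (by decide) (by decide) (by decide) (by simp; omega)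
  have h₄' := Runs.eq_false (s := { v.idle with res := 1 }.st) (t := 2) (M := M)
    (i := Reg.b) (j := Reg.zer) (by decide) (by decide) (by decide) (by simp; omega) (by simp)
  have h₅ := fun b => Runs.one (s := { v.idle with res := 1, b := b }.st) (t := 2) (M := M)
    (i := Reg.bad) (by decide) (by simp; omega)
  have h₆ := Runs.inc (s := { v.idle with res := 1 }.st) (t := 2) (M := M) (i := Reg.b) (by decide)
    (by simp; omega)
  have h₇ := Runs.eq_true (s := { v.idle with res := 1, b := v.b + 1 }.st) (t := 2) (M := M)
    (i := Reg.a) (j := Reg.b) (by decide) (by decide) (by decide) (by simp; omega)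
  have h₇' := Runs.eq_false (s := { v.idle with res := 1, b := v.b + 1 }.st) (t := 2) (M := M)
    (i := Reg.a) (j := Reg.b) (by decide) (by decide) (by decide) (by simp; omega) (by simp; omega)
  simp only [reg_res, reg_zer, reg_a, reg_b, set_res, set_bad, set_b]
    at h₁ h₁' h₂ h₂' h₃ h₄ h₄' h₅ h₆ h₇ h₇'
  generalize hr' : (if v.res = 0 ∧ v.a ≠ v.b then 1 else v.res) = r'
  generalize hb' : (if v.res = 0 ∧ v.b < v.a then 1 else v.bad) = β'
  by_cases hr : v.res = 0
  · by_cases hab : v.a = v.b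
    · rw [if_neg (by simp [hab])] at hr' hb'
      subst hr' hb'
      exact ⟨_, v.b, by omega, (h₁ hr).ite_true ((h₂ hab).ite_true (Runs.ret true))⟩
    · rw [if_pos ⟨hr, hab⟩] at hr'
      by_cases hb0 : v.b = 0
      · rw [if_pos ⟨hr, by omega⟩] at hb'
        subst hr' hb'
        exact ⟨_, v.b, by omega, (h₁ hr).ite_true ((h₂' hab).ite_false
          (h₃.seq₀ ((h₄ hb0).ite_true (h₅ _))))⟩
      · by_cases ha1 : v.a = v.b + 1
        · rw [if_pos ⟨hr, by omega⟩] at hb'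
          subst hr' hb'
          exact ⟨_, v.b + 1, by omega, (h₁ hr).ite_true ((h₂' hab).ite_false
            (h₃.seq₀ ((h₄' hb0).ite_false (h₆.seq₀ ((h₇ ha1).ite_true (h₅ _))))))⟩
        · rw [if_neg (by omega)] at hb'
          subst hr' hb'
          exact ⟨_, v.b + 1, by omega, (h₁ hr).ite_true ((h₂' hab).ite_false
            (h₃.seq₀ ((h₄' hb0).ite_false (h₆.seq₀ ((h₇' ha1).ite_false (Runs.ret true))))))⟩
  · rw [if_neg (by simp [hr])] at hr' hb'
    subst hr' hb'
    exact ⟨_, v.b, by omega, (h₁' hr).ite_false (Runs.ret true)⟩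

end Runs

namespace Runs

open Prog Vars

variable {M : ℕ}

theorem compareAt (v : Vars) {w : List Letter} (hn : v.n = w.length) (hc : v.c₀ = 0) (hj : v.j = 0)
    (hi : v.i = 0) (ha : v.a = 0) (hb : v.b = 0) (hka : v.ka ≤ M) (hkb : v.kb ≤ M)
    (htt : v.tt ≤ M) (hres : v.res ≤ 1) (hM : w.length + 3 ≤ M) {z : List Letter} {β : ℕ}
    (hβ : β ≤ 1) (hz : z.length + w.length ≤ M) {cs : List Bool} (hcs : cs.length = 2 * w.length)
    {σ : FetchState}
    (hσ : (decodeBits cs).foldl (FetchState.step v.ka v.kb v.tt) ⟨0, 0, 0, 0⟩ = σ) :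
    ∃ b, Runs 2 M .compareAt (v.guessed w z β).idle.st cs b
      ({ v with res := if v.res = 0 ∧ σ.a ≠ σ.b then 1 else v.res }.guessed w (z ++ decodeBits cs)
        (if v.res = 0 ∧ σ.b < σ.a then 1 else β)).idle.st := by
  have hv : v.withFetch ⟨0, 0, 0, 0⟩ = v := by
    cases v
    dsimp only at hj hi ha hb
    subst hj hi ha hb
    rfl
  obtain ⟨h₁, hσj, hσi, hσa, hσb⟩ := Runs.guessWord (M := M) (body := .fetchLetter) w
    (fun σ : FetchState => v.withFetch σ) (FetchState.step v.ka v.kb v.tt)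
    (fun k σ => σ.j ≤ k ∧ σ.i ≤ k ∧ σ.a ≤ 2 ∧ σ.b ≤ 2) (fun _ => hc) (fun _ => hn) (by
      rintro k hk σ ⟨hσj, hσi, hσa, hσb⟩ z β a
      refine ⟨_, fetchLetter ({ v with c₀ := k }.guessed w z β) (by omega) (by omega) (by omega)
        hσa hσb hka hkb htt a, ?_⟩
      cases a with
      | hash => exact ⟨Nat.succ_le_succ hσj, Nat.zero_le _, hσa, hσb⟩
      | bit c =>
        have := c.toNat_le
        refine ⟨hσj.trans (Nat.le_succ k), Nat.succ_le_succ hσi, ?_, ?_⟩ <;>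
          simp only [FetchState.step] <;> split_ifs <;> omega)
    (σ := ⟨0, 0, 0, 0⟩) ⟨le_rfl, le_rfl, Nat.zero_le _, Nat.zero_le _⟩ z β hz hcs
  rw [hσ] at h₁ hσj hσi hσa hσb
  rw [hv] at h₁
  obtain ⟨j, i, a, b⟩ := σ
  dsimp only at hσj hσi hσa hσb ⊢
  generalize z ++ decodeBits cs = z' at h₁ ⊢
  have h₂ := Runs.zero (s := ((v.withFetch ⟨j, i, a, b⟩).guessed w z' β).idle.st) (t := 2) (M := M)
    (i := Reg.j) (by decide) (by simp; omega)
  have h₃ := Runs.zero (s := ((v.withFetch ⟨0, i, a, b⟩).guessed w z' β).idle.st) (t := 2) (M := M)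
    (i := Reg.i) (by decide) (by simp; omega)
  obtain ⟨_, b', hb', h₄⟩ := Runs.judge (M := M) ((v.withFetch ⟨0, 0, a, b⟩).guessed w z' β)
    (by omega) hσa hσb hres hβ
  dsimp only at h₄
  generalize (if v.res = 0 ∧ a ≠ b then 1 else v.res) = r' at h₄ ⊢
  generalize (if v.res = 0 ∧ b < a then 1 else β) = β' at h₄ ⊢
  have h₅ := Runs.zero (s := (({ v with res := r' }.withFetch ⟨0, 0, a, b'⟩).guessed w z' β').idle.st)
    (t := 2) (M := M) (i := Reg.a) (by decide) (by simp; omega)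
  have h₆ := Runs.zero (s := (({ v with res := r' }.withFetch ⟨0, 0, 0, b'⟩).guessed w z' β').idle.st)
    (t := 2) (M := M) (i := Reg.b) (by decide) (by simp; omega)
  simp only [set_j, set_i, set_a, set_b] at h₂ h₃ h₅ h₆
  have hv' : ({ v with res := r' }.withFetch ⟨0, 0, 0, 0⟩).guessed w z' β' =
      { v with res := r' }.guessed w z' β' := by
    cases v
    dsimp only at hj hi ha hb
    subst hj hi ha hb
    rfl
  rw [← hv']
  have h := h₁.seq (h₂.seq₀ (h₃.seq₀ (h₄.seq₀ (h₅.seq₀ h₆))))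
  rw [List.append_nil] at h
  exact ⟨_, h⟩

end Runs

/-- The state after the search for the letters with index `r` of the words `ka` and `kb`. -/
def fetched (w : List Letter) (ka kb r : ℕ) : FetchState :=
  w.foldl (FetchState.step ka kb r) ⟨0, 0, 0, 0⟩

open Prog Vars in
-- The register `res` is 0 as long as all previous letters agree, so only the first difference is
-- judged. No word is longer than the input, which is why `w.length` rounds are made.
theorem verifies_compareWords {M : ℕ} {w : List Letter} {v : Vars} (hn : v.n = w.length)
    (hc : v.c₀ = 0) (hj : v.j = 0) (hi : v.i = 0) (ha : v.a = 0) (hb : v.b = 0) (htt : v.tt = 0)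
    (hres : v.res = 0) (hka : v.ka ≤ M) (hkb : v.kb ≤ M) (hM : w.length + 3 ≤ M) :
    Verifies w M v v .compareWords w.length
      (∀ i < w.length, (∀ s < i, (fetched w v.ka v.kb s).a = (fetched w v.ka v.kb s).b) →
        (fetched w v.ka v.kb i).a ≤ (fetched w v.ka v.kb i).b) := by
  intro z β cs hcs hβ hzM
  obtain ⟨s', h₁, h₂, β', hβ', r, hr, rfl, h₄⟩ := Runs.forLoop (t := 2) (M := M) (c := Reg.tt)
    (x := Reg.n) (N := w.length) (p := .compareAt) (by decide) (by decide) (by decide) (by omega)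
    -- Both flags stay in the range 0 to 1 in any case, but they have a meaning only if the blocks
    -- guessed so far are correct.
    (fun k cs s => cs.length = 2 * (w.length * k) ∧ ∃ β' ≤ 1, ∃ r ≤ 1,
      s = ({ v with res := r }.guessed w (z ++ decodeBits cs) β').idle.st ∧
      (decodeBits cs = wordPow w k →
        (r = 0 ↔ ∀ s < k, (fetched w v.ka v.kb s).a = (fetched w v.ka v.kb s).b) ∧
        (β' = 0 ↔ β = 0 ∧ ∀ i < k,
          (∀ s < i, (fetched w v.ka v.kb s).a = (fetched w v.ka v.kb s).b) →
            (fetched w v.ka v.kb i).a ≤ (fetched w v.ka v.kb i).b)))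
    (fun _ => 2 * w.length) (by rintro i cs s ⟨-, β', -, r, -, rfl, -⟩; exact ⟨htt, hn⟩) (by
      rintro k cs s hk ⟨hcs, β', hβ', r, hr, rfl, hQ⟩ ds hds
      have hle : w.length * k + w.length ≤ w.length * w.length := by
        rw [← Nat.mul_succ]
        exact Nat.mul_le_mul_left _ hk
      obtain ⟨σ, hσ⟩ : ∃ σ, (decodeBits ds).foldl (FetchState.step v.ka v.kb k) ⟨0, 0, 0, 0⟩ = σ :=
        ⟨_, rfl⟩
      obtain ⟨b, h⟩ := Runs.compareAt (M := M) { v with res := r, tt := k } hn hc hj hi ha hb hka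
        hkb (by dsimp only; omega) hr hM (z := z ++ decodeBits cs) hβ'
        (by rw [List.length_append, length_decodeBits _ hcs]; omega) hds hσ
      refine ⟨b, _, ?_, ?_, if r = 0 ∧ σ.b < σ.a then 1 else β', ?_,
        if r = 0 ∧ σ.a ≠ σ.b then 1 else r, ?_, rfl, fun hd => ?_⟩
      · rw [decodeBits_append _ hcs, ← List.append_assoc z]
        simp only [set_tt]
        exact h
      · rw [List.length_append, hcs, hds]; ring
      · split_ifs <;> omega
      · split_ifs <;> omega
      · clear h
        obtain ⟨e, e'⟩ := Verifies.wordPow_split hcs hd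
        rw [wordPow_one] at e'
        obtain ⟨hQ₁, hQ₂⟩ := hQ e
        obtain rfl : fetched w v.ka v.kb k = σ := by rw [← hσ, e', fetched]
        constructor
        · rw [Nat.forall_lt_succ_right, ← hQ₁]
          split_ifs <;> simp <;> tauto
        · rw [Nat.forall_lt_succ_right, ← and_assoc, ← hQ₂, ← hQ₁]
          split_ifs <;> grind)
    (s := (v.guessed w z β).idle.st) ⟨rfl, β, hβ, 0, Nat.zero_le _, by
      cases v
      dsimp only at hres
      subst hres
      simp [decodeBits], by simp⟩ (cs := cs)
    (by simp [hcs]; ring)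
  have h₅ := Runs.zero (s := ({ v with res := r }.guessed w (z ++ decodeBits cs) β').idle.st)
    (t := 2) (M := M) (i := Reg.res) (by decide) (by simp; omega)
  simp only [set_res] at h₅
  have hv : { v with res := 0 }.guessed w (z ++ decodeBits cs) β' =
      v.guessed w (z ++ decodeBits cs) β' := by
    cases v
    dsimp only at hres
    subst hres
    rfl
  have h := h₁.seq h₅
  rw [List.append_nil] at h
  refine ⟨true, β', hβ', ?_, fun hd => (h₄ hd).2⟩
  rw [← hv]
  exact h

open Prog Vars in
-- Words are numbered from 0 here, so the second half starts at `v.m`. In iteration 0 the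
-- subtraction `k - 1` is truncated and word `v.m` is compared with itself, which is harmless and
-- saves a special case.
theorem verifies_checkSorted {M : ℕ} {w : List Letter} {v : Vars} (hn : v.n = w.length)
    (hc : v.c₀ = 0) (hj : v.j = 0) (hi : v.i = 0) (ha : v.a = 0) (hb : v.b = 0)
    (htt : v.tt = 0) (hres : v.res = 0) (hk : v.k = 0) (hka : v.ka ≤ M) (hkb : v.kb ≤ M)
    (hM : w.length + 3 ≤ M) (hm : 2 * v.m ≤ M) :
    Verifies w M v { v with ka := v.m + (v.m - 1), kb := v.m + v.m } .checkSorted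
      (w.length * v.m) (∀ k < v.m, ∀ i < w.length,
        (∀ s < i, (fetched w (v.m + (k - 1)) (v.m + k) s).a =
          (fetched w (v.m + (k - 1)) (v.m + k) s).b) →
        (fetched w (v.m + (k - 1)) (v.m + k) i).a ≤ (fetched w (v.m + (k - 1)) (v.m + k) i).b) := by
  have h₁ : Verifies w M v { v with ka := v.m } (.copy Reg.c₁ Reg.m Reg.ka) 0 True :=
    .of_runs fun z β _ => by
      have h := Runs.copy (s := (v.guessed w z β).idle.st) (t := 2) (M := M)
        (c := Reg.c₁) (a := Reg.m) (d := Reg.ka) (by decide) (by decide) (by decide) (by decide)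
        (by decide) (by decide) rfl (by simp; omega) (by simpa using hka)
      simp only [reg_m, set_ka] at h
      exact ⟨_, h⟩
  have h₂ : Verifies w M { v with ka := v.m } { v with ka := v.m, kb := v.m }
      (.copy Reg.c₁ Reg.m Reg.kb) 0 True :=
    .of_runs fun z β _ => by
      have h := Runs.copy (s := ({ v with ka := v.m }.guessed w z β).idle.st) (t := 2) (M := M)
        (c := Reg.c₁) (a := Reg.m) (d := Reg.kb) (by decide) (by decide) (by decide) (by decide)
        (by decide) (by decide) rfl (by simp; omega) (by simpa using hkb)
      simp only [reg_m, set_kb] at h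
      exact ⟨_, h⟩
  have h₃ := Verifies.forLoop (w := w) (M := M) (c := Reg.k) (r := Reg.m) (L := w.length) (N := v.m)
    (C := .compareWords ⨟ .copy Reg.c₁ Reg.kb Reg.ka ⨟ .inc Reg.kb)
    (P := fun k => ∀ i < w.length,
        (∀ s < i, (fetched w (v.m + (k - 1)) (v.m + k) s).a =
          (fetched w (v.m + (k - 1)) (v.m + k) s).b) →
        (fetched w (v.m + (k - 1)) (v.m + k) i).a ≤ (fetched w (v.m + (k - 1)) (v.m + k) i).b)
    (by decide) (by decide) (by decide) (by omega)
    (V := fun k => { v with ka := v.m + (k - 1), kb := v.m + k })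
    (U := fun k => { v with ka := v.m + (k - 1), kb := v.m + k, k := k })
    (U' := fun k => { v with ka := v.m + k, kb := v.m + (k + 1), k := k })
    (fun _ _ _ => hk) (fun _ _ _ => rfl) (fun _ _ _ => set_k _ _) (fun _ _ _ => set_k _ _) ?_
  · exact (h₁.seq (h₂.seq h₃)).congr (by omega) (by simp)
  · intro k hkm
    have e₁ := verifies_compareWords (M := M) (w := w)
      (v := { v with ka := v.m + (k - 1), kb := v.m + k, k := k }) hn hc hj hi ha hb htt hres
      (by dsimp only; omega) (by dsimp only; omega) hM
    have e₂ : Verifies w M { v with ka := v.m + (k - 1), kb := v.m + k, k := k }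
        { v with ka := v.m + k, kb := v.m + k, k := k } (.copy Reg.c₁ Reg.kb Reg.ka) 0 True :=
      .of_runs fun z β _ => by
        have h := Runs.copy
          (s := ({ v with ka := v.m + (k - 1), kb := v.m + k, k := k }.guessed w z β).idle.st)
          (t := 2) (M := M) (c := Reg.c₁) (a := Reg.kb) (d := Reg.ka) (by decide) (by decide)
          (by decide) (by decide) (by decide) (by decide) rfl (by simp; omega) (by simp; omega)
        simp only [reg_kb, set_ka] at h
        exact ⟨_, h⟩
    have e₃ : Verifies w M { v with ka := v.m + k, kb := v.m + k, k := k }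
        { v with ka := v.m + k, kb := v.m + (k + 1), k := k } (.inc Reg.kb) 0 True :=
      .of_runs fun z β _ => by
        have h := Runs.inc
          (s := ({ v with ka := v.m + k, kb := v.m + k, k := k }.guessed w z β).idle.st)
          (t := 2) (M := M) (i := Reg.kb) (by decide) (by simp; omega)
        simp only [reg_kb, set_kb] at h
        exact ⟨_, h⟩
    exact (e₁.seq (e₂.seq e₃)).congr (by omega) (by simp)

theorem fetched_encodeList (vs : List (List Bool)) (ka kb r : ℕ) :
    fetched (encodeList vs) ka kb r =
      { j := vs.length, i := 0,
        a := letterCode (vs.getD ka []) r, b := letterCode (vs.getD kb []) r } :=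
  FetchState.foldl_encodeList ka kb r vs

theorem length_getD_le (vs : List (List Bool)) (k : ℕ) :
    (vs.getD k []).length ≤ (encodeList vs).length := by
  induction vs generalizing k with
  | nil => simp
  | cons v vs ih =>
    rw [encodeList_cons]
    cases k with
    | zero => simp
    | succ k =>
      have := ih k
      simp only [List.getD_cons_succ, List.length_append, List.length_cons]
      omega

/-- By transitivity it suffices to compare neighbours. Indices beyond the input length need no test,
since all codes are 0 there. -/
theorem forall_fetched_iff {vs vs' : List (List Bool)} (h : vs.length = vs'.length) :
    (∀ k < vs.length, ∀ i < (encodeList vs ++ encodeList vs').length,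
        (∀ s < i, (fetched (encodeList vs ++ encodeList vs') (vs.length + (k - 1))
            (vs.length + k) s).a =
          (fetched (encodeList vs ++ encodeList vs') (vs.length + (k - 1)) (vs.length + k) s).b) →
        (fetched (encodeList vs ++ encodeList vs') (vs.length + (k - 1)) (vs.length + k) i).a ≤
          (fetched (encodeList vs ++ encodeList vs') (vs.length + (k - 1)) (vs.length + k) i).b) ↔
      vs'.Pairwise (fun x y => x ≤ y) := by
  have hle : ∀ k l, (∀ i < (encodeList (vs ++ vs')).length,
      (∀ s < i, letterCode ((vs ++ vs').getD k []) s = letterCode ((vs ++ vs').getD l []) s) →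
        letterCode ((vs ++ vs').getD k []) i ≤ letterCode ((vs ++ vs').getD l []) i) ↔
      (vs ++ vs').getD k [] ≤ (vs ++ vs').getD l [] := by
    intro k l
    rw [le_iff_letterCode]
    refine forall_congr' fun i => ⟨fun H => ?_, fun H _ => H⟩
    rcases Nat.lt_or_ge i (encodeList (vs ++ vs')).length with hi | hi
    · exact H hi
    · intro _
      rw [letterCode_of_le ((length_getD_le _ _).trans hi)]
      exact Nat.zero_le _
  have hget : ∀ k, (vs ++ vs').getD (vs.length + k) [] = vs'.getD k [] := fun k => by
    rw [List.getD_append_right _ _ _ _ (Nat.le_add_right _ _), Nat.add_sub_cancel_left]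
  rw [← encodeList_append]
  simp only [fetched_encodeList]
  simp only [hle]
  simp only [hget]
  rw [← List.isChain_iff_pairwise, List.isChain_iff_getElem]
  constructor
  · intro H i hi
    have := H (i + 1) (by omega)
    rwa [Nat.add_sub_cancel, List.getD_eq_getElem _ _ hi, List.getD_eq_getElem _ _ (by omega)] at this
  · intro H k hk
    cases k with
    | zero => exact le_refl (vs'.getD 0 [])
    | succ k =>
      rw [Nat.add_sub_cancel, List.getD_eq_getElem _ _ (by omega),
        List.getD_eq_getElem _ _ (by omega)]
      exact H k (by omega)

theorem checkSort_mem_NST : CheckSort ∈ NST Letter {fun _ => 1 + 2} OLog 2 := by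
  refine mem_NST_of_verifies (.checkPoints .testEq ⨟ .checkSorted) (by decide)
    fun w hw p hp hp₁ hp₂ => ?_
  have hM := le_regBound w.length
  have hm : hashes w ≤ w.length := List.countP_le_length
  refine ⟨_, _, _, (verifies_checkPoints_checking hp hp₂ (tests_testEq (by omega))).seq
    (verifies_checkSorted (v := .checking w p) rfl rfl rfl rfl rfl rfl rfl rfl rfl
      (Nat.zero_le _) (Nat.zero_le _) (by omega) (by dsimp only; omega)), rfl, rfl,
    mul_prime_sq_le_regBound hp₂ (Nat.mul_le_mul_left _ (by dsimp only; omega)), ?_⟩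
  obtain ⟨vs, vs', hvs, hvs', rfl⟩ := hw.exists
  have hvv := hvs.trans hvs'.symm
  rw [mem_listProblem_iff hvv]
  dsimp only
  rw [← hvs, forall_pointHash_eq_iff hp hvv (by nlinarith), forall_fetched_iff hvv]

theorem theorem8 :
    (MultisetEquality ∈ co (RST Letter {fun _ => 2} OLog 1) ∧
      ∀ α : Type, co (RST α {fun _ => 2} OLog 1) ⊆ co (NST α {fun _ => 2} OLog 1)) ∧
    MultisetEquality ∈ NST Letter {fun _ => 3} OLog 2 ∧
    CheckSort ∈ NST Letter {fun _ => 3} OLog 2 ∧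
    SetEquality ∈ NST Letter {fun _ => 3} OLog 2 :=
  ⟨⟨multisetEquality_compl_mem_RST, fun α _ hL => RST_subset_NST α _ _ _ hL⟩,
    multisetEquality_mem_NST, checkSort_mem_NST, setEquality_mem_NST⟩
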